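/- **Setting.** Work over $\mathbb{C}$. Let $\mathcal D$ be the following locally graded $\mathbb{C}$-linear (strict) 2-category. Objects are the integers $n\ge 0$. The 1-morphisms $n\to n$ are the finite words in the colors $1,\dots,n-1$; there are no 1-morphisms $m\to n$ for $m\ne n$; composition $\circ_1$ of 1-morphisms is concatenation. The 2-morphisms between two words over $n$ are the type $A_{n-1}$ ($\mathfrak{gl}_n$) Soergel diagrams modulo relations: linear combinations of vertical composites of horizontally whiskered generators, namely the merge $ii\to i$ and split $i\to ii$ (degree $-1$), the dots $\emptyset\to i$ and $i\to\emptyset$ (degree $1$), the six-valent vertices $iji\to jij$ for $|i-j|=1$ (degree $0$), the crossings $ij\to ji$ for $|i-j|>1$ (degree $0$) and boxes $x_1,\dots,x_n$ (degree $2$); the relations (imposed locally) are the interchange law, the Frobenius algebra relations for each color, rotation invariance of six-valent vertices and crossings, polynomial forcing ($x_k\,|_i = |_i\,s_i(x_k) + \partial_i(x_k)\cdot(\text{end dot followed by start dot})$), the barbell relation ($=x_i-x_{i+1}$), the needle relation, the two-color relations (six-valent vertex with a dot; six-valent vertex with a trivalent vertex; dots and trivalent vertices pass through crossings), and the three-color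 relations ($A_1\times A_1\times A_1$, $A_2\times A_1$, and Zamolodchikov $A_3$). Vertical composition $\circ_2$ is stacking and horizontal composition $\circ_1$ is juxtaposition. The tensor product is $m\boxtimes n=m+n$ on objects; $m\boxtimes -$ adds $m$ to all colors and variable indices, and $-\boxtimes n$ leaves diagrams unchanged; the unit object is $0$. For words $c$ over $m$ and $c'$ over $n$, the tensorator $\boxtimes_{c,c'}\colon (c\boxtimes \mathrm{id}_n)\circ_1(\mathrm{id}_m\boxtimes c')\to(\mathrm{id}_m\boxtimes c')\circ_1(c\boxtimes\mathrm{id}_n)$ is the shuffle diagram in which every strand of $c$ crosses every strand of $\mathrm{id}_m\boxtimes c'$ once. Define $K^b_{\mathrm{loc}}(\mathcal D)$ by applying $K^b$ hom-category-wise. Objects are those of $\mathcal D$. A 1-morphism is a bounded complex: a finite ordered list of 1-morphisms of $\mathcal D$ with homological shifts $\Sigma^{s}$ and internal grading shifts, together with a matrix $d$ of 2-morphisms of cohomological degree $1$ and internal degree $0$ with $d\circ d=0$. A 2-morphism is a chain map (closed, of cohomological degree $0$) modulo homotopy, graded by the internal degree. Composition of 1-morphisms is the total complex with terms $\Sigma^{s+t}(Y^i\circ_1X^j)$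 in lexicographic order and differential $d_Y\circ_1\mathrm{id}+\mathrm{id}\circ_1d_X$ with Koszul signs; $\circ_1$ of chain maps is the Koszul-signed Kronecker product. **Theorem.** $K^b_{\mathrm{loc}}(\mathcal D)$ is a locally graded $\mathbb{C}$-linear 2-category: the 2-morphism spaces are graded vector spaces, vertical and horizontal composition are bilinear and respect degrees, and composition is strictly associative and unital. It carries a semistrict monoidal structure (Gray monoid structure), as follows. The tensor product on objects and the unit object are those of $\mathcal D$. The operations $m\boxtimes-$ and $-\boxtimes n$ on 1- and 2-morphisms are the termwise extensions of those of $\mathcal D$. The tensorator $\boxtimes_{c,c'}$ of complexes $c,c'$ is the homotopy class of the matrix whose only non-zero components send the term $(c^i\boxtimes\mathrm{id})\circ_1(\mathrm{id}\boxtimes c'^j)$, where $c^i$ and $c'^j$ carry the homological shifts $\Sigma^s$ and $\Sigma^t$, to the corresponding term $(\mathrm{id}\boxtimes c'^j)\circ_1(c^i\boxtimes\mathrm{id})$ by $(-1)^{st}$ times the shuffle crossing of $\mathcal D$; in particular this matrix is a chain map. Explicitly, the following hold: $m\boxtimes-$ and $-\boxtimes n$ are degree-preserving linear strict 2-functors;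 the tensor product with objects is strictly unital and strictly associative; the tensorators are 2-isomorphisms of degree $0$, natural in both arguments, compatible with tensoring by objects ($\boxtimes_{m\boxtimes g,h}=m\boxtimes(\boxtimes_{g,h})$, $\boxtimes_{f\boxtimes m,h}=\boxtimes_{f,m\boxtimes h}$, $\boxtimes_{f,g\boxtimes m}=(\boxtimes_{f,g})\boxtimes m$), equal to identities when one argument is an identity 1-morphism, and multiplicative with respect to $\circ_1$ in each argument. -/

import Mathlib

noncomputable section

namespace SoergelGray

/-! ## Subquotients of modules -/

section Subquotients

variable {k : Type} [Field k] {M M₁ M₂ M₃ : Type}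
  [AddCommGroup M] [Module k M] [AddCommGroup M₁] [Module k M₁]
  [AddCommGroup M₂] [Module k M₂] [AddCommGroup M₃] [Module k M₃]

/-- The subquotient `Z / (B ∩ Z)` of a module, for submodules `Z` and `B`. -/
abbrev SubQuot (Z B : Submodule k M) : Type := ↥Z ⧸ B.submoduleOf Z

/-- The class of an element of `Z`. -/
def SubQuot.cls {Z B : Submodule k M} (x : M) (hx : x ∈ Z) : SubQuot Z B :=
  (B.submoduleOf Z).mkQ ⟨x, hx⟩

theorem SubQuot.cls_eq {Z B : Submodule k M} {x y : M} (hx : x ∈ Z) (hy : y ∈ Z)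
    (h : x - y ∈ B) : (SubQuot.cls x hx : SubQuot Z B) = SubQuot.cls y hy :=
  (Submodule.Quotient.eq _).2 h

theorem SubQuot.cls_congr {Z B : Submodule k M} {x y : M} (hx : x ∈ Z) (h : x = y) :
    (SubQuot.cls x hx : SubQuot Z B) = SubQuot.cls y (h ▸ hx) := by
  subst h; rfl

theorem SubQuot.exists_cls {Z B : Submodule k M} (x : SubQuot Z B) :
    ∃ y, ∃ hy : y ∈ Z, x = SubQuot.cls y hy := by
  obtain ⟨⟨y, hy⟩, rfl⟩ := Submodule.mkQ_surjective _ x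
  exact ⟨y, hy, rfl⟩

theorem SubQuot.cls_add {Z B : Submodule k M} (x y : M) (hx : x ∈ Z) (hy : y ∈ Z) :
    (SubQuot.cls x hx + SubQuot.cls y hy : SubQuot Z B) = SubQuot.cls (x + y) (Z.add_mem hx hy) :=
  rfl

theorem SubQuot.cls_smul {Z B : Submodule k M} (c : k) (x : M) (hx : x ∈ Z) :
    (c • SubQuot.cls x hx : SubQuot Z B) = SubQuot.cls (c • x) (Z.smul_mem c hx) :=
  rfl

/-- The linear map of subquotients induced by a linear map. -/
def SubQuot.map {Z₁ B₁ : Submodule k M₁} {Z₂ B₂ : Submodule k M₂} (φ : M₁ →ₗ[k] M₂)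
    (hZ : ∀ x ∈ Z₁, φ x ∈ Z₂) (hB : ∀ x ∈ Z₁, x ∈ B₁ → φ x ∈ B₂) :
    SubQuot Z₁ B₁ →ₗ[k] SubQuot Z₂ B₂ :=
  Submodule.mapQ _ _ (φ.restrict hZ) (fun x hx => hB x.1 x.2 hx)

theorem SubQuot.map_cls {Z₁ B₁ : Submodule k M₁} {Z₂ B₂ : Submodule k M₂} (φ : M₁ →ₗ[k] M₂)
    (hZ : ∀ x ∈ Z₁, φ x ∈ Z₂) (hB : ∀ x ∈ Z₁, x ∈ B₁ → φ x ∈ B₂) (x : M₁) (hx : x ∈ Z₁) :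
    SubQuot.map φ hZ hB (SubQuot.cls x hx) = SubQuot.cls (φ x) (hZ x hx) := rfl

/-- The bilinear map of subquotients induced by a bilinear map. -/
def SubQuot.map₂ {Z₁ B₁ : Submodule k M₁} {Z₂ B₂ : Submodule k M₂} {Z₃ B₃ : Submodule k M₃}
    (φ : M₁ →ₗ[k] M₂ →ₗ[k] M₃)
    (hZ : ∀ x ∈ Z₁, ∀ y ∈ Z₂, φ x y ∈ Z₃)
    (hB₁ : ∀ x ∈ Z₁, x ∈ B₁ → ∀ y ∈ Z₂, φ x y ∈ B₃)
    (hB₂ : ∀ x ∈ Z₁, ∀ y ∈ Z₂, y ∈ B₂ → φ x y ∈ B₃) :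
    SubQuot Z₁ B₁ →ₗ[k] SubQuot Z₂ B₂ →ₗ[k] SubQuot Z₃ B₃ :=
  Submodule.liftQ _
    { toFun := fun x => SubQuot.map (φ x.1) (hZ x.1 x.2) (hB₂ x.1 x.2)
      map_add' := fun x x' => by
        refine LinearMap.ext fun y => ?_
        obtain ⟨y, hy, rfl⟩ := SubQuot.exists_cls y
        rw [LinearMap.add_apply, SubQuot.map_cls, SubQuot.map_cls, SubQuot.map_cls,
          SubQuot.cls_add]
        exact SubQuot.cls_congr _ (by simp)
      map_smul' := fun c x => by
        refine LinearMap.ext fun y => ?_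
        obtain ⟨y, hy, rfl⟩ := SubQuot.exists_cls y
        rw [LinearMap.smul_apply, SubQuot.map_cls, SubQuot.map_cls, RingHom.id_apply,
          SubQuot.cls_smul]
        exact SubQuot.cls_congr _ (by simp) }
    (fun x hx => by
      refine LinearMap.mem_ker.2 (LinearMap.ext fun y => ?_)
      obtain ⟨y, hy, rfl⟩ := SubQuot.exists_cls y
      exact (Submodule.Quotient.mk_eq_zero _).2 (hB₁ x.1 x.2 hx y hy))

theorem SubQuot.map₂_cls {Z₁ B₁ : Submodule k M₁} {Z₂ B₂ : Submodule k M₂}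
    {Z₃ B₃ : Submodule k M₃} (φ : M₁ →ₗ[k] M₂ →ₗ[k] M₃)
    (hZ : ∀ x ∈ Z₁, ∀ y ∈ Z₂, φ x y ∈ Z₃)
    (hB₁ : ∀ x ∈ Z₁, x ∈ B₁ → ∀ y ∈ Z₂, φ x y ∈ B₃)
    (hB₂ : ∀ x ∈ Z₁, ∀ y ∈ Z₂, y ∈ B₂ → φ x y ∈ B₃)
    (x : M₁) (hx : x ∈ Z₁) (y : M₂) (hy : y ∈ Z₂) :
    SubQuot.map₂ φ hZ hB₁ hB₂ (SubQuot.cls x hx) (SubQuot.cls y hy)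
      = SubQuot.cls (φ x y) (hZ x hx y hy) := rfl

/-- The image in `Z / (B ∩ Z)` of a submodule `G`, that is, of `G ∩ Z`. -/
def SubQuot.image (Z B G : Submodule k M) : Submodule k (SubQuot Z B) :=
  (G.submoduleOf Z).map (B.submoduleOf Z).mkQ

end Subquotients

/-! ## Locally graded linear 2-categories and semistrict monoidal structures -/

/-- The data of a locally graded `k`-linear 2-category: objects, 1-morphisms, `k`-modules of
2-morphisms with homogeneous submodules `deg f g d`, identities, the composition `comp g f = g ∘₁ f`
of 1-morphisms, the (bilinear) vertical composition `vcomp β α = β ∘₂ α` and the (bilinear)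
horizontal composition `hcomp β α = β ∘₁ α` of 2-morphisms. No law is imposed here. -/
structure TwoCatData (k : Type) [Field k] where
  Obj : Type
  Hom : Obj → Obj → Type
  Hom2 : {a b : Obj} → Hom a b → Hom a b → Type
  [addCommGroup : ∀ {a b : Obj} (f g : Hom a b), AddCommGroup (Hom2 f g)]
  [module : ∀ {a b : Obj} (f g : Hom a b), Module k (Hom2 f g)]
  deg : ∀ {a b : Obj} (f g : Hom a b), ℤ → Submodule k (Hom2 f g)
  one : ∀ a : Obj, Hom a a
  comp : ∀ {a b c : Obj}, Hom b c → Hom a b → Hom a c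
  id2 : ∀ {a b : Obj} (f : Hom a b), Hom2 f f
  vcomp : ∀ {a b : Obj} {f g h : Hom a b}, Hom2 g h →ₗ[k] Hom2 f g →ₗ[k] Hom2 f h
  hcomp : ∀ {a b c : Obj} {g g' : Hom b c} {f f' : Hom a b},
    Hom2 g g' →ₗ[k] Hom2 f f' →ₗ[k] Hom2 (comp g f) (comp g' f')

attribute [instance] TwoCatData.addCommGroup TwoCatData.module

section General

variable {k : Type} [Field k]

/-- The identity 2-morphism, regarded as a 2-morphism between equal 1-morphisms. -/
def TwoCatData.eqTo (C : TwoCatData k) {a b : C.Obj} {f g : C.Hom a b} (h : f = g) : C.Hom2 f g :=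
  h ▸ C.id2 f

/-- The laws which say that the 2-morphisms form `k`-linear hom-categories whose composition
respects degrees, and that horizontal composition is a (bilinear, degree preserving) functor. -/
structure TwoCatData.IsLocallyFunctorial (C : TwoCatData k) : Prop where
  vcomp_assoc : ∀ {a b : C.Obj} {f g h l : C.Hom a b} (γ : C.Hom2 h l) (β : C.Hom2 g h)
    (α : C.Hom2 f g), C.vcomp (C.vcomp γ β) α = C.vcomp γ (C.vcomp β α)
  id_vcomp : ∀ {a b : C.Obj} {f g : C.Hom a b} (α : C.Hom2 f g), C.vcomp (C.id2 g) α = α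
  vcomp_id : ∀ {a b : C.Obj} {f g : C.Hom a b} (α : C.Hom2 f g), C.vcomp α (C.id2 f) = α
  hcomp_id : ∀ {a b c : C.Obj} (g : C.Hom b c) (f : C.Hom a b),
    C.hcomp (C.id2 g) (C.id2 f) = C.id2 (C.comp g f)
  interchange : ∀ {a b c : C.Obj} {g g' g'' : C.Hom b c} {f f' f'' : C.Hom a b}
    (β' : C.Hom2 g' g'') (β : C.Hom2 g g') (α' : C.Hom2 f' f'') (α : C.Hom2 f f'),
    C.vcomp (C.hcomp β' α') (C.hcomp β α) = C.hcomp (C.vcomp β' β) (C.vcomp α' α)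
  id2_deg : ∀ {a b : C.Obj} (f : C.Hom a b), C.id2 f ∈ C.deg f f 0
  vcomp_deg : ∀ {a b : C.Obj} {f g h : C.Hom a b} {d e : ℤ} {β : C.Hom2 g h} {α : C.Hom2 f g},
    β ∈ C.deg g h d → α ∈ C.deg f g e → C.vcomp β α ∈ C.deg f h (d + e)
  hcomp_deg : ∀ {a b c : C.Obj} {g g' : C.Hom b c} {f f' : C.Hom a b} {d e : ℤ}
    {β : C.Hom2 g g'} {α : C.Hom2 f f'},
    β ∈ C.deg g g' d → α ∈ C.deg f f' e → C.hcomp β α ∈ C.deg _ _ (d + e)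

/-- The data `C` form a (strict) locally graded `k`-linear 2-category: moreover each module of
2-morphisms is the direct sum of its homogeneous submodules, and the composition of 1-morphisms
and the horizontal composition of 2-morphisms are strictly associative and unital. -/
structure TwoCatData.IsLocallyGradedTwoCategory (C : TwoCatData k) : Prop
    extends C.IsLocallyFunctorial where
  isInternal : ∀ {a b : C.Obj} (f g : C.Hom a b), DirectSum.IsInternal (C.deg f g)
  one_comp : ∀ {a b : C.Obj} (f : C.Hom a b), C.comp (C.one b) f = f
  comp_one : ∀ {a b : C.Obj} (f : C.Hom a b), C.comp f (C.one a) = f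
  comp_assoc : ∀ {a b c d : C.Obj} (h : C.Hom c d) (g : C.Hom b c) (f : C.Hom a b),
    C.comp (C.comp h g) f = C.comp h (C.comp g f)
  one_hcomp : ∀ {a b : C.Obj} {f f' : C.Hom a b} (α : C.Hom2 f f'),
    HEq (C.hcomp (C.id2 (C.one b)) α) α
  hcomp_one : ∀ {a b : C.Obj} {f f' : C.Hom a b} (α : C.Hom2 f f'),
    HEq (C.hcomp α (C.id2 (C.one a))) α
  hcomp_assoc : ∀ {a b c d : C.Obj} {h h' : C.Hom c d} {g g' : C.Hom b c} {f f' : C.Hom a b}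
    (γ : C.Hom2 h h') (β : C.Hom2 g g') (α : C.Hom2 f f'),
    HEq (C.hcomp (C.hcomp γ β) α) (C.hcomp γ (C.hcomp β α))

/-- The data of a tensor product on `C` without tensorators: a unit object, tensor products of
objects, and tensor products `a ⊗ -` and `- ⊗ b` of 1- and 2-morphisms with objects. -/
structure TensorData (C : TwoCatData k) where
  unit : C.Obj
  obj : C.Obj → C.Obj → C.Obj
  left : ∀ (a : C.Obj) {b b' : C.Obj}, C.Hom b b' → C.Hom (obj a b) (obj a b')
  right : ∀ {a a' : C.Obj}, C.Hom a a' → ∀ b : C.Obj, C.Hom (obj a b) (obj a' b)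
  left2 : ∀ (a : C.Obj) {b b' : C.Obj} {g g' : C.Hom b b'},
    C.Hom2 g g' →ₗ[k] C.Hom2 (left a g) (left a g')
  right2 : ∀ {a a' : C.Obj} {f f' : C.Hom a a'} (b : C.Obj),
    C.Hom2 f f' →ₗ[k] C.Hom2 (right f b) (right f' b)

/-- A family of 2-morphisms `(f ⊗ b') ∘₁ (a ⊗ g) ⟶ (a' ⊗ g) ∘₁ (f ⊗ b)`. -/
abbrev TensorData.Tensorator {C : TwoCatData k} (T : TensorData C) : Type :=
  ∀ {a a' b b' : C.Obj} (f : C.Hom a a') (g : C.Hom b b'),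
    C.Hom2 (C.comp (T.right f b') (T.left a g)) (C.comp (T.left a' g) (T.right f b))

/-- On hom-categories, `a ⊗ -` and `- ⊗ b` are degree preserving (linear) functors. -/
structure TensorData.IsLocallyFunctorial {C : TwoCatData k} (T : TensorData C) : Prop where
  left2_id2 : ∀ (a : C.Obj) {b b' : C.Obj} (g : C.Hom b b'),
    T.left2 a (C.id2 g) = C.id2 (T.left a g)
  left2_vcomp : ∀ (a : C.Obj) {b b' : C.Obj} {g g' g'' : C.Hom b b'} (β' : C.Hom2 g' g'')
    (β : C.Hom2 g g'), T.left2 a (C.vcomp β' β) = C.vcomp (T.left2 a β') (T.left2 a β)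
  left2_deg : ∀ (a : C.Obj) {b b' : C.Obj} {g g' : C.Hom b b'} {d : ℤ} {β : C.Hom2 g g'},
    β ∈ C.deg g g' d → T.left2 a β ∈ C.deg _ _ d
  right2_id2 : ∀ {a a' : C.Obj} (f : C.Hom a a') (b : C.Obj),
    T.right2 b (C.id2 f) = C.id2 (T.right f b)
  right2_vcomp : ∀ {a a' : C.Obj} {f f' f'' : C.Hom a a'} (b : C.Obj) (α' : C.Hom2 f' f'')
    (α : C.Hom2 f f'), T.right2 b (C.vcomp α' α) = C.vcomp (T.right2 b α') (T.right2 b α)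
  right2_deg : ∀ {a a' : C.Obj} {f f' : C.Hom a a'} (b : C.Obj) {d : ℤ} {α : C.Hom2 f f'},
    α ∈ C.deg f f' d → T.right2 b α ∈ C.deg _ _ d

/-- A semistrict monoidal structure (Gray monoid structure) on the locally graded linear
2-category `C`, spelled out: `T` and the family `τ` of tensorators satisfy the following laws. All
tensor operations are linear on 2-morphisms and preserve degrees, and `τ` is of degree zero. -/
structure IsSemistrictMonoidal {C : TwoCatData k} (hC : C.IsLocallyGradedTwoCategory)
    (T : TensorData C) (τ : T.Tensorator) : Prop extends T.IsLocallyFunctorial where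
  /- tensoring with an object on either side is a 2-functor -/
  left_one : ∀ a b : C.Obj, T.left a (C.one b) = C.one (T.obj a b)
  left_comp : ∀ (a : C.Obj) {b b' b'' : C.Obj} (g' : C.Hom b' b'') (g : C.Hom b b'),
    T.left a (C.comp g' g) = C.comp (T.left a g') (T.left a g)
  left2_hcomp : ∀ (a : C.Obj) {b b' b'' : C.Obj} {g' h' : C.Hom b' b''} {g h : C.Hom b b'}
    (β' : C.Hom2 g' h') (β : C.Hom2 g h),
    HEq (T.left2 a (C.hcomp β' β)) (C.hcomp (T.left2 a β') (T.left2 a β))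
  right_one : ∀ a b : C.Obj, T.right (C.one a) b = C.one (T.obj a b)
  right_comp : ∀ {a a' a'' : C.Obj} (f' : C.Hom a' a'') (f : C.Hom a a') (b : C.Obj),
    T.right (C.comp f' f) b = C.comp (T.right f' b) (T.right f b)
  right2_hcomp : ∀ {a a' a'' : C.Obj} {f' h' : C.Hom a' a''} {f h : C.Hom a a'} (b : C.Obj)
    (α' : C.Hom2 f' h') (α : C.Hom2 f h),
    HEq (T.right2 b (C.hcomp α' α)) (C.hcomp (T.right2 b α') (T.right2 b α))
  /- strict unitality -/
  unit_obj : ∀ b : C.Obj, T.obj T.unit b = b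
  unit_left : ∀ {b b' : C.Obj} (g : C.Hom b b'), HEq (T.left T.unit g) g
  unit_left2 : ∀ {b b' : C.Obj} {g g' : C.Hom b b'} (β : C.Hom2 g g'), HEq (T.left2 T.unit β) β
  obj_unit : ∀ a : C.Obj, T.obj a T.unit = a
  right_unit : ∀ {a a' : C.Obj} (f : C.Hom a a'), HEq (T.right f T.unit) f
  right2_unit : ∀ {a a' : C.Obj} {f f' : C.Hom a a'} (α : C.Hom2 f f'), HEq (T.right2 T.unit α) α
  /- strict associativity -/
  obj_assoc : ∀ a b c : C.Obj, T.obj (T.obj a b) c = T.obj a (T.obj b c)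
  left_left : ∀ (a b : C.Obj) {c c' : C.Obj} (h : C.Hom c c'),
    HEq (T.left (T.obj a b) h) (T.left a (T.left b h))
  left2_left2 : ∀ (a b : C.Obj) {c c' : C.Obj} {h h' : C.Hom c c'} (γ : C.Hom2 h h'),
    HEq (T.left2 (T.obj a b) γ) (T.left2 a (T.left2 b γ))
  right_left : ∀ (a : C.Obj) {b b' : C.Obj} (g : C.Hom b b') (c : C.Obj),
    HEq (T.right (T.left a g) c) (T.left a (T.right g c))
  right2_left2 : ∀ (a : C.Obj) {b b' : C.Obj} {g g' : C.Hom b b'} (β : C.Hom2 g g') (c : C.Obj),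
    HEq (T.right2 c (T.left2 a β)) (T.left2 a (T.right2 c β))
  right_right : ∀ {a a' : C.Obj} (f : C.Hom a a') (b c : C.Obj),
    HEq (T.right (T.right f b) c) (T.right f (T.obj b c))
  right2_right2 : ∀ {a a' : C.Obj} {f f' : C.Hom a a'} (α : C.Hom2 f f') (b c : C.Obj),
    HEq (T.right2 c (T.right2 b α)) (T.right2 (T.obj b c) α)
  /- the tensorators are 2-isomorphisms of degree zero -/
  tensorator_deg : ∀ {a a' b b' : C.Obj} (f : C.Hom a a') (g : C.Hom b b'),
    τ f g ∈ C.deg _ _ 0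
  tensorator_iso : ∀ {a a' b b' : C.Obj} (f : C.Hom a a') (g : C.Hom b b'),
    ∃ σ : C.Hom2 (C.comp (T.left a' g) (T.right f b)) (C.comp (T.right f b') (T.left a g)),
      C.vcomp σ (τ f g) = C.id2 _ ∧ C.vcomp (τ f g) σ = C.id2 _
  /- compatibility of the tensorators with tensoring by an object -/
  tensorator_left : ∀ (a : C.Obj) {b b' c c' : C.Obj} (g : C.Hom b b') (h : C.Hom c c'),
    HEq (τ (T.left a g) h) (T.left2 a (τ g h))
  tensorator_mid : ∀ {a a' c c' : C.Obj} (f : C.Hom a a') (b : C.Obj) (h : C.Hom c c'),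
    HEq (τ (T.right f b) h) (τ f (T.left b h))
  tensorator_right : ∀ {a a' b b' : C.Obj} (f : C.Hom a a') (g : C.Hom b b') (c : C.Obj),
    HEq (τ f (T.right g c)) (T.right2 c (τ f g))
  /- tensorators of identity 1-morphisms -/
  tensorator_one_left : ∀ (a : C.Obj) {b b' : C.Obj} (g : C.Hom b b'),
    HEq (τ (C.one a) g) (C.id2 (T.left a g))
  tensorator_one_right : ∀ {a a' : C.Obj} (f : C.Hom a a') (b : C.Obj),
    HEq (τ f (C.one b)) (C.id2 (T.right f b))
  /- naturality of the tensorators in both arguments -/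
  tensorator_natural_left : ∀ {a a' b b' : C.Obj} {f f' : C.Hom a a'} (α : C.Hom2 f f')
    (g : C.Hom b b'),
    C.vcomp (τ f' g) (C.hcomp (T.right2 b' α) (C.id2 (T.left a g)))
      = C.vcomp (C.hcomp (C.id2 (T.left a' g)) (T.right2 b α)) (τ f g)
  tensorator_natural_right : ∀ {a a' b b' : C.Obj} (f : C.Hom a a') {g g' : C.Hom b b'}
    (β : C.Hom2 g g'),
    C.vcomp (τ f g') (C.hcomp (C.id2 (T.right f b')) (T.left2 a β))
      = C.vcomp (C.hcomp (T.left2 a' β) (C.id2 (T.right f b))) (τ f g)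
  /- compatibility of the tensorators with composition of 1-morphisms in both arguments -/
  tensorator_comp_right : ∀ {a a' b b' b'' : C.Obj} (f : C.Hom a a') (g' : C.Hom b' b'')
    (g : C.Hom b b'),
    HEq (τ f (C.comp g' g))
      (C.vcomp (C.hcomp (C.id2 (T.left a' g')) (τ f g))
        (C.vcomp (C.eqTo (hC.comp_assoc (T.left a' g') (T.right f b') (T.left a g)))
          (C.hcomp (τ f g') (C.id2 (T.left a g)))))
  tensorator_comp_left : ∀ {a a' a'' b b' : C.Obj} (f' : C.Hom a' a'') (f : C.Hom a a')
    (g : C.Hom b b'),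
    HEq (τ (C.comp f' f) g)
      (C.vcomp (C.hcomp (τ f' g) (C.id2 (T.right f b)))
        (C.vcomp (C.eqTo (hC.comp_assoc (T.right f' b') (T.left a' g) (T.right f b)).symm)
          (C.hcomp (C.id2 (T.right f' b')) (τ f g))))

end General

/-! ## Bounded complexes over the hom-categories -/

section Complexes

variable {k : Type} [Field k] (C : TwoCatData k)

/-- A finite ordered collection of formally shifted 1-morphisms `Σ^{h i} X^i ⟨q i⟩`, where `h i` is
the homological shift (so that the `i`-th term is in cohomological degree `-h i`) and `q i` is the
shift of the internal grading. -/
structure Susp (a b : C.Obj) where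
  len : ℕ
  obj : Fin len → C.Hom a b
  h : Fin len → ℤ
  q : Fin len → ℤ

variable {C}

/-- Matrices of 2-morphisms between the terms of two collections. -/
abbrev Mat {a b : C.Obj} (X Y : Susp C a b) : Type :=
  ∀ (i : Fin X.len) (j : Fin Y.len), C.Hom2 (X.obj i) (Y.obj j)

/-- The Koszul sign `(-1)^n`. -/
def koszul (k : Type) [Field k] (n : ℤ) : k := ((n.negOnePow : ℤ) : k)

/-- Matrix multiplication `B ∘ A`. -/
def Mat.comp {a b : C.Obj} {X Y Z : Susp C a b} : Mat Y Z →ₗ[k] Mat X Y →ₗ[k] Mat X Z :=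
  LinearMap.mk₂ k (fun B A i l => ∑ j, C.vcomp (B j l) (A i j))
    (fun B B' A => by ext i l; simp [Finset.sum_add_distrib])
    (fun c B A => by ext i l; simp [Finset.smul_sum])
    (fun B A A' => by ext i l; simp [Finset.sum_add_distrib])
    (fun c B A => by ext i l; simp [Finset.smul_sum])

/-- The identity matrix. -/
def Mat.one {a b : C.Obj} (X : Susp C a b) : Mat X X :=
  fun i j => if h : i = j then C.eqTo (congrArg X.obj h) else 0

/-- Matrices which are homogeneous of cohomological degree `n`: the entry from `Σ^s X` to `Σ^t Y`
vanishes unless `s - t = n`. -/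
def Mat.hDeg {a b : C.Obj} (X Y : Susp C a b) (n : ℤ) : Submodule k (Mat X Y) where
  carrier := {A | ∀ i j, X.h i - Y.h j ≠ n → A i j = 0}
  add_mem' := fun hA hB i j h => by simp [hA i j h, hB i j h]
  zero_mem' := fun _ _ _ => rfl
  smul_mem' := fun c A hA i j h => by simp [hA i j h]

/-- Matrices which are homogeneous of internal degree `d`: a 2-morphism `X ⟶ Y` of degree `e` has
degree `e + t - s` as an entry from `X⟨s⟩` to `Y⟨t⟩`. -/
def Mat.qDeg {a b : C.Obj} (X Y : Susp C a b) (d : ℤ) : Submodule k (Mat X Y) where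
  carrier := {A | ∀ i j, A i j ∈ C.deg (X.obj i) (Y.obj j) (d + X.q i - Y.q j)}
  add_mem' := fun hA hB i j => Submodule.add_mem _ (hA i j) (hB i j)
  zero_mem' := fun _ _ => Submodule.zero_mem _
  smul_mem' := fun c _ hA i j => Submodule.smul_mem _ c (hA i j)

/-- The horizontal composite of two collections, in lexicographic order: the term with index
`(i, j)` is `Σ^{s + t} (Y^i ∘₁ X^j)`. -/
@[reducible] def Susp.comp {a b c : C.Obj} (Y : Susp C b c) (X : Susp C a b) : Susp C a c where
  len := Y.len * X.len
  obj := fun p => C.comp (Y.obj p.divNat) (X.obj p.modNat)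
  h := fun p => Y.h p.divNat + X.h p.modNat
  q := fun p => Y.q p.divNat + X.q p.modNat

/-- The Kronecker product of matrices with Koszul signs: the entry of `G ∘₁ F` determined by
`G i i' : Σ^s Y^i ⟶ Σ^{s'} Y'^{i'}` and `F j j' : Σ^t X^j ⟶ Σ^{t'} X'^{j'}` is
`(-1)^{(t' - t) s} (G i i' ∘₁ F j j')`. -/
def Mat.hcomp {a b c : C.Obj} {Y Y' : Susp C b c} {X X' : Susp C a b} :
    Mat Y Y' →ₗ[k] Mat X X' →ₗ[k] Mat (Y.comp X) (Y'.comp X') :=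
  LinearMap.mk₂ k
    (fun G F p r => koszul k ((X'.h r.modNat - X.h p.modNat) * Y.h p.divNat) •
      C.hcomp (G p.divNat r.divNat) (F p.modNat r.modNat))
    (fun G G' F => by
      funext p r
      exact (congrArg (koszul k _ • ·) (LinearMap.map_add₂ C.hcomp _ _ _)).trans (smul_add _ _ _))
    (fun c G F => by
      funext p r
      exact (congrArg (koszul k _ • ·) (LinearMap.map_smul₂ C.hcomp _ _ _)).trans
        (smul_comm _ _ _))
    (fun G F F' => by
      funext p r
      exact (congrArg (koszul k _ • ·) (map_add (C.hcomp _) _ _)).trans (smul_add _ _ _))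
    (fun c G F => by
      funext p r
      exact (congrArg (koszul k _ • ·) (map_smul (C.hcomp _) _ _)).trans (smul_comm _ _ _))

theorem koszul_zero : koszul k 0 = 1 := by simp [koszul]

theorem koszul_add (m n : ℤ) : koszul k (m + n) = koszul k m * koszul k n := by
  simp [koszul, Int.negOnePow_add]

theorem koszul_neg_one : koszul k (-1) = -1 := by simp [koszul]

theorem koszul_one : koszul k 1 = -1 := by simp [koszul]

theorem Mat.comp_apply {a b : C.Obj} {X Y Z : Susp C a b} (B : Mat Y Z) (A : Mat X Y)
    (i : Fin X.len) (l : Fin Z.len) :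
    Mat.comp B A i l = ∑ j, C.vcomp (B j l) (A i j) := rfl

theorem Mat.hcomp_apply {a b c : C.Obj} {Y Y' : Susp C b c} {X X' : Susp C a b} (G : Mat Y Y')
    (F : Mat X X') (p : Fin (Y.comp X).len) (r : Fin (Y'.comp X').len) :
    Mat.hcomp G F p r = koszul k ((X'.h (Fin.modNat r) - X.h (Fin.modNat p)) * Y.h (Fin.divNat p)) •
      C.hcomp (G (Fin.divNat p) (Fin.divNat r)) (F (Fin.modNat p) (Fin.modNat r)) := rfl

theorem Mat.one_mem_hDeg {a b : C.Obj} (X : Susp C a b) : Mat.one X ∈ Mat.hDeg X X 0 := by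
  intro i j h
  have : i ≠ j := fun e => h (by simp [e])
  simp [Mat.one, this]

theorem Mat.comp_mem_hDeg {a b : C.Obj} {X Y Z : Susp C a b} {m n l : ℤ} (hl : l = m + n)
    {B : Mat Y Z} {A : Mat X Y} (hB : B ∈ Mat.hDeg Y Z m) (hA : A ∈ Mat.hDeg X Y n) :
    Mat.comp B A ∈ Mat.hDeg X Z l := by
  intro i j h
  rw [Mat.comp_apply]
  refine Finset.sum_eq_zero fun t _ => ?_
  by_cases h1 : X.h i - Y.h t = n
  · have h2 : Y.h t - Z.h j ≠ m := fun h2 => h (by omega)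
    simp [hB t j h2]
  · simp [hA i t h1]

theorem Mat.hcomp_mem_hDeg {a b c : C.Obj} {Y Y' : Susp C b c} {X X' : Susp C a b} {m n l : ℤ}
    (hl : l = m + n) {G : Mat Y Y'} {F : Mat X X'} (hG : G ∈ Mat.hDeg Y Y' m)
    (hF : F ∈ Mat.hDeg X X' n) : Mat.hcomp G F ∈ Mat.hDeg (Y.comp X) (Y'.comp X') l := by
  intro p r h
  rw [Mat.hcomp_apply]
  by_cases h1 : X.h (Fin.modNat p) - X'.h (Fin.modNat r) = n
  · have h2 : Y.h (Fin.divNat p) - Y'.h (Fin.divNat r) ≠ m := fun h2 =>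
      h (by
        change Y.h _ + X.h _ - (Y'.h _ + X'.h _) = l
        omega)
    rw [hG _ _ h2, map_zero, LinearMap.zero_apply]
    exact smul_zero _
  · rw [hF _ _ h1, map_zero]
    exact smul_zero _

section Laws

theorem Mat.comp_assoc (hC : C.IsLocallyFunctorial)
    {a b : C.Obj} {W X Y Z : Susp C a b} (D : Mat Y Z) (B : Mat X Y)
    (A : Mat W X) : Mat.comp (Mat.comp D B) A = Mat.comp D (Mat.comp B A) := by
  ext i l
  simp only [Mat.comp_apply, map_sum, LinearMap.sum_apply, hC.vcomp_assoc]
  exact Finset.sum_comm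

theorem Mat.one_comp (hC : C.IsLocallyFunctorial)
    {a b : C.Obj} {X Y : Susp C a b} (A : Mat X Y) :
    Mat.comp (Mat.one Y) A = A := by
  ext i l
  rw [Mat.comp_apply, Finset.sum_eq_single l]
  · simp [Mat.one, TwoCatData.eqTo, hC.id_vcomp]
  · intro j _ hj
    simp [Mat.one, hj]
  · simp

theorem Mat.comp_one (hC : C.IsLocallyFunctorial)
    {a b : C.Obj} {X Y : Susp C a b} (A : Mat X Y) :
    Mat.comp A (Mat.one X) = A := by
  ext i l
  rw [Mat.comp_apply, Finset.sum_eq_single i]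
  · simp [Mat.one, TwoCatData.eqTo, hC.vcomp_id]
  · intro j _ hj
    simp [Mat.one, hj.symm]
  · simp

/-- The graded interchange law. -/
theorem Mat.interchange (hC : C.IsLocallyFunctorial)
    {a b c : C.Obj} {Y Y' Y'' : Susp C b c} {X X' X'' : Susp C a b} {m n : ℤ}
    (G' : Mat Y' Y'') {G : Mat Y Y'} {F' : Mat X' X''} (F : Mat X X')
    (hG : G ∈ Mat.hDeg Y Y' m) (hF' : F' ∈ Mat.hDeg X' X'' n) :
    Mat.comp (Mat.hcomp G' F') (Mat.hcomp G F)
      = koszul k (n * m) • Mat.hcomp (Mat.comp G' G) (Mat.comp F' F) := by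
  ext p r
  have hl : Mat.comp (Mat.hcomp G' F') (Mat.hcomp G F) p r
      = ∑ s : Fin (Y'.len * X'.len),
          C.vcomp (Mat.hcomp G' F' s r) (Mat.hcomp G F p s) := rfl
  have hr : (koszul k (n * m) • Mat.hcomp (Mat.comp G' G) (Mat.comp F' F)) p r
      = koszul k (n * m) •
          koszul k ((X''.h (Fin.modNat r) - X.h (Fin.modNat p)) * Y.h (Fin.divNat p)) •
          C.hcomp (∑ i, C.vcomp (G' i (Fin.divNat r)) (G (Fin.divNat p) i))
            (∑ j, C.vcomp (F' j (Fin.modNat r)) (F (Fin.modNat p) j)) := rfl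
  rw [hl, hr, map_sum, smul_smul, ← koszul_add]
  simp only [LinearMap.sum_apply, map_sum, Finset.smul_sum]
  rw [Finset.sum_comm, ← Fintype.sum_prod_type']
  refine Fintype.sum_equiv finProdFinEquiv.symm _ _ fun s => ?_
  simp only [Mat.hcomp_apply, map_smul, LinearMap.smul_apply, smul_smul, hC.interchange,
    ← koszul_add]
  by_cases h1 : X'.h (Fin.modNat s) - X''.h (Fin.modNat r) = n
  · by_cases h2 : Y.h (Fin.divNat p) - Y'.h (Fin.divNat s) = m
    · subst h1 h2
      congr 2
      ring
    · have hz : G (Fin.divNat p) (finProdFinEquiv.symm s).1 = 0 := hG _ _ h2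
      rw [hG _ _ h2, hz]
      simp only [map_zero, LinearMap.zero_apply, smul_zero]
  · have hz : F' (finProdFinEquiv.symm s).2 (Fin.modNat r) = 0 := hF' _ _ h1
    rw [hF' _ _ h1, hz]
    simp only [map_zero, LinearMap.zero_apply, smul_zero]

/-- The total differential `dY ∘₁ id + id ∘₁ dX`. -/
def Mat.totalD {a b c : C.Obj} {Y : Susp C b c} {X : Susp C a b} (dY : Mat Y Y) (dX : Mat X X) :
    Mat (Y.comp X) (Y.comp X) :=
  Mat.hcomp dY (Mat.one X) + Mat.hcomp (Mat.one Y) dX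

theorem Mat.totalD_comp (hC : C.IsLocallyFunctorial) {a b c : C.Obj} {Y Y' : Susp C b c}
    {X X' : Susp C a b} (dY : Mat Y' Y') {dX : Mat X' X'} (hX : dX ∈ Mat.hDeg X' X' 1) {m : ℤ}
    {G : Mat Y Y'} (F : Mat X X') (hG : G ∈ Mat.hDeg Y Y' m) :
    Mat.comp (Mat.totalD dY dX) (Mat.hcomp G F)
      = Mat.hcomp (Mat.comp dY G) F + koszul k m • Mat.hcomp G (Mat.comp dX F) := by
  rw [Mat.totalD, map_add, LinearMap.add_apply,
    Mat.interchange hC _ _ hG (Mat.one_mem_hDeg X'), Mat.interchange hC _ _ hG hX,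
    Mat.one_comp hC, Mat.one_comp hC, zero_mul, koszul_zero, one_smul, one_mul]

theorem Mat.comp_totalD (hC : C.IsLocallyFunctorial) {a b c : C.Obj} {Y Y' : Susp C b c}
    {X X' : Susp C a b} {dY : Mat Y Y} (dX : Mat X X) (hY : dY ∈ Mat.hDeg Y Y 1) {n : ℤ}
    (G : Mat Y Y') {F : Mat X X'} (hF : F ∈ Mat.hDeg X X' n) :
    Mat.comp (Mat.hcomp G F) (Mat.totalD dY dX)
      = koszul k n • Mat.hcomp (Mat.comp G dY) F + Mat.hcomp G (Mat.comp F dX) := by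
  rw [Mat.totalD, map_add,
    Mat.interchange hC _ _ hY hF, Mat.interchange hC _ _ (Mat.one_mem_hDeg Y) hF,
    Mat.comp_one hC, Mat.comp_one hC, mul_zero, koszul_zero, one_smul, mul_one]

end Laws

variable (C)

/-- A bounded complex `tw_d(X)`: a collection with a differential of cohomological degree one and
internal degree zero, which satisfies the Maurer-Cartan equation `d ∘ d = 0`. -/
structure Cx (a b : C.Obj) extends Susp C a b where
  d : Mat toSusp toSusp
  d_hDeg : d ∈ Mat.hDeg toSusp toSusp 1
  d_qDeg : d ∈ Mat.qDeg toSusp toSusp 0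
  d_comp_d : Mat.comp d d = 0

variable {C}

/-- The differential `A ↦ d_Y ∘ A - (-1)^n A ∘ d_X` on matrices of cohomological degree `n`. -/
def Cx.diff {a b : C.Obj} (X Y : Cx C a b) (n : ℤ) :
    Mat X.toSusp Y.toSusp →ₗ[k] Mat X.toSusp Y.toSusp :=
  Mat.comp Y.d - koszul k n • Mat.comp.flip X.d

/-- The chain maps: closed matrices of cohomological degree zero. -/
def Cx.chainMaps {a b : C.Obj} (X Y : Cx C a b) : Submodule k (Mat X.toSusp Y.toSusp) :=
  Mat.hDeg X.toSusp Y.toSusp 0 ⊓ LinearMap.ker (Cx.diff X Y 0)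

/-- The null-homotopic chain maps: differentials of matrices of cohomological degree `-1`. -/
def Cx.nullHomotopic {a b : C.Obj} (X Y : Cx C a b) : Submodule k (Mat X.toSusp Y.toSusp) :=
  (Mat.hDeg X.toSusp Y.toSusp (-1)).map (Cx.diff X Y (-1))

/-- The 2-morphisms in the homotopy category: chain maps up to homotopy. -/
abbrev Cx.Hom2 {a b : C.Obj} (X Y : Cx C a b) : Type :=
  SubQuot (Cx.chainMaps X Y) (Cx.nullHomotopic X Y)

theorem Cx.mem_chainMaps {a b : C.Obj} {X Y : Cx C a b} {A : Mat X.toSusp Y.toSusp} :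
    A ∈ Cx.chainMaps X Y ↔
      A ∈ Mat.hDeg X.toSusp Y.toSusp 0 ∧ Mat.comp Y.d A = Mat.comp A X.d := by
  simp [Cx.chainMaps, Cx.diff, koszul_zero, sub_eq_zero]

theorem Cx.mem_nullHomotopic {a b : C.Obj} {X Y : Cx C a b} {A : Mat X.toSusp Y.toSusp} :
    A ∈ Cx.nullHomotopic X Y ↔
      ∃ H ∈ Mat.hDeg X.toSusp Y.toSusp (-1), Mat.comp Y.d H + Mat.comp H X.d = A := by
  simp [Cx.nullHomotopic, Cx.diff, koszul_neg_one]

section Ops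

variable (hC : C.IsLocallyFunctorial)

/-- The identity complex, concentrated in degree zero. -/
def Cx.one (a : C.Obj) : Cx C a a where
  len := 1
  obj := fun _ => C.one a
  h := fun _ => 0
  q := fun _ => 0
  d := 0
  d_hDeg := Submodule.zero_mem _
  d_qDeg := Submodule.zero_mem _
  d_comp_d := by simp

theorem Mat.one_mem_qDeg (hC : C.IsLocallyFunctorial)
    {a b : C.Obj} (X : Susp C a b) : Mat.one X ∈ Mat.qDeg X X 0 := by
  intro i j
  by_cases h : i = j
  · subst h
    simpa [Mat.one, TwoCatData.eqTo] using hC.id2_deg (X.obj i)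
  · simp [Mat.one, h]

theorem Mat.hcomp_mem_qDeg (hC : C.IsLocallyFunctorial)
    {a b c : C.Obj} {Y Y' : Susp C b c} {X X' : Susp C a b} {m n l : ℤ}
    (hl : l = m + n) {G : Mat Y Y'} {F : Mat X X'} (hG : G ∈ Mat.qDeg Y Y' m)
    (hF : F ∈ Mat.qDeg X X' n) : Mat.hcomp G F ∈ Mat.qDeg (Y.comp X) (Y'.comp X') l := by
  intro p r
  rw [Mat.hcomp_apply]
  refine Submodule.smul_mem _ _ ?_
  have := hC.hcomp_deg (hG (Fin.divNat p) (Fin.divNat r)) (hF (Fin.modNat p) (Fin.modNat r))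
  convert this using 2
  change l + (Y.q _ + X.q _) - (Y'.q _ + X'.q _) = _
  omega

/-- The horizontal composite of complexes: the total complex with differential
`d_Y ∘₁ id + id ∘₁ d_X`, formed with Koszul signs. -/
def Cx.comp {a b c : C.Obj} (Y : Cx C b c) (X : Cx C a b) : Cx C a c where
  toSusp := Y.toSusp.comp X.toSusp
  d := Mat.totalD Y.d X.d
  d_hDeg := Submodule.add_mem _
    (Mat.hcomp_mem_hDeg (by norm_num) Y.d_hDeg (Mat.one_mem_hDeg _))
    (Mat.hcomp_mem_hDeg (by norm_num) (Mat.one_mem_hDeg _) X.d_hDeg)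
  d_qDeg := Submodule.add_mem _
    (Mat.hcomp_mem_qDeg hC (by norm_num) Y.d_qDeg (Mat.one_mem_qDeg hC _))
    (Mat.hcomp_mem_qDeg hC (by norm_num) (Mat.one_mem_qDeg hC _) X.d_qDeg)
  d_comp_d := by
    have h1 := Mat.totalD_comp hC Y.d X.d_hDeg (Mat.one X.toSusp) Y.d_hDeg
    have h2 := Mat.totalD_comp hC Y.d X.d_hDeg X.d (Mat.one_mem_hDeg Y.toSusp)
    rw [Mat.comp_one hC, Y.d_comp_d, map_zero, LinearMap.zero_apply, zero_add, koszul_one] at h1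
    rw [Mat.comp_one hC, X.d_comp_d, map_zero, smul_zero, add_zero] at h2
    refine (map_add (Mat.comp (Mat.totalD Y.d X.d)) _ _).trans ?_
    rw [h1, h2, neg_smul, one_smul, neg_add_cancel]

/-- The homotopy class of the identity. -/
def Cx.id2 {a b : C.Obj} (X : Cx C a b) : Cx.Hom2 X X :=
  SubQuot.cls (Mat.one X.toSusp) (Cx.mem_chainMaps.2
    ⟨Mat.one_mem_hDeg _, by rw [Mat.one_comp hC, Mat.comp_one hC]⟩)

/-- The composition of homotopy classes of chain maps. -/
def Cx.vcomp {a b : C.Obj} {X Y Z : Cx C a b} :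
    Cx.Hom2 Y Z →ₗ[k] Cx.Hom2 X Y →ₗ[k] Cx.Hom2 X Z :=
  SubQuot.map₂ Mat.comp
    (fun B hB A hA => by
      rw [Cx.mem_chainMaps] at *
      refine ⟨Mat.comp_mem_hDeg (by norm_num) hB.1 hA.1, ?_⟩
      rw [← Mat.comp_assoc hC, hB.2, Mat.comp_assoc hC, hA.2, Mat.comp_assoc hC])
    (fun B _ hB' A hA => by
      rw [Cx.mem_chainMaps] at *
      rw [Cx.mem_nullHomotopic] at *
      obtain ⟨H, hH, rfl⟩ := hB'
      refine ⟨Mat.comp H A, Mat.comp_mem_hDeg (by norm_num) hH hA.1, ?_⟩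
      rw [map_add, LinearMap.add_apply, Mat.comp_assoc hC, Mat.comp_assoc hC, Mat.comp_assoc hC,
        hA.2])
    (fun B hB A _ hA' => by
      rw [Cx.mem_chainMaps] at *
      rw [Cx.mem_nullHomotopic] at *
      obtain ⟨H, hH, rfl⟩ := hA'
      refine ⟨Mat.comp B H, Mat.comp_mem_hDeg (by norm_num) hB.1 hH, ?_⟩
      rw [map_add, ← Mat.comp_assoc hC, ← Mat.comp_assoc hC, ← Mat.comp_assoc hC, hB.2])

/-- The horizontal composition of homotopy classes of chain maps. -/
def Cx.hcomp {a b c : C.Obj} {Y Y' : Cx C b c} {X X' : Cx C a b} :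
    Cx.Hom2 Y Y' →ₗ[k] Cx.Hom2 X X' →ₗ[k] Cx.Hom2 (Cx.comp hC Y X) (Cx.comp hC Y' X') :=
  SubQuot.map₂ Mat.hcomp
    (fun G hG F hF => by
      rw [Cx.mem_chainMaps] at *
      refine ⟨Mat.hcomp_mem_hDeg (by norm_num) hG.1 hF.1, ?_⟩
      refine (Mat.totalD_comp hC _ X'.d_hDeg _ hG.1).trans
        (Eq.trans ?_ (Mat.comp_totalD hC _ Y.d_hDeg _ hF.1).symm)
      rw [hG.2, hF.2, koszul_zero, one_smul, one_smul])
    (fun G _ hG' F hF => by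
      rw [Cx.mem_chainMaps] at *
      rw [Cx.mem_nullHomotopic] at *
      obtain ⟨H, hH, rfl⟩ := hG'
      refine ⟨Mat.hcomp H F, Mat.hcomp_mem_hDeg (by norm_num) hH hF.1, ?_⟩
      refine (congrArg₂ (· + ·) (Mat.totalD_comp hC _ X'.d_hDeg _ hH)
        (Mat.comp_totalD hC _ Y.d_hDeg _ hF.1)).trans ?_
      have h3 := LinearMap.map_add₂ (Mat.hcomp (X := X.toSusp) (X' := X'.toSusp))
        (Mat.comp Y'.d H) (Mat.comp H Y.d) F
      refine Eq.trans ?_ h3.symm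
      rw [hF.2, koszul_zero, koszul_neg_one, one_smul, neg_smul, one_smul]
      abel)
    (fun G hG F _ hF' => by
      rw [Cx.mem_chainMaps] at *
      rw [Cx.mem_nullHomotopic] at *
      obtain ⟨H, hH, rfl⟩ := hF'
      refine ⟨Mat.hcomp G H, Mat.hcomp_mem_hDeg (by norm_num) hG.1 hH, ?_⟩
      refine (congrArg₂ (· + ·) (Mat.totalD_comp hC _ X'.d_hDeg _ hG.1)
        (Mat.comp_totalD hC _ Y.d_hDeg _ hH)).trans ?_
      have h3 := map_add (Mat.hcomp G) (Mat.comp X'.d H) (Mat.comp H X.d)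
      refine Eq.trans ?_ h3.symm
      rw [hG.2, koszul_zero, koszul_neg_one, one_smul, neg_smul, one_smul]
      abel)

/-- The 2-category data obtained by applying `K^b` to each hom-category of `C`: the 1-morphisms are
the bounded complexes of shifted 1-morphisms of `C`, the 2-morphisms are the homotopy classes of
chain maps, graded by the internal degree. -/
def KbLoc : TwoCatData k where
  Obj := C.Obj
  Hom := Cx C
  Hom2 := Cx.Hom2
  deg := fun X Y d => SubQuot.image _ _ (Mat.qDeg X.toSusp Y.toSusp d)
  one := Cx.one
  comp := Cx.comp hC
  id2 := Cx.id2 hC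
  vcomp := Cx.vcomp hC
  hcomp := Cx.hcomp hC

/-! ### Tensor products of complexes -/

variable {T : TensorData C}

/-- Termwise tensor product with an object on the left. -/
@[reducible] def Susp.left (T : TensorData C) (a : C.Obj) {b b' : C.Obj} (X : Susp C b b') :
    Susp C (T.obj a b) (T.obj a b') where
  len := X.len
  obj := fun i => T.left a (X.obj i)
  h := X.h
  q := X.q

/-- Termwise tensor product with an object on the right. -/
@[reducible] def Susp.right (T : TensorData C) {a a' : C.Obj} (X : Susp C a a') (b : C.Obj) :
    Susp C (T.obj a b) (T.obj a' b) where
  len := X.len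
  obj := fun i => T.right (X.obj i) b
  h := X.h
  q := X.q

/-- Entrywise tensor product with an object on the left. -/
def Mat.left (T : TensorData C) (a : C.Obj) {b b' : C.Obj} {X Y : Susp C b b'} :
    Mat X Y →ₗ[k] Mat (X.left T a) (Y.left T a) where
  toFun := fun A i j => T.left2 a (A i j)
  map_add' := fun A B => by ext i j; exact map_add _ _ _
  map_smul' := fun c A => by ext i j; exact map_smul _ _ _

/-- Entrywise tensor product with an object on the right. -/
def Mat.right (T : TensorData C) {a a' : C.Obj} {X Y : Susp C a a'} (b : C.Obj) :
    Mat X Y →ₗ[k] Mat (X.right T b) (Y.right T b) where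
  toFun := fun A i j => T.right2 b (A i j)
  map_add' := fun A B => by ext i j; exact map_add _ _ _
  map_smul' := fun c A => by ext i j; exact map_smul _ _ _

theorem Mat.left_mem_hDeg (a : C.Obj) {b b' : C.Obj} {X Y : Susp C b b'} {n : ℤ} {A : Mat X Y}
    (hA : A ∈ Mat.hDeg X Y n) : Mat.left T a A ∈ Mat.hDeg (X.left T a) (Y.left T a) n := by
  intro i j h
  change T.left2 a (A i j) = 0
  rw [hA i j h, map_zero]

theorem Mat.right_mem_hDeg {a a' : C.Obj} {X Y : Susp C a a'} (b : C.Obj) {n : ℤ} {A : Mat X Y}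
    (hA : A ∈ Mat.hDeg X Y n) : Mat.right T b A ∈ Mat.hDeg (X.right T b) (Y.right T b) n := by
  intro i j h
  change T.right2 b (A i j) = 0
  rw [hA i j h, map_zero]

section TensorLaws

theorem Mat.left_comp (hT : T.IsLocallyFunctorial) (a : C.Obj) {b b' : C.Obj} {X Y Z : Susp C b b'} (B : Mat Y Z)
    (A : Mat X Y) : Mat.left T a (Mat.comp B A) = Mat.comp (Mat.left T a B) (Mat.left T a A) := by
  ext i l
  change T.left2 a (∑ j, C.vcomp (B j l) (A i j)) = ∑ j, C.vcomp (T.left2 a (B j l)) (T.left2 a _)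
  simp only [map_sum, hT.left2_vcomp]

theorem Mat.right_comp (hT : T.IsLocallyFunctorial) {a a' : C.Obj} {X Y Z : Susp C a a'} (b : C.Obj) (B : Mat Y Z)
    (A : Mat X Y) :
    Mat.right T b (Mat.comp B A) = Mat.comp (Mat.right T b B) (Mat.right T b A) := by
  ext i l
  change T.right2 b (∑ j, C.vcomp (B j l) (A i j))
    = ∑ j, C.vcomp (T.right2 b (B j l)) (T.right2 b _)
  simp only [map_sum, hT.right2_vcomp]

end TensorLaws

variable (hT : T.IsLocallyFunctorial)

/-- Termwise tensor product of a complex with an object on the left. -/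
def Cx.left (a : C.Obj) {b b' : C.Obj} (X : Cx C b b') : Cx C (T.obj a b) (T.obj a b') where
  toSusp := X.toSusp.left T a
  d := Mat.left T a X.d
  d_hDeg := Mat.left_mem_hDeg a X.d_hDeg
  d_qDeg := fun i j => hT.left2_deg a (X.d_qDeg i j)
  d_comp_d := by rw [← Mat.left_comp hT, X.d_comp_d, map_zero]

/-- Termwise tensor product of a complex with an object on the right. -/
def Cx.right {a a' : C.Obj} (X : Cx C a a') (b : C.Obj) : Cx C (T.obj a b) (T.obj a' b) where
  toSusp := X.toSusp.right T b
  d := Mat.right T b X.d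
  d_hDeg := Mat.right_mem_hDeg b X.d_hDeg
  d_qDeg := fun i j => hT.right2_deg b (X.d_qDeg i j)
  d_comp_d := by rw [← Mat.right_comp hT, X.d_comp_d, map_zero]

/-- The functor on homotopy categories induced by tensoring with an object on the left. -/
def Cx.left2 (a : C.Obj) {b b' : C.Obj} {X Y : Cx C b b'} :
    Cx.Hom2 X Y →ₗ[k] Cx.Hom2 (Cx.left hT a X) (Cx.left hT a Y) :=
  SubQuot.map (Mat.left T a)
    (fun A hA => by
      rw [Cx.mem_chainMaps] at *
      refine ⟨Mat.left_mem_hDeg a hA.1, ?_⟩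
      exact (Mat.left_comp hT a _ _).symm.trans
        ((congrArg (Mat.left T a) hA.2).trans (Mat.left_comp hT a _ _)))
    (fun A _ hA => by
      rw [Cx.mem_nullHomotopic] at *
      obtain ⟨H, hH, rfl⟩ := hA
      refine ⟨Mat.left T a H, Mat.left_mem_hDeg a hH, ?_⟩
      exact (congrArg₂ (· + ·) (Mat.left_comp hT a _ _) (Mat.left_comp hT a _ _)).symm.trans
        (map_add (Mat.left T a) _ _).symm)

/-- The functor on homotopy categories induced by tensoring with an object on the right. -/
def Cx.right2 {a a' : C.Obj} {X Y : Cx C a a'} (b : C.Obj) :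
    Cx.Hom2 X Y →ₗ[k] Cx.Hom2 (Cx.right hT X b) (Cx.right hT Y b) :=
  SubQuot.map (Mat.right T b)
    (fun A hA => by
      rw [Cx.mem_chainMaps] at *
      refine ⟨Mat.right_mem_hDeg b hA.1, ?_⟩
      exact (Mat.right_comp hT b _ _).symm.trans
        ((congrArg (Mat.right T b) hA.2).trans (Mat.right_comp hT b _ _)))
    (fun A _ hA => by
      rw [Cx.mem_nullHomotopic] at *
      obtain ⟨H, hH, rfl⟩ := hA
      refine ⟨Mat.right T b H, Mat.right_mem_hDeg b hH, ?_⟩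
      exact (congrArg₂ (· + ·) (Mat.right_comp hT b _ _) (Mat.right_comp hT b _ _)).symm.trans
        (map_add (Mat.right T b) _ _).symm)

/-- The termwise extension of the tensor operations of `C` to complexes. -/
def KbTensor : TensorData (KbLoc hC) where
  unit := T.unit
  obj := T.obj
  left := fun a _ _ => Cx.left hT a
  right := Cx.right hT
  left2 := fun a _ _ _ _ => Cx.left2 hT a
  right2 := Cx.right2 hT

/-- The Koszul-signed termwise tensorator: the term `(f^i ⊗ b') ∘₁ (a ⊗ g^j)` of the source is
mapped to the term `(a' ⊗ g^j) ∘₁ (f^i ⊗ b)` of the target by `(-1)^{s t} τ_{f^i, g^j}`, where `s`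
and `t` are the homological shifts of `f^i` and `g^j`; all other entries are zero. -/
def koszulTensorator (τ : T.Tensorator) {a a' b b' : C.Obj} (f : Cx C a a') (g : Cx C b b') :
    Mat (Cx.comp hC (Cx.right hT f b') (Cx.left hT a g)).toSusp
      (Cx.comp hC (Cx.left hT a' g) (Cx.right hT f b)).toSusp :=
  fun (p : Fin (f.len * g.len)) (r : Fin (g.len * f.len)) =>
    if e : p.divNat = r.modNat ∧ p.modNat = r.divNat then
      koszul k (f.h p.divNat * g.h p.modNat) •
        C.vcomp (C.eqTo (show C.comp (T.left a' (g.obj p.modNat)) (T.right (f.obj p.divNat) b)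
            = C.comp (T.left a' (g.obj r.divNat)) (T.right (f.obj r.modNat) b) by rw [e.1, e.2]))
          (τ (f.obj p.divNat) (g.obj p.modNat))
    else 0

end Ops

end Complexes

/-! ## The semistrict monoidal 2-category of diagrams

Words in the colors `1, …, n - 1` are the 1-endomorphisms of the object `n`. The 2-morphisms
between two words are linear combinations of diagrams, which are composed from horizontally
whiskered generators, modulo the diagrammatic relations of type `A`. -/

section Diagrams

/-- The generating diagrams: trivalent vertices and dots of color `i`, six-valent vertices
`i j i ⟶ j i j` for adjacent colors, crossings `i j ⟶ j i` of distant colors, and boxes labelled by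
the variables `x_k` of the polynomial ring. Diagrams are read from bottom to top. -/
inductive Gen : Type
  | merge (i : ℕ)
  | split (i : ℕ)
  | startdot (i : ℕ)
  | enddot (i : ℕ)
  | six (i j : ℕ)
  | cross (i j : ℕ)
  | box (k : ℕ)

/-- The bottom boundary of a generator. -/
def Gen.src : Gen → List ℕ
  | merge i => [i, i]
  | split i => [i]
  | startdot _ => []
  | enddot i => [i]
  | six i j => [i, j, i]
  | cross i j => [i, j]
  | box _ => []

/-- The top boundary of a generator. -/
def Gen.tgt : Gen → List ℕ
  | merge i => [i]
  | split i => [i, i]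
  | startdot i => [i]
  | enddot _ => []
  | six i j => [j, i, j]
  | cross i j => [j, i]
  | box _ => []

/-- The degree of a generator. -/
def Gen.degree : Gen → ℤ
  | merge _ => -1
  | split _ => -1
  | startdot _ => 1
  | enddot _ => 1
  | six _ _ => 0
  | cross _ _ => 0
  | box _ => 2

/-- The colors of the object `n` are `1, …, n - 1`. -/
def IsColor (n i : ℕ) : Prop := 1 ≤ i ∧ i < n

def Adjacent (i j : ℕ) : Prop := i + 1 = j ∨ j + 1 = i

def Distant (i j : ℕ) : Prop := i + 1 < j ∨ j + 1 < i

/-- The generators which are available over the object `n`; the variables are `x_1, …, x_n`. -/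
def Gen.Ok (n : ℕ) : Gen → Prop
  | merge i => IsColor n i
  | split i => IsColor n i
  | startdot i => IsColor n i
  | enddot i => IsColor n i
  | six i j => IsColor n i ∧ IsColor n j ∧ Adjacent i j
  | cross i j => IsColor n i ∧ IsColor n j ∧ Distant i j
  | box k => 1 ≤ k ∧ k ≤ n

/-- A generator with identity strands `l` to its left and `r` to its right. -/
structure Step where
  l : List ℕ
  gen : Gen
  r : List ℕ

/-- The sequence of steps `L`, read from bottom to top, is a diagram from `w` to `w'`. -/
def IsPath (n : ℕ) : List ℕ → List Step → List ℕ → Prop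
  | w, [], w' => w = w'
  | w, s :: L, w' => s.gen.Ok n ∧ w = s.l ++ s.gen.src ++ s.r ∧
      IsPath n (s.l ++ s.gen.tgt ++ s.r) L w'

/-- Formal linear combinations of sequences of steps; multiplication is concatenation, so that
`x * y` denotes `y` on top of `x`. -/
abbrev Alg : Type := FreeAlgebra ℂ Step

/-- The element of `Alg` given by a sequence of steps. -/
def diag (L : List Step) : Alg := (L.map (FreeAlgebra.ι ℂ)).prod

/-- The single step with generator `g` as an element of `Alg`. -/
def st (l : List ℕ) (g : Gen) (r : List ℕ) : Alg := FreeAlgebra.ι ℂ ⟨l, g, r⟩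

def cap (i : ℕ) (l r : List ℕ) : Alg := st l (.merge i) r * st l (.enddot i) r

def cup (i : ℕ) (l r : List ℕ) : Alg := st l (.startdot i) r * st l (.split i) r

/-- Adding identity strands `u` to the left and `v` to the right. -/
def Step.whisk (u v : List ℕ) (s : Step) : Step := ⟨u ++ s.l, s.gen, s.r ++ v⟩

def whisk (u v : List ℕ) : Alg →ₐ[ℂ] Alg :=
  FreeAlgebra.lift ℂ fun s => FreeAlgebra.ι ℂ (s.whisk u v)

/-- Linear combinations of diagrams from `w` to `w'`. -/
def paths (n : ℕ) (w w' : List ℕ) : Submodule ℂ Alg :=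
  Submodule.span ℂ {x | ∃ L, IsPath n w L w' ∧ x = diag L}

/-- The basic diagrammatic relations: `BasicRel n s t x` says that `x = 0` is one of the defining
relations between diagrams from `s` to `t`. The dumbbell and box relations are imposed for the
variables `x_k`; for arbitrary polynomials they follow by multiplicativity. -/
inductive BasicRel (n : ℕ) : List ℕ → List ℕ → Alg → Prop
  /- distant parts of diagrams commute -/
  | interchange {s s' t t' : List ℕ} {L M : List Step} (hL : IsPath n s L s')
      (hM : IsPath n t M t') :
      BasicRel n (s ++ t) (s' ++ t')
        (whisk [] t (diag L) * whisk s' [] (diag M) - whisk s [] (diag M) * whisk [] t' (diag L))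
  /- each color is a Frobenius algebra -/
  | unit_left {i : ℕ} (hi : IsColor n i) : BasicRel n [i] [i]
      (st [] (.startdot i) [i] * st [] (.merge i) [] - 1)
  | unit_right {i : ℕ} (hi : IsColor n i) : BasicRel n [i] [i]
      (st [i] (.startdot i) [] * st [] (.merge i) [] - 1)
  | counit_left {i : ℕ} (hi : IsColor n i) : BasicRel n [i] [i]
      (st [] (.split i) [] * st [] (.enddot i) [i] - 1)
  | counit_right {i : ℕ} (hi : IsColor n i) : BasicRel n [i] [i]
      (st [] (.split i) [] * st [i] (.enddot i) [] - 1)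
  | assoc {i : ℕ} (hi : IsColor n i) : BasicRel n [i, i, i] [i]
      (st [] (.merge i) [i] * st [] (.merge i) [] - st [i] (.merge i) [] * st [] (.merge i) [])
  | coassoc {i : ℕ} (hi : IsColor n i) : BasicRel n [i] [i, i, i]
      (st [] (.split i) [] * st [] (.split i) [i] - st [] (.split i) [] * st [i] (.split i) [])
  | frobenius_left {i : ℕ} (hi : IsColor n i) : BasicRel n [i, i] [i, i]
      (st [] (.split i) [i] * st [i] (.merge i) [] - st [] (.merge i) [] * st [] (.split i) [])
  | frobenius_right {i : ℕ} (hi : IsColor n i) : BasicRel n [i, i] [i, i]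
      (st [i] (.split i) [] * st [] (.merge i) [i] - st [] (.merge i) [] * st [] (.split i) [])
  /- the rotation of a six-valent vertex or a crossing is again such a vertex -/
  | six_rotation {i j : ℕ} (hi : IsColor n i) (hj : IsColor n j) (hij : Adjacent i j) :
      BasicRel n [j, i, j] [i, j, i]
        (cup i [] [j, i, j] * st [i] (.six i j) [j] * cap j [i, j, i] [] - st [] (.six j i) [])
  | cross_rotation {i j : ℕ} (hi : IsColor n i) (hj : IsColor n j) (hij : Distant i j) :
      BasicRel n [j, i] [i, j]
        (cup i [] [j, i] * st [i] (.cross i j) [i] * cap i [i, j] [] - st [] (.cross j i) [])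
  /- one-color relations -/
  | box_slide {i k : ℕ} (hi : IsColor n i) (hk : 1 ≤ k ∧ k ≤ n) : BasicRel n [i] [i]
      (st [] (.box k) [i] - st [i] (.box (Equiv.swap i (i + 1) k)) []
        - ((if k = i then 1 else 0) - (if k = i + 1 then 1 else 0) : ℂ) •
          (st [] (.enddot i) [] * st [] (.startdot i) []))
  | barbell {i : ℕ} (hi : IsColor n i) : BasicRel n [] []
      (st [] (.startdot i) [] * st [] (.enddot i) [] - (st [] (.box i) [] - st [] (.box (i + 1)) []))
  | needle {i : ℕ} (hi : IsColor n i) : BasicRel n [i] []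
      (st [] (.split i) [] * cap i [] [])
  /- two-color relations -/
  | six_dot {i j : ℕ} (hi : IsColor n i) (hj : IsColor n j) (hij : Adjacent i j) :
      BasicRel n [i, j, i] [j, j]
        (st [] (.six i j) [] * st [j] (.enddot i) [j]
          - (st [i] (.enddot j) [i] * cap i [] [] * cup j [] []
            + st [] (.enddot i) [j, i] * st [j] (.enddot i) [] * st [] (.split j) []))
  | six_merge {i j : ℕ} (hi : IsColor n i) (hj : IsColor n j) (hij : Adjacent i j) :
      BasicRel n [i, j, j, i] [j, i, j]
        (st [i] (.merge j) [i] * st [] (.six i j) []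
          - cup i [i, j] [j, i] * st [] (.six i j) [i, j, i] * st [j, i, j] (.six i j) [] *
            cap j [j, i] [i, j] * st [j] (.merge i) [j])
  | cross_dot {i j : ℕ} (hi : IsColor n i) (hj : IsColor n j) (hij : Distant i j) :
      BasicRel n [i, j] [j]
        (st [] (.cross i j) [] * st [j] (.enddot i) [] - st [] (.enddot i) [j])
  | cross_merge {i j : ℕ} (hi : IsColor n i) (hj : IsColor n j) (hij : Distant i j) :
      BasicRel n [i, i, j] [j, i]
        (st [] (.merge i) [j] * st [] (.cross i j) []
          - st [i] (.cross i j) [] * st [] (.cross i j) [i] * st [j] (.merge i) [])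
  /- three-color relations -/
  | cross_cross {i j l : ℕ} (hi : IsColor n i) (hj : IsColor n j) (hl : IsColor n l)
      (hij : Distant i j) (hil : Distant i l) (hjl : Distant j l) :
      BasicRel n [i, j, l] [l, j, i]
        (st [] (.cross i j) [l] * st [j] (.cross i l) [] * st [] (.cross j l) [i]
          - st [i] (.cross j l) [] * st [] (.cross i l) [j] * st [l] (.cross i j) [])
  | six_cross {i j l : ℕ} (hi : IsColor n i) (hj : IsColor n j) (hl : IsColor n l)
      (hij : Adjacent i j) (hil : Distant i l) (hjl : Distant j l) :
      BasicRel n [i, j, i, l] [l, j, i, j]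
        (st [] (.six i j) [l] * st [j, i] (.cross j l) [] * st [j] (.cross i l) [j] *
            st [] (.cross j l) [i, j]
          - st [i, j] (.cross i l) [] * st [i] (.cross j l) [i] * st [] (.cross i l) [j, i] *
            st [l] (.six i j) [])
  | six_six {i j l : ℕ} (hi : IsColor n i) (hj : IsColor n j) (hl : IsColor n l)
      (hij : Adjacent i j) (hjl : Adjacent j l) (hil : Distant i l) :
      BasicRel n [i, j, l, i, j, i] [l, j, l, i, j, l]
        (st [i, j] (.cross l i) [j, i] * st [] (.six i j) [l, j, i] * st [j, i] (.six j l) [i] *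
            st [j] (.cross i l) [j, l, i] * st [j, l, i, j] (.cross l i) [] *
            st [j, l] (.six i j) [l] * st [] (.six j l) [i, j, l]
          - st [i, j, l] (.six i j) [] * st [i] (.six j l) [i, j] * st [i, l, j] (.cross l i) [j] *
            st [] (.cross i l) [j, i, l, j] * st [l] (.six i j) [l, j] *
            st [l, j, i] (.six j l) [] * st [l, j] (.cross i l) [j, l])

/-- All consequences of the basic relations between diagrams from `w` to `w'`: the relations are
imposed locally, inside of arbitrary diagrams. -/
def relations (n : ℕ) (w w' : List ℕ) : Submodule ℂ Alg :=
  Submodule.span ℂ {x | ∃ u v s t ρ L M, BasicRel n s t ρ ∧ IsPath n w L (u ++ s ++ v) ∧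
    IsPath n (u ++ t ++ v) M w' ∧ x = diag L * whisk u v ρ * diag M}

/-- Diagrams from `w` to `w'` modulo relations. -/
abbrev DHom (n : ℕ) (w w' : List ℕ) : Type := SubQuot (paths n w w') (relations n w w')

/-- Linear combinations of diagrams of degree `d`. -/
def homogeneous (n : ℕ) (w w' : List ℕ) (d : ℤ) : Submodule ℂ Alg :=
  Submodule.span ℂ {x | ∃ L, IsPath n w L w' ∧ (L.map fun s => s.gen.degree).sum = d ∧ x = diag L}

/-! ### Elementary properties of diagrams -/

theorem diag_nil : diag [] = 1 := rfl

theorem diag_cons (s : Step) (L : List Step) : diag (s :: L) = FreeAlgebra.ι ℂ s * diag L := by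
  simp [diag]

theorem diag_append (L M : List Step) : diag (L ++ M) = diag L * diag M := by simp [diag]

theorem IsPath.append {n : ℕ} : ∀ {L M : List Step} {w w' w'' : List ℕ}, IsPath n w L w' →
    IsPath n w' M w'' → IsPath n w (L ++ M) w''
  | [], _, _, _, _, h, h' => by cases h; exact h'
  | _ :: _, _, _, _, _, h, h' => ⟨h.1, h.2.1, IsPath.append h.2.2 h'⟩

theorem IsPath.whisk {n : ℕ} (u v : List ℕ) : ∀ {L : List Step} {w w' : List ℕ}, IsPath n w L w' →
    IsPath n (u ++ w ++ v) (L.map (Step.whisk u v)) (u ++ w' ++ v)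
  | [], _, _, h => by cases h; rfl
  | s :: _, _, _, h => by
    refine ⟨h.1, ?_, ?_⟩
    · rw [h.2.1]; simp [Step.whisk]
    · have := IsPath.whisk u v h.2.2
      simpa [Step.whisk] using this

theorem whisk_diag (u v : List ℕ) (L : List Step) :
    whisk u v (diag L) = diag (L.map (Step.whisk u v)) := by
  induction L with
  | nil => simp [diag]
  | cons s L ih => rw [diag_cons, map_mul, ih, List.map_cons, diag_cons]; simp [whisk]

theorem whisk_whisk (u v u' v' : List ℕ) (x : Alg) :
    whisk u v (whisk u' v' x) = whisk (u ++ u') (v' ++ v) x := by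
  have : (whisk u v).comp (whisk u' v') = whisk (u ++ u') (v' ++ v) := by
    ext s
    simp [whisk, Step.whisk]
  exact DFunLike.congr_fun this x

theorem diag_mem_paths {n : ℕ} {w w' : List ℕ} {L : List Step} (h : IsPath n w L w') :
    diag L ∈ paths n w w' := Submodule.subset_span ⟨L, h, rfl⟩

theorem one_mem_paths (n : ℕ) (w : List ℕ) : (1 : Alg) ∈ paths n w w :=
  diag_mem_paths (L := []) rfl

/-- A linear map sends one span into a submodule once it does so on generators. -/
theorem map_mem_of_span {M M' : Type} [AddCommGroup M] [Module ℂ M] [AddCommGroup M'] [Module ℂ M']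
    (φ : M →ₗ[ℂ] M') {S : Set M} {N : Submodule ℂ M'} (h : ∀ x ∈ S, φ x ∈ N) :
    ∀ x ∈ Submodule.span ℂ S, φ x ∈ N :=
  fun _ hx => (Submodule.span_le (p := N.comap φ)).2 h hx

theorem map₂_mem_of_span {M M' M'' : Type} [AddCommGroup M] [Module ℂ M] [AddCommGroup M']
    [Module ℂ M'] [AddCommGroup M''] [Module ℂ M''] (φ : M →ₗ[ℂ] M' →ₗ[ℂ] M'') {S : Set M}
    {S' : Set M'} {N : Submodule ℂ M''} (h : ∀ x ∈ S, ∀ y ∈ S', φ x y ∈ N) :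
    ∀ x ∈ Submodule.span ℂ S, ∀ y ∈ Submodule.span ℂ S', φ x y ∈ N :=
  fun x hx y hy => map_mem_of_span (φ.flip y)
    (fun x hx => map_mem_of_span (φ x) (fun y hy => h x hx y hy) y hy) x hx

theorem mul_mem_paths {n : ℕ} {w w' w'' : List ℕ} : ∀ x ∈ paths n w w', ∀ y ∈ paths n w' w'',
    x * y ∈ paths n w w'' :=
  map₂_mem_of_span (LinearMap.mul ℂ Alg) (by
    rintro _ ⟨L, hL, rfl⟩ _ ⟨M, hM, rfl⟩
    exact Submodule.subset_span ⟨L ++ M, hL.append hM, (diag_append L M).symm⟩)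

theorem whisk_mem_paths {n : ℕ} {w w' : List ℕ} (u v : List ℕ) : ∀ x ∈ paths n w w',
    whisk u v x ∈ paths n (u ++ w ++ v) (u ++ w' ++ v) :=
  map_mem_of_span (whisk u v).toLinearMap (by
    rintro _ ⟨L, hL, rfl⟩
    exact Submodule.subset_span ⟨_, hL.whisk u v, whisk_diag u v L⟩)

theorem mul_mem_relations_left {n : ℕ} {w w' w'' : List ℕ} : ∀ x ∈ relations n w w',
    ∀ y ∈ paths n w' w'', x * y ∈ relations n w w'' :=
  map₂_mem_of_span (LinearMap.mul ℂ Alg) (by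
    rintro _ ⟨u, v, s, t, ρ, L, M, hρ, hL, hM, rfl⟩ _ ⟨M', hM', rfl⟩
    refine Submodule.subset_span ⟨u, v, s, t, ρ, L, M ++ M', hρ, hL, hM.append hM', ?_⟩
    simp only [diag_append, LinearMap.mul_apply', mul_assoc])

theorem mul_mem_relations_right {n : ℕ} {w w' w'' : List ℕ} : ∀ x ∈ paths n w w',
    ∀ y ∈ relations n w' w'', x * y ∈ relations n w w'' :=
  map₂_mem_of_span (LinearMap.mul ℂ Alg) (by
    rintro _ ⟨L', hL', rfl⟩ _ ⟨u, v, s, t, ρ, L, M, hρ, hL, hM, rfl⟩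
    refine Submodule.subset_span ⟨u, v, s, t, ρ, L' ++ L, M, hρ, hL'.append hL, hM, ?_⟩
    simp only [diag_append, LinearMap.mul_apply', mul_assoc])

theorem whisk_mem_relations {n : ℕ} {w w' : List ℕ} (u v : List ℕ) : ∀ x ∈ relations n w w',
    whisk u v x ∈ relations n (u ++ w ++ v) (u ++ w' ++ v) :=
  map_mem_of_span (whisk u v).toLinearMap (by
    rintro _ ⟨u', v', s, t, ρ, L, M, hρ, hL, hM, rfl⟩
    refine Submodule.subset_span ⟨u ++ u', v' ++ v, s, t, ρ, L.map (Step.whisk u v),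
      M.map (Step.whisk u v), hρ, ?_, ?_, ?_⟩
    · simpa using hL.whisk u v
    · simpa using hM.whisk u v
    · rw [← whisk_diag, ← whisk_diag, ← whisk_whisk]
      simp)

/-- Distant parts of diagrams commute. -/
theorem interchange_mem_relations {n : ℕ} {s s' t t' : List ℕ} : ∀ x ∈ paths n s s',
    ∀ y ∈ paths n t t', whisk [] t x * whisk s' [] y - whisk s [] y * whisk [] t' x
      ∈ relations n (s ++ t) (s' ++ t') :=
  map₂_mem_of_span
    (((LinearMap.mul ℂ Alg).compl₁₂ (whisk [] t).toLinearMap (whisk s' []).toLinearMap)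
      - ((LinearMap.mul ℂ Alg).flip.compl₁₂ (whisk [] t').toLinearMap (whisk s []).toLinearMap)) (by
    rintro _ ⟨L, hL, rfl⟩ _ ⟨M, hM, rfl⟩
    refine Submodule.subset_span ⟨[], [], _, _, _, [], [], BasicRel.interchange hL hM, ?_, ?_, ?_⟩
    · simp [IsPath]
    · simp [IsPath]
    · rw [diag_nil, one_mul, mul_one, map_sub, map_mul, map_mul]
      simp [whisk_whisk])

theorem homogeneous_le_paths (n : ℕ) (w w' : List ℕ) (d : ℤ) :
    homogeneous n w w' d ≤ paths n w w' :=
  Submodule.span_mono fun _ ⟨L, hL, _, hx⟩ => ⟨L, hL, hx⟩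

theorem mul_mem_homogeneous {n : ℕ} {w w' w'' : List ℕ} {d e f : ℤ} (hf : f = d + e) :
    ∀ x ∈ homogeneous n w w' d, ∀ y ∈ homogeneous n w' w'' e, x * y ∈ homogeneous n w w'' f :=
  map₂_mem_of_span (LinearMap.mul ℂ Alg) (by
    rintro _ ⟨L, hL, hd, rfl⟩ _ ⟨M, hM, he, rfl⟩
    refine Submodule.subset_span ⟨L ++ M, hL.append hM, ?_, (diag_append L M).symm⟩
    rw [List.map_append, List.sum_append, hd, he, hf])

theorem whisk_mem_homogeneous {n : ℕ} {w w' : List ℕ} (u v : List ℕ) {d : ℤ} :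
    ∀ x ∈ homogeneous n w w' d, whisk u v x ∈ homogeneous n (u ++ w ++ v) (u ++ w' ++ v) d :=
  map_mem_of_span (whisk u v).toLinearMap (by
    rintro _ ⟨L, hL, hd, rfl⟩
    refine Submodule.subset_span ⟨_, hL.whisk u v, ?_, whisk_diag u v L⟩
    rw [List.map_map, ← hd]
    rfl)

/-! ### The 2-category -/

/-- The 1-morphisms from `m` to `n`: words in the colors if `m = n`, and none otherwise. -/
structure DWord (m n : ℕ) where
  letters : List ℕ
  eq : m = n
  valid : ∀ i ∈ letters, IsColor m i

def DWord.one (n : ℕ) : DWord n n := ⟨[], rfl, by simp⟩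

def DWord.comp {m n p : ℕ} (g : DWord n p) (f : DWord m n) : DWord m p :=
  ⟨g.letters ++ f.letters, f.eq.trans g.eq, fun i hi => by
    rcases List.mem_append.1 hi with h | h
    · exact f.eq ▸ g.valid i h
    · exact f.valid i h⟩

abbrev DWord.Hom2 {m n : ℕ} (f g : DWord m n) : Type := DHom m f.letters g.letters

/-- The vertical composition `β ∘₂ α` places `β` on top of `α`. -/
def DWord.vcomp {m n : ℕ} {f g h : DWord m n} : DWord.Hom2 g h →ₗ[ℂ] DWord.Hom2 f g →ₗ[ℂ]
    DWord.Hom2 f h :=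
  SubQuot.map₂ (LinearMap.mul ℂ Alg).flip
    (fun y hy x hx => mul_mem_paths x hx y hy)
    (fun y _ hy x hx => mul_mem_relations_right x hx y hy)
    (fun y hy x _ hx => mul_mem_relations_left x hx y hy)

/-- Placing `x` to the left of `y`, where `x` ends at `s'` and `y` starts at `t`. -/
def juxtapose (s' t : List ℕ) : Alg →ₗ[ℂ] Alg →ₗ[ℂ] Alg :=
  (LinearMap.mul ℂ Alg).compl₁₂ (whisk [] t).toLinearMap (whisk s' []).toLinearMap

theorem juxtapose_apply (s' t : List ℕ) (x y : Alg) :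
    juxtapose s' t x y = whisk [] t x * whisk s' [] y := rfl

theorem juxtapose_mem_paths {n : ℕ} {s s' t t' : List ℕ} : ∀ x ∈ paths n s s', ∀ y ∈ paths n t t',
    juxtapose s' t x y ∈ paths n (s ++ t) (s' ++ t') := fun x hx y hy =>
  mul_mem_paths _ (whisk_mem_paths [] t x hx) _ (by simpa using whisk_mem_paths s' [] y hy)

theorem juxtapose_mem_relations_left {n : ℕ} {s s' t t' : List ℕ} : ∀ x ∈ relations n s s',
    ∀ y ∈ paths n t t', juxtapose s' t x y ∈ relations n (s ++ t) (s' ++ t') := fun x hx y hy =>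
  mul_mem_relations_left _ (whisk_mem_relations [] t x hx) _
    (by simpa using whisk_mem_paths s' [] y hy)

theorem juxtapose_mem_relations_right {n : ℕ} {s s' t t' : List ℕ} : ∀ x ∈ paths n s s',
    ∀ y ∈ relations n t t', juxtapose s' t x y ∈ relations n (s ++ t) (s' ++ t') :=
  fun x hx y hy => mul_mem_relations_right _ (whisk_mem_paths [] t x hx) _
    (by simpa using whisk_mem_relations s' [] y hy)

theorem juxtapose_mem_homogeneous {n : ℕ} {s s' t t' : List ℕ} {d e : ℤ} :
    ∀ x ∈ homogeneous n s s' d, ∀ y ∈ homogeneous n t t' e,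
      juxtapose s' t x y ∈ homogeneous n (s ++ t) (s' ++ t') (d + e) := fun x hx y hy =>
  mul_mem_homogeneous rfl _ (whisk_mem_homogeneous [] t x hx) _
    (by simpa using whisk_mem_homogeneous s' [] y hy)

/-- The horizontal composition `β ∘₁ α` places `β` to the left of `α`. -/
def DWord.hcomp {m n p : ℕ} {g g' : DWord n p} {f f' : DWord m n} : DWord.Hom2 g g' →ₗ[ℂ]
    DWord.Hom2 f f' →ₗ[ℂ] DWord.Hom2 (DWord.comp g f) (DWord.comp g' f') :=
  SubQuot.map₂ (juxtapose g'.letters f.letters)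
    (fun x hx y hy => juxtapose_mem_paths x (f.eq ▸ hx) y hy)
    (fun x _ hx y hy => juxtapose_mem_relations_left x (f.eq ▸ hx) y hy)
    (fun x hx y _ hy => juxtapose_mem_relations_right x (f.eq ▸ hx) y hy)

/-- The data of the locally graded `ℂ`-linear 2-category of diagrams. -/
def Diag : TwoCatData ℂ where
  Obj := ℕ
  Hom := DWord
  Hom2 := DWord.Hom2
  deg := fun {m _} f g d => SubQuot.image _ _ (homogeneous m f.letters g.letters d)
  one := DWord.one
  comp := DWord.comp
  id2 := fun {m _} f => SubQuot.cls 1 (one_mem_paths m f.letters)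
  vcomp := DWord.vcomp
  hcomp := DWord.hcomp

theorem SubQuot.mem_image {k M : Type} [Field k] [AddCommGroup M] [Module k M]
    {Z B G : Submodule k M} {x : SubQuot Z B} :
    x ∈ SubQuot.image Z B G ↔ ∃ y, ∃ hy : y ∈ Z, y ∈ G ∧ x = SubQuot.cls y hy := by
  constructor
  · rintro ⟨⟨y, hy⟩, hG, rfl⟩
    exact ⟨y, hy, hG, rfl⟩
  · rintro ⟨y, hy, hG, rfl⟩
    exact ⟨⟨y, hy⟩, hG, rfl⟩

theorem Diag.isLocallyFunctorial : Diag.IsLocallyFunctorial where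
  vcomp_assoc := by
    intro a b f g h l γ β α
    obtain ⟨z, hz, rfl⟩ := SubQuot.exists_cls γ
    obtain ⟨y, hy, rfl⟩ := SubQuot.exists_cls β
    obtain ⟨x, hx, rfl⟩ := SubQuot.exists_cls α
    exact SubQuot.cls_congr _ (mul_assoc x y z).symm
  id_vcomp := by
    intro a b f g α
    obtain ⟨x, hx, rfl⟩ := SubQuot.exists_cls α
    exact SubQuot.cls_congr _ (mul_one x)
  vcomp_id := by
    intro a b f g α
    obtain ⟨x, hx, rfl⟩ := SubQuot.exists_cls α
    exact SubQuot.cls_congr _ (one_mul x)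
  hcomp_id := by
    intro a b c g f
    have h : juxtapose g.letters f.letters 1 1 = 1 := by
      rw [juxtapose_apply, map_one, map_one, one_mul]
    exact SubQuot.cls_congr _ h
  interchange := by
    intro a b c g g' g'' f f' f'' β' β α' α
    obtain ⟨y', hy', rfl⟩ := SubQuot.exists_cls β'
    obtain ⟨y, hy, rfl⟩ := SubQuot.exists_cls β
    obtain ⟨x', hx', rfl⟩ := SubQuot.exists_cls α'
    obtain ⟨x, hx, rfl⟩ := SubQuot.exists_cls α
    have hab : a = b := f.eq
    subst hab
    refine SubQuot.cls_eq _ _ ?_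
    change juxtapose g'.letters f.letters y x * juxtapose g''.letters f'.letters y' x'
      - juxtapose g''.letters f.letters (y * y') (x * x') ∈
        relations a (g.letters ++ f.letters) (g''.letters ++ f''.letters)
    have h1 := interchange_mem_relations y' hy' x hx
    have h2 := mul_mem_relations_right _ (whisk_mem_paths [] f.letters y hy) _ h1
    have h3 := mul_mem_relations_left _ h2 (whisk g''.letters [] x')
      (by simpa using whisk_mem_paths g''.letters [] x' hx')
    have h4 := Submodule.neg_mem _ h3
    simp only [juxtapose_apply, map_mul]
    refine cast (congrArg (· ∈ relations a (g.letters ++ f.letters) _) ?_) h4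
    noncomm_ring
  id2_deg := by
    intro a b f
    exact SubQuot.mem_image.2 ⟨1, _, Submodule.subset_span ⟨[], rfl, rfl, rfl⟩, rfl⟩
  vcomp_deg := by
    intro a b f g h d e β α hβ hα
    obtain ⟨y, hy, hy', rfl⟩ := SubQuot.mem_image.1 hβ
    obtain ⟨x, hx, hx', rfl⟩ := SubQuot.mem_image.1 hα
    exact SubQuot.mem_image.2 ⟨x * y, mul_mem_paths x hx y hy,
      mul_mem_homogeneous (add_comm d e) x hx' y hy', rfl⟩
  hcomp_deg := by
    intro a b c g g' f f' d e β α hβ hα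
    obtain ⟨y, hy, hy', rfl⟩ := SubQuot.mem_image.1 hβ
    obtain ⟨x, hx, hx', rfl⟩ := SubQuot.mem_image.1 hα
    have hab : a = b := f.eq
    subst hab
    exact SubQuot.mem_image.2 ⟨juxtapose g'.letters f.letters y x, juxtapose_mem_paths y hy x hx,
      juxtapose_mem_homogeneous y hy' x hx', rfl⟩

/-! ### The tensor product -/

/-- Adding `a` to all colors and to the indices of all variables. -/
def Gen.shift (a : ℕ) : Gen → Gen
  | merge i => merge (a + i)
  | split i => split (a + i)
  | startdot i => startdot (a + i)
  | enddot i => enddot (a + i)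
  | six i j => six (a + i) (a + j)
  | cross i j => cross (a + i) (a + j)
  | box k => box (a + k)

def Step.shift (a : ℕ) (s : Step) : Step := ⟨s.l.map (a + ·), s.gen.shift a, s.r.map (a + ·)⟩

def shift (a : ℕ) : Alg →ₐ[ℂ] Alg :=
  FreeAlgebra.lift ℂ fun s => FreeAlgebra.ι ℂ (s.shift a)

theorem shift_st (a : ℕ) (l : List ℕ) (g : Gen) (r : List ℕ) :
    shift a (st l g r) = st (l.map (a + ·)) (g.shift a) (r.map (a + ·)) := by
  simp [shift, st, Step.shift]

theorem shift_cap (a i : ℕ) (l r : List ℕ) :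
    shift a (cap i l r) = cap (a + i) (l.map (a + ·)) (r.map (a + ·)) := by
  simp [cap, shift_st, Gen.shift]

theorem shift_cup (a i : ℕ) (l r : List ℕ) :
    shift a (cup i l r) = cup (a + i) (l.map (a + ·)) (r.map (a + ·)) := by
  simp [cup, shift_st, Gen.shift]

theorem shift_whisk (a : ℕ) (u v : List ℕ) (x : Alg) :
    shift a (whisk u v x) = whisk (u.map (a + ·)) (v.map (a + ·)) (shift a x) := by
  have : (shift a).comp (whisk u v) = (whisk (u.map (a + ·)) (v.map (a + ·))).comp (shift a) := by
    ext s
    simp [whisk, shift, Step.whisk, Step.shift]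
  exact DFunLike.congr_fun this x

theorem shift_diag (a : ℕ) (L : List Step) : shift a (diag L) = diag (L.map (Step.shift a)) := by
  induction L with
  | nil => simp [diag]
  | cons s L ih => rw [diag_cons, map_mul, ih, List.map_cons, diag_cons]; simp [shift]

theorem Gen.src_shift (a : ℕ) (g : Gen) : (g.shift a).src = g.src.map (a + ·) := by
  cases g <;> rfl

theorem Gen.tgt_shift (a : ℕ) (g : Gen) : (g.shift a).tgt = g.tgt.map (a + ·) := by
  cases g <;> rfl

theorem Gen.degree_shift (a : ℕ) (g : Gen) : (g.shift a).degree = g.degree := by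
  cases g <;> rfl

theorem IsColor.shift {n i : ℕ} (a : ℕ) (h : IsColor n i) : IsColor (a + n) (a + i) := by
  obtain ⟨h1, h2⟩ := h
  exact ⟨by omega, by omega⟩

theorem Adjacent.shift {i j : ℕ} (a : ℕ) (h : Adjacent i j) : Adjacent (a + i) (a + j) := by
  unfold Adjacent at *
  omega

theorem Distant.shift {i j : ℕ} (a : ℕ) (h : Distant i j) : Distant (a + i) (a + j) := by
  unfold Distant at *
  omega

theorem Gen.Ok.shift {n : ℕ} (a : ℕ) {g : Gen} (h : g.Ok n) : (g.shift a).Ok (a + n) := by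
  cases g
  case box k => exact ⟨by have := h.1; omega, by have := h.2; omega⟩
  case six i j => exact ⟨h.1.shift a, h.2.1.shift a, h.2.2.shift a⟩
  case cross i j => exact ⟨h.1.shift a, h.2.1.shift a, h.2.2.shift a⟩
  all_goals exact IsColor.shift a h

theorem IsColor.mono {n i : ℕ} (b : ℕ) (h : IsColor n i) : IsColor (n + b) i := by
  obtain ⟨h1, h2⟩ := h
  exact ⟨by omega, by omega⟩

theorem Gen.Ok.mono {n : ℕ} (b : ℕ) {g : Gen} (h : g.Ok n) : g.Ok (n + b) := by
  cases g
  case box k => exact ⟨h.1, by have := h.2; omega⟩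
  case six i j => exact ⟨h.1.mono b, h.2.1.mono b, h.2.2⟩
  case cross i j => exact ⟨h.1.mono b, h.2.1.mono b, h.2.2⟩
  all_goals exact IsColor.mono b h

theorem IsPath.shift {n : ℕ} (a : ℕ) : ∀ {L : List Step} {w w' : List ℕ}, IsPath n w L w' →
    IsPath (a + n) (w.map (a + ·)) (L.map (Step.shift a)) (w'.map (a + ·))
  | [], _, _, h => by cases h; rfl
  | s :: _, _, _, h => by
    refine ⟨h.1.shift a, ?_, ?_⟩
    · rw [h.2.1]; simp [Step.shift, Gen.src_shift]
    · have := IsPath.shift a h.2.2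
      simpa [Step.shift, Gen.tgt_shift] using this

theorem IsPath.mono {n : ℕ} (b : ℕ) : ∀ {L : List Step} {w w' : List ℕ}, IsPath n w L w' →
    IsPath (n + b) w L w'
  | [], _, _, h => h
  | _ :: _, _, _, h => ⟨h.1.mono b, h.2.1, IsPath.mono b h.2.2⟩

theorem swap_shift (a i k : ℕ) :
    a + Equiv.swap i (i + 1) k = Equiv.swap (a + i) (a + i + 1) (a + k) := by
  simp only [Equiv.swap_apply_def]
  split_ifs <;> omega

theorem BasicRel.shift {n : ℕ} (a : ℕ) {s t : List ℕ} {ρ : Alg} (h : BasicRel n s t ρ) :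
    BasicRel (a + n) (s.map (a + ·)) (t.map (a + ·)) (SoergelGray.shift a ρ) := by
  cases h with
  | interchange hL hM =>
    simpa only [map_sub, map_mul, shift_whisk, shift_diag, List.map_append] using!
      BasicRel.interchange (hL.shift a) (hM.shift a)
  | box_slide hi hk =>
    have := BasicRel.box_slide (hi.shift a) (n := a + n)
      (k := _) (⟨Nat.le_add_left_of_le hk.1, Nat.add_le_add_left hk.2 a⟩)
    simpa [shift_st, Gen.shift, swap_shift, add_assoc] using this
  | unit_left hi => simpa [shift_st, Gen.shift] using BasicRel.unit_left (hi.shift a)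
  | unit_right hi => simpa [shift_st, Gen.shift] using BasicRel.unit_right (hi.shift a)
  | counit_left hi => simpa [shift_st, Gen.shift] using BasicRel.counit_left (hi.shift a)
  | counit_right hi => simpa [shift_st, Gen.shift] using BasicRel.counit_right (hi.shift a)
  | assoc hi => simpa [shift_st, Gen.shift] using BasicRel.assoc (hi.shift a)
  | coassoc hi => simpa [shift_st, Gen.shift] using BasicRel.coassoc (hi.shift a)
  | frobenius_left hi => simpa [shift_st, Gen.shift] using BasicRel.frobenius_left (hi.shift a)
  | frobenius_right hi => simpa [shift_st, Gen.shift] using BasicRel.frobenius_right (hi.shift a)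
  | barbell hi => simpa [shift_st, Gen.shift, add_assoc] using BasicRel.barbell (hi.shift a)
  | needle hi => simpa [shift_st, shift_cap, Gen.shift] using BasicRel.needle (hi.shift a)
  | six_rotation hi hj hij =>
    simpa [shift_st, shift_cap, shift_cup, Gen.shift] using
      BasicRel.six_rotation (hi.shift a) (hj.shift a) (hij.shift a)
  | cross_rotation hi hj hij =>
    simpa [shift_st, shift_cap, shift_cup, Gen.shift] using
      BasicRel.cross_rotation (hi.shift a) (hj.shift a) (hij.shift a)
  | six_dot hi hj hij =>
    simpa [shift_st, shift_cap, shift_cup, Gen.shift] using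
      BasicRel.six_dot (hi.shift a) (hj.shift a) (hij.shift a)
  | six_merge hi hj hij =>
    simpa [shift_st, shift_cap, shift_cup, Gen.shift] using
      BasicRel.six_merge (hi.shift a) (hj.shift a) (hij.shift a)
  | cross_dot hi hj hij =>
    simpa [shift_st, Gen.shift] using
      BasicRel.cross_dot (hi.shift a) (hj.shift a) (hij.shift a)
  | cross_merge hi hj hij =>
    simpa [shift_st, Gen.shift] using
      BasicRel.cross_merge (hi.shift a) (hj.shift a) (hij.shift a)
  | cross_cross hi hj hl hij hil hjl =>
    simpa [shift_st, Gen.shift] using BasicRel.cross_cross (hi.shift a) (hj.shift a) (hl.shift a)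
      (hij.shift a) (hil.shift a) (hjl.shift a)
  | six_cross hi hj hl hij hil hjl =>
    simpa [shift_st, Gen.shift] using BasicRel.six_cross (hi.shift a) (hj.shift a) (hl.shift a)
      (hij.shift a) (hil.shift a) (hjl.shift a)
  | six_six hi hj hl hij hjl hil =>
    simpa [shift_st, Gen.shift] using BasicRel.six_six (hi.shift a) (hj.shift a) (hl.shift a)
      (hij.shift a) (hjl.shift a) (hil.shift a)

theorem BasicRel.mono {n : ℕ} (b : ℕ) {s t : List ℕ} {ρ : Alg} (h : BasicRel n s t ρ) :
    BasicRel (n + b) s t ρ := by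
  cases h with
  | interchange hL hM => exact .interchange (hL.mono b) (hM.mono b)
  | box_slide hi hk => exact .box_slide (hi.mono b) ⟨hk.1, by have := hk.2; omega⟩
  | unit_left hi => exact .unit_left (hi.mono b)
  | unit_right hi => exact .unit_right (hi.mono b)
  | counit_left hi => exact .counit_left (hi.mono b)
  | counit_right hi => exact .counit_right (hi.mono b)
  | assoc hi => exact .assoc (hi.mono b)
  | coassoc hi => exact .coassoc (hi.mono b)
  | frobenius_left hi => exact .frobenius_left (hi.mono b)
  | frobenius_right hi => exact .frobenius_right (hi.mono b)
  | barbell hi => exact .barbell (hi.mono b)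
  | needle hi => exact .needle (hi.mono b)
  | six_rotation hi hj hij => exact .six_rotation (hi.mono b) (hj.mono b) hij
  | cross_rotation hi hj hij => exact .cross_rotation (hi.mono b) (hj.mono b) hij
  | six_dot hi hj hij => exact .six_dot (hi.mono b) (hj.mono b) hij
  | six_merge hi hj hij => exact .six_merge (hi.mono b) (hj.mono b) hij
  | cross_dot hi hj hij => exact .cross_dot (hi.mono b) (hj.mono b) hij
  | cross_merge hi hj hij => exact .cross_merge (hi.mono b) (hj.mono b) hij
  | cross_cross hi hj hl hij hil hjl =>
    exact .cross_cross (hi.mono b) (hj.mono b) (hl.mono b) hij hil hjl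
  | six_cross hi hj hl hij hil hjl =>
    exact .six_cross (hi.mono b) (hj.mono b) (hl.mono b) hij hil hjl
  | six_six hi hj hl hij hjl hil =>
    exact .six_six (hi.mono b) (hj.mono b) (hl.mono b) hij hjl hil

theorem shift_mem_paths {n : ℕ} (a : ℕ) {w w' : List ℕ} : ∀ x ∈ paths n w w',
    shift a x ∈ paths (a + n) (w.map (a + ·)) (w'.map (a + ·)) :=
  map_mem_of_span (shift a).toLinearMap (by
    rintro _ ⟨L, hL, rfl⟩
    exact Submodule.subset_span ⟨_, hL.shift a, shift_diag a L⟩)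

theorem shift_mem_relations {n : ℕ} (a : ℕ) {w w' : List ℕ} : ∀ x ∈ relations n w w',
    shift a x ∈ relations (a + n) (w.map (a + ·)) (w'.map (a + ·)) :=
  map_mem_of_span (shift a).toLinearMap (by
    rintro _ ⟨u, v, s, t, ρ, L, M, hρ, hL, hM, rfl⟩
    refine Submodule.subset_span ⟨u.map (a + ·), v.map (a + ·), _, _, _, L.map (Step.shift a),
      M.map (Step.shift a), hρ.shift a, ?_, ?_, ?_⟩
    · simpa only [List.map_append] using hL.shift a
    · simpa only [List.map_append] using hM.shift a
    · rw [← shift_diag, ← shift_diag, ← shift_whisk]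
      simp)

theorem shift_mem_homogeneous {n : ℕ} (a : ℕ) {w w' : List ℕ} {d : ℤ} :
    ∀ x ∈ homogeneous n w w' d,
      shift a x ∈ homogeneous (a + n) (w.map (a + ·)) (w'.map (a + ·)) d :=
  map_mem_of_span (shift a).toLinearMap (by
    rintro _ ⟨L, hL, hd, rfl⟩
    refine Submodule.subset_span ⟨_, hL.shift a, ?_, shift_diag a L⟩
    rw [List.map_map, ← hd]
    exact congrArg List.sum (List.map_congr_left fun s _ => Gen.degree_shift a s.gen))

theorem paths_mono {n : ℕ} (b : ℕ) (w w' : List ℕ) : paths n w w' ≤ paths (n + b) w w' :=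
  Submodule.span_mono fun _ ⟨L, hL, hx⟩ => ⟨L, hL.mono b, hx⟩

theorem relations_mono {n : ℕ} (b : ℕ) (w w' : List ℕ) :
    relations n w w' ≤ relations (n + b) w w' :=
  Submodule.span_mono fun _ ⟨u, v, s, t, ρ, L, M, hρ, hL, hM, hx⟩ =>
    ⟨u, v, s, t, ρ, L, M, hρ.mono b, hL.mono b, hM.mono b, hx⟩

theorem homogeneous_mono {n : ℕ} (b : ℕ) (w w' : List ℕ) (d : ℤ) :
    homogeneous n w w' d ≤ homogeneous (n + b) w w' d :=
  Submodule.span_mono fun _ ⟨L, hL, hd, hx⟩ => ⟨L, hL.mono b, hd, hx⟩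

/-- The tensor product `a ⊗ -` on 1-morphisms shifts all colors by `a`. -/
def DWord.left (a : ℕ) {b b' : ℕ} (g : DWord b b') : DWord (a + b) (a + b') :=
  ⟨g.letters.map (a + ·), congrArg (a + ·) g.eq, fun i hi => by
    obtain ⟨j, hj, rfl⟩ := List.mem_map.1 hi
    exact (g.valid j hj).shift a⟩

/-- The tensor product `- ⊗ b` on 1-morphisms does not change the colors. -/
def DWord.right {a a' : ℕ} (f : DWord a a') (b : ℕ) : DWord (a + b) (a' + b) :=
  ⟨f.letters, congrArg (· + b) f.eq, fun i hi => (f.valid i hi).mono b⟩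

def DWord.left2 (a : ℕ) {b b' : ℕ} {g g' : DWord b b'} :
    DWord.Hom2 g g' →ₗ[ℂ] DWord.Hom2 (g.left a) (g'.left a) :=
  SubQuot.map (shift a).toLinearMap (shift_mem_paths a) (fun x _ hx => shift_mem_relations a x hx)

def DWord.right2 {a a' : ℕ} {f f' : DWord a a'} (b : ℕ) :
    DWord.Hom2 f f' →ₗ[ℂ] DWord.Hom2 (f.right b) (f'.right b) :=
  SubQuot.map LinearMap.id (fun _ hx => paths_mono b _ _ hx)
    (fun _ _ hx => relations_mono b _ _ hx)

/-- The tensor product on the 2-category of diagrams: the sum of objects, with a diagram over `a`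
placed to the left of a diagram over `b` whose colors are shifted by `a`. -/
def DiagTensor : TensorData Diag where
  unit := (0 : ℕ)
  obj := fun a b : ℕ => a + b
  left := fun a _ _ => DWord.left a
  right := DWord.right
  left2 := fun a _ _ _ _ => DWord.left2 a
  right2 := DWord.right2

theorem DiagTensor.isLocallyFunctorial : DiagTensor.IsLocallyFunctorial where
  left2_id2 := fun a {_ _} _ => SubQuot.cls_congr _ (map_one (shift a))
  left2_vcomp := by
    intro a b b' g g' g'' β' β
    obtain ⟨y, hy, rfl⟩ := SubQuot.exists_cls β'
    obtain ⟨x, hx, rfl⟩ := SubQuot.exists_cls β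
    exact SubQuot.cls_congr _ (map_mul (shift a) x y)
  left2_deg := by
    intro a b b' g g' d β hβ
    obtain ⟨x, hx, hx', rfl⟩ := SubQuot.mem_image.1 hβ
    exact SubQuot.mem_image.2 ⟨shift a x, shift_mem_paths a x hx, shift_mem_homogeneous a x hx', rfl⟩
  right2_id2 := fun _ _ => rfl
  right2_vcomp := by
    intro a a' f f' f'' b α' α
    obtain ⟨y, hy, rfl⟩ := SubQuot.exists_cls α'
    obtain ⟨x, hx, rfl⟩ := SubQuot.exists_cls α
    rfl
  right2_deg := by
    intro a a' f f' b d α hα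
    obtain ⟨x, hx, hx', rfl⟩ := SubQuot.mem_image.1 hα
    exact SubQuot.mem_image.2 ⟨x, paths_mono b _ _ hx, homogeneous_mono b _ _ _ hx', rfl⟩

/-! ### The tensorators -/

/-- The strand `i` crosses all strands of `v`, from left to right. -/
def crossRow (i : ℕ) : List ℕ → List Step
  | [] => []
  | j :: v => ⟨[], .cross i j, v⟩ :: (crossRow i v).map (Step.whisk [j] [])

/-- The shuffle crossing `u ++ v ⟶ v ++ u`: all strands of `u` cross all strands of `v`. -/
def crossing : List ℕ → List ℕ → List Step
  | [], _ => []
  | i :: u, v => (crossing u v).map (Step.whisk [i] []) ++ (crossRow i v).map (Step.whisk [] u)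

theorem isPath_crossRow {n i : ℕ} : ∀ v : List ℕ,
    (∀ j ∈ v, (Gen.cross i j).Ok n) → IsPath n (i :: v) (crossRow i v) (v ++ [i])
  | [], _ => rfl
  | j :: v, h => by
    refine ⟨h j (by simp), rfl, ?_⟩
    have := (isPath_crossRow v fun l hl => h l (by simp [hl])).whisk [j] []
    simpa [Gen.tgt] using this

theorem isPath_crossing {n : ℕ} : ∀ u v : List ℕ,
    (∀ i ∈ u, ∀ j ∈ v, (Gen.cross i j).Ok n) → IsPath n (u ++ v) (crossing u v) (v ++ u)
  | [], v, _ => by simp [crossing, IsPath]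
  | i :: u, v, h => by
    have h1 := (isPath_crossing u v fun l hl => h l (by simp [hl])).whisk [i] []
    have h2 := (isPath_crossRow v (h i (by simp))).whisk [] u
    refine IsPath.append (w' := [i] ++ (v ++ u)) ?_ ?_
    · simpa using h1
    · simpa using h2

/-- The tensorator of two words is the shuffle crossing. -/
def DiagTensorator : DiagTensor.Tensorator := fun {a a' b b' : ℕ} (f : DWord a a') (g : DWord b b') =>
  SubQuot.cls (diag (crossing f.letters (g.letters.map (a + ·)))) (by
    have haa : a = a' := f.eq
    subst haa
    refine diag_mem_paths (isPath_crossing _ _ fun i hi j hj => ?_)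
    obtain ⟨l, hl, rfl⟩ := List.mem_map.1 hj
    have h1 := f.valid i hi
    have h2 := g.valid l hl
    refine ⟨h1.mono b, h2.shift a, Or.inl ?_⟩
    have h3 := h1.2
    have h4 := h2.1
    omega)

end Diagrams

end SoergelGray

end

/-!
The theorem is the combination of two independent statements.

The first one is general. Let `C` be a locally graded linear 2-category with a semistrict monoidal
structure. Then the homotopy categories of bounded complexes over its hom-categories inherit such a
structure (`KbLoc.isLocallyGradedTwoCategory`, `KbLoc.isSemistrictMonoidal`). All strict laws hold
entrywise for matrices of 2-morphisms, up to the bookkeeping of lexicographic indices and Koszul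
signs; 1-morphisms which are equal by a strict law have different types of 2-morphisms, so that the
laws are heterogeneous equalities (`Mat.heq`, `Cx.cls_heq_of_apply`). The matrix of signed tensorators
is natural with respect to arbitrary matrices, not only chain maps (`Mat.tensorator_natural_left`,
`Mat.tensorator_natural_right`). Naturality with respect to the differentials says that it is a chain
map, and naturality with respect to chain maps is the naturality of the tensorators of complexes. The
homotopy classes are graded since the differentials are of internal degree zero, so that the
projections to homogeneous components are defined on homotopy classes.

The second one is that diagrams modulo relations form such a 2-category
(`Diag.isLocallyGradedTwoCategory`, `Diag.isSemistrictMonoidal`). All defining relations are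
homogeneous, which gives the grading. The essential point is that shuffle crossings are invertible and
natural. The second Reidemeister move for two distant strands is not among the defining relations; it
follows from them since a crossing is a rotation of the opposite crossing (`cross_mul_cross_dEq`). The
relations let merges, end dots, six-valent vertices, crossings and boxes slide through a distant
strand. With the Reidemeister move also cups slide (`cup_slide_dEq`), hence so do splits and start
dots, which are composed from cups, merges and end dots. It follows that every diagram slides through
strands of distant colors (`slides_diag`), and any diagram of one tensor factor is of this kind with
respect to the strands of the other factor.
-/

namespace SoergelGray

section Heterogeneous

variable {k : Type} [Field k] {C : TwoCatData k}

/-! ### Heterogeneous equality of 2-morphisms and matrices -/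

namespace TwoCatData

variable {a a' b b' c c' : C.Obj}

theorem zero_heq (ha : a = a') (hb : b = b') {f g : C.Hom a b} {f' g' : C.Hom a' b'}
    (hf : HEq f f') (hg : HEq g g') : HEq (0 : C.Hom2 f g) (0 : C.Hom2 f' g') := by
  subst ha hb; cases hf; cases hg; rfl

theorem smul_heq (ha : a = a') (hb : b = b') {f g : C.Hom a b} {f' g' : C.Hom a' b'}
    (hf : HEq f f') (hg : HEq g g') {r r' : k} (hr : r = r') {x : C.Hom2 f g} {x' : C.Hom2 f' g'}
    (hx : HEq x x') : HEq (r • x) (r' • x') := by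
  subst ha hb hr; cases hf; cases hg; cases hx; rfl

theorem comp_heq (ha : a = a') (hb : b = b') (hc : c = c') {g : C.Hom b c} {g' : C.Hom b' c'}
    {f : C.Hom a b} {f' : C.Hom a' b'} (hg : HEq g g') (hf : HEq f f') :
    HEq (C.comp g f) (C.comp g' f') := by
  subst ha hb hc; cases hf; cases hg; rfl

/-- A composite through an identification of 1-morphisms can be computed with any 2-morphism
heterogeneously equal to the first factor. -/
theorem vcomp_eqTo_vcomp (hC : C.IsLocallyFunctorial) {f g g' h : C.Hom a b} (e : g = g')
    (y : C.Hom2 g' h) {x : C.Hom2 f g} {x' : C.Hom2 f g'} (hx : HEq x x') :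
    C.vcomp y (C.vcomp (C.eqTo e) x) = C.vcomp y x' := by
  subst e; cases hx
  exact congrArg _ (hC.id_vcomp _)

end TwoCatData

section Families

variable {a a' b b' : C.Obj}

/-- Collections of shifted 1-morphisms are heterogeneously equal when they are so termwise. Terms are
compared at equal positions in `ℕ`, since the index types `Fin` differ before substitution. -/
theorem Susp.heq (ha : a = a') (hb : b = b') {X : Susp C a b} {X' : Susp C a' b'}
    (hl : X.len = X'.len)
    (ho : ∀ (i : Fin X.len) (i' : Fin X'.len), (i : ℕ) = i' → HEq (X.obj i) (X'.obj i'))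
    (hh : ∀ (i : Fin X.len) (i' : Fin X'.len), (i : ℕ) = i' → X.h i = X'.h i')
    (hq : ∀ (i : Fin X.len) (i' : Fin X'.len), (i : ℕ) = i' → X.q i = X'.q i') :
    HEq X X' := by
  subst ha hb
  obtain ⟨n, o, h, q⟩ := X
  obtain ⟨n', o', h', q'⟩ := X'
  obtain rfl : n = n' := hl
  obtain rfl : o = o' := funext fun i => eq_of_heq (ho i i rfl)
  obtain rfl : h = h' := funext fun i => hh i i rfl
  obtain rfl : q = q' := funext fun i => hq i i rfl
  rfl

theorem Susp.ext' {X X' : Susp C a b}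
    (hl : X.len = X'.len)
    (ho : ∀ (i : Fin X.len) (i' : Fin X'.len), (i : ℕ) = i' → X.obj i = X'.obj i')
    (hh : ∀ (i : Fin X.len) (i' : Fin X'.len), (i : ℕ) = i' → X.h i = X'.h i')
    (hq : ∀ (i : Fin X.len) (i' : Fin X'.len), (i : ℕ) = i' → X.q i = X'.q i') :
    X = X' :=
  eq_of_heq (Susp.heq rfl rfl hl (fun i i' h => heq_of_eq (ho i i' h)) hh hq)

/-- Entrywise criterion for matrices to be heterogeneously equal. -/
theorem Mat.heq (ha : a = a') (hb : b = b') {X Y : Susp C a b} {X' Y' : Susp C a' b'}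
    (hX : HEq X X') (hY : HEq Y Y') {A : Mat X Y} {A' : Mat X' Y'}
    (h : ∀ (i : Fin X.len) (i' : Fin X'.len) (j : Fin Y.len) (j' : Fin Y'.len),
      (i : ℕ) = i' → (j : ℕ) = j' → HEq (A i j) (A' i' j')) : HEq A A' := by
  subst ha hb; cases hX; cases hY
  exact heq_of_eq (funext fun i => funext fun j => eq_of_heq (h i i j j rfl rfl))

theorem Mat.add_heq (ha : a = a') (hb : b = b') {X Y : Susp C a b} {X' Y' : Susp C a' b'}
    (hX : HEq X X') (hY : HEq Y Y') {A B : Mat X Y} {A' B' : Mat X' Y'} (hA : HEq A A')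
    (hB : HEq B B') : HEq (A + B) (A' + B') := by
  subst ha hb; cases hX; cases hY; cases hA; cases hB; rfl

theorem Cx.heq (ha : a = a') (hb : b = b') {X : Cx C a b} {X' : Cx C a' b'}
    (hS : HEq X.toSusp X'.toSusp) (hd : HEq X.d X'.d) : HEq X X' := by
  subst ha hb
  obtain ⟨S, d, _, _, _⟩ := X
  obtain ⟨S', d', _, _, _⟩ := X'
  cases hS; cases hd; rfl

theorem Cx.toSusp_heq (ha : a = a') (hb : b = b') {X : Cx C a b} {X' : Cx C a' b'}
    (h : HEq X X') : HEq X.toSusp X'.toSusp := by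
  subst ha hb; cases h; rfl

theorem Cx.cls_heq (ha : a = a') (hb : b = b') {X Y : Cx C a b} {X' Y' : Cx C a' b'}
    (hX : HEq X X') (hY : HEq Y Y') {A : Mat X.toSusp Y.toSusp} {A' : Mat X'.toSusp Y'.toSusp}
    (hA : A ∈ Cx.chainMaps X Y) (hA' : A' ∈ Cx.chainMaps X' Y') (h : HEq A A') :
    HEq (SubQuot.cls A hA : Cx.Hom2 X Y) (SubQuot.cls A' hA' : Cx.Hom2 X' Y') := by
  subst ha hb; cases hX; cases hY; cases h; rfl

/-- Entrywise criterion for classes of chain maps to be heterogeneously equal. -/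
theorem Cx.cls_heq_of_apply (ha : a = a') (hb : b = b') {X Y : Cx C a b} {X' Y' : Cx C a' b'}
    (hX : HEq X X') (hY : HEq Y Y') {A : Mat X.toSusp Y.toSusp} {A' : Mat X'.toSusp Y'.toSusp}
    (hA : A ∈ Cx.chainMaps X Y) (hA' : A' ∈ Cx.chainMaps X' Y')
    (h : ∀ (i : Fin X.len) (i' : Fin X'.len) (j : Fin Y.len) (j' : Fin Y'.len),
      (i : ℕ) = i' → (j : ℕ) = j' → HEq (A i j) (A' i' j')) :
    HEq (SubQuot.cls A hA : Cx.Hom2 X Y) (SubQuot.cls A' hA' : Cx.Hom2 X' Y') :=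
  Cx.cls_heq ha hb hX hY hA hA'
    (Mat.heq ha hb (Cx.toSusp_heq ha hb hX) (Cx.toSusp_heq ha hb hY) h)

end Families

/-! ### Kronecker products and identity matrices -/

section Kronecker

variable {a b c d : C.Obj}

theorem Mat.one_self (X : Susp C a b) (i : Fin X.len) : Mat.one X i i = C.id2 (X.obj i) := by
  simp [Mat.one, TwoCatData.eqTo]

theorem Mat.one_ne (X : Susp C a b) {i j : Fin X.len} (h : i ≠ j) : Mat.one X i j = 0 := by
  simp [Mat.one, h]

theorem Fin.divNat_modNat_ext {m n : ℕ} {p r : Fin (m * n)} (h1 : p.divNat = r.divNat)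
    (h2 : p.modNat = r.modNat) : p = r :=
  finProdFinEquiv.symm.injective (Prod.ext h1 h2)

/-- Summation over lexicographically ordered pairs. -/
theorem Fin.sum_divNat_modNat {M : Type} [AddCommMonoid M] {m n : ℕ} (F : Fin m → Fin n → M) :
    ∑ p : Fin (m * n), F p.divNat p.modNat = ∑ i, ∑ j, F i j := by
  rw [← Fintype.sum_prod_type']
  exact Fintype.sum_equiv finProdFinEquiv.symm _ _ fun _ => rfl

/-- The two ways to bracket a lexicographically ordered triple of indices agree. -/
theorem Fin.divNat_divNat_eq {l m n : ℕ} {p : Fin (l * m * n)} {p' : Fin (l * (m * n))}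
    (h : (p : ℕ) = p') : p.divNat.divNat = p'.divNat ∧ p.divNat.modNat = p'.modNat.divNat ∧
      p.modNat = p'.modNat.modNat := by
  refine ⟨Fin.ext ?_, Fin.ext ?_, Fin.ext ?_⟩
  · simp [h, Nat.div_div_eq_div_mul, mul_comm]
  · simp [h, Nat.mod_mul_left_div_self]
  · simp [h]

theorem Mat.hcomp_one_one (hC : C.IsLocallyFunctorial) (Y : Susp C b c) (X : Susp C a b) :
    Mat.hcomp (Mat.one Y) (Mat.one X) = Mat.one (Y.comp X) := by
  funext p r
  rw [Mat.hcomp_apply]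
  by_cases h : p = r
  · subst h
    simp only [Mat.one_self, sub_self, zero_mul, koszul_zero, hC.hcomp_id]
    exact one_smul _ _
  · rw [Mat.one_ne _ h]
    by_cases h1 : p.divNat = r.divNat
    · rw [Mat.one_ne X fun h2 => h (Fin.divNat_modNat_ext h1 h2), map_zero]
      exact smul_zero _
    · rw [Mat.one_ne Y h1, map_zero, LinearMap.zero_apply]
      exact smul_zero _

variable (hC : C.IsLocallyGradedTwoCategory)
include hC

theorem Susp.comp_assoc (Z : Susp C c d) (Y : Susp C b c) (X : Susp C a b) :
    (Z.comp Y).comp X = Z.comp (Y.comp X) := by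
  refine Susp.ext' (mul_assoc _ _ _) (fun p p' h => ?_) (fun p p' h => ?_) (fun p p' h => ?_)
  all_goals
    obtain ⟨h1, h2, h3⟩ := Fin.divNat_divNat_eq h
    simp only [h1, h2, h3, hC.comp_assoc, add_assoc]

/-- The Koszul signs of both bracketings of a triple product agree. The indices on both sides are
independent variables, so that equations between them can be substituted. -/
theorem Mat.hcomp_assoc_entry {Z Z' : Susp C c d} {Y Y' : Susp C b c} {X X' : Susp C a b}
    (G : Mat Z Z') (F : Mat Y Y') (E : Mat X X') {i₁ i₂ i₁' i₂' j₁ j₂ j₁' j₂' l₁ l₂ l₁' l₂'}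
    (hi : i₁ = i₂) (hi' : i₁' = i₂') (hj : j₁ = j₂) (hj' : j₁' = j₂') (hl : l₁ = l₂)
    (hl' : l₁' = l₂') :
    HEq (koszul k ((X'.h l₁' - X.h l₁) * (Z.h i₁ + Y.h j₁)) •
          C.hcomp (koszul k ((Y'.h j₁' - Y.h j₁) * Z.h i₁) • C.hcomp (G i₁ i₁') (F j₁ j₁'))
            (E l₁ l₁'))
      (koszul k (((Y'.h j₂' + X'.h l₂') - (Y.h j₂ + X.h l₂)) * Z.h i₂) •
          C.hcomp (G i₂ i₂')
            (koszul k ((X'.h l₂' - X.h l₂) * Y.h j₂) • C.hcomp (F j₂ j₂') (E l₂ l₂'))) := by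
  subst hi hi' hj hj' hl hl'
  rw [map_smul, map_smul, LinearMap.smul_apply, smul_smul, smul_smul, ← koszul_add, ← koszul_add]
  refine TwoCatData.smul_heq rfl rfl (heq_of_eq (hC.comp_assoc _ _ _))
    (heq_of_eq (hC.comp_assoc _ _ _)) ?_ (hC.hcomp_assoc _ _ _)
  congr 1
  ring

theorem Mat.hcomp_assoc {Z Z' : Susp C c d} {Y Y' : Susp C b c} {X X' : Susp C a b}
    (G : Mat Z Z') (F : Mat Y Y') (E : Mat X X') :
    HEq (Mat.hcomp (Mat.hcomp G F) E) (Mat.hcomp G (Mat.hcomp F E)) := by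
  refine Mat.heq rfl rfl (heq_of_eq (Susp.comp_assoc hC _ _ _))
    (heq_of_eq (Susp.comp_assoc hC _ _ _)) fun p p' r r' hp hr => ?_
  obtain ⟨h1, h2, h3⟩ := Fin.divNat_divNat_eq hp
  obtain ⟨h1', h2', h3'⟩ := Fin.divNat_divNat_eq hr
  exact Mat.hcomp_assoc_entry hC G F E h1 h1' h2 h2' h3 h3'

theorem Cx.comp_assoc (Z : Cx C c d) (Y : Cx C b c) (X : Cx C a b) :
    Cx.comp hC.toIsLocallyFunctorial (Cx.comp hC.toIsLocallyFunctorial Z Y) X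
      = Cx.comp hC.toIsLocallyFunctorial Z (Cx.comp hC.toIsLocallyFunctorial Y X) := by
  have hS := Susp.comp_assoc hC Z.toSusp Y.toSusp X.toSusp
  refine eq_of_heq (Cx.heq rfl rfl (heq_of_eq hS) ?_)
  change HEq (Mat.hcomp (Mat.hcomp Z.d (Mat.one Y.toSusp) + Mat.hcomp (Mat.one Z.toSusp) Y.d)
      (Mat.one X.toSusp) + Mat.hcomp (Mat.one (Z.toSusp.comp Y.toSusp)) X.d)
    (Mat.hcomp Z.d (Mat.one (Y.toSusp.comp X.toSusp)) + Mat.hcomp (Mat.one Z.toSusp)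
      (Mat.hcomp Y.d (Mat.one X.toSusp) + Mat.hcomp (Mat.one Y.toSusp) X.d))
  rw [map_add, map_add, LinearMap.add_apply, ← Mat.hcomp_one_one hC.toIsLocallyFunctorial,
    ← Mat.hcomp_one_one hC.toIsLocallyFunctorial, ← add_assoc]
  exact Mat.add_heq rfl rfl (heq_of_eq hS) (heq_of_eq hS)
    (Mat.add_heq rfl rfl (heq_of_eq hS) (heq_of_eq hS) (Mat.hcomp_assoc hC _ _ _)
      (Mat.hcomp_assoc hC _ _ _)) (Mat.hcomp_assoc hC _ _ _)

theorem Susp.one_comp (X : Susp C a b) :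
    (Cx.one b : Cx C b b).toSusp.comp X = X := by
  refine Susp.ext' (one_mul _) (fun p p' h => ?_) (fun p p' h => ?_) (fun p p' h => ?_)
  all_goals
    obtain rfl : p.modNat = p' := by
      refine Fin.ext (Eq.trans ?_ h)
      exact Nat.mod_eq_of_lt (h ▸ p'.2)
  · exact hC.one_comp _
  · exact zero_add _
  · exact zero_add _

theorem Susp.comp_one (X : Susp C a b) :
    X.comp (Cx.one a : Cx C a a).toSusp = X := by
  refine Susp.ext' (mul_one _) (fun p p' h => ?_) (fun p p' h => ?_) (fun p p' h => ?_)
  all_goals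
    obtain rfl : p.divNat = p' := Fin.ext (Eq.trans (Nat.div_one _) h)
  · exact hC.comp_one _
  · exact add_zero _
  · exact add_zero _

theorem Mat.one_hcomp {X X' : Susp C a b} (A : Mat X X') :
    HEq (Mat.hcomp (Mat.one (Cx.one b : Cx C b b).toSusp) A) A := by
  refine Mat.heq rfl rfl (heq_of_eq (Susp.one_comp hC _))
    (heq_of_eq (Susp.one_comp hC _)) fun p p' r r' hp hr => ?_
  obtain rfl : p.modNat = p' := Fin.ext ((Nat.mod_eq_of_lt (hp ▸ p'.2)).trans hp)
  obtain rfl : r.modNat = r' := Fin.ext ((Nat.mod_eq_of_lt (hr ▸ r'.2)).trans hr)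
  have h0 : p.divNat = r.divNat := Subsingleton.elim (α := Fin 1) _ _
  rw [Mat.hcomp_apply, ← h0, Mat.one_self]
  have h1 : koszul k ((X'.h r.modNat - X.h p.modNat) * (Cx.one b : Cx C b b).h p.divNat) = 1 := by
    rw [show (Cx.one b : Cx C b b).h p.divNat = 0 from rfl, mul_zero, koszul_zero]
  rw [h1]
  refine HEq.trans (heq_of_eq (one_smul _ _)) (hC.one_hcomp _)

theorem Mat.hcomp_one {X X' : Susp C a b} (A : Mat X X') :
    HEq (Mat.hcomp A (Mat.one (Cx.one a : Cx C a a).toSusp)) A := by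
  refine Mat.heq rfl rfl (heq_of_eq (Susp.comp_one hC _))
    (heq_of_eq (Susp.comp_one hC _)) fun p p' r r' hp hr => ?_
  obtain rfl : p.divNat = p' := Fin.ext (Eq.trans (Nat.div_one _) hp)
  obtain rfl : r.divNat = r' := Fin.ext (Eq.trans (Nat.div_one _) hr)
  have h0 : p.modNat = r.modNat := Subsingleton.elim (α := Fin 1) _ _
  rw [Mat.hcomp_apply, ← h0, Mat.one_self, sub_self, zero_mul, koszul_zero]
  refine HEq.trans (heq_of_eq (one_smul _ _)) (hC.hcomp_one _)

theorem Cx.one_comp (X : Cx C a b) : Cx.comp hC.toIsLocallyFunctorial (Cx.one b) X = X := by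
  refine eq_of_heq (Cx.heq rfl rfl (heq_of_eq (Susp.one_comp hC _)) ?_)
  refine HEq.trans (heq_of_eq ?_) (Mat.one_hcomp hC X.d)
  change Mat.hcomp (0 : Mat (Cx.one b : Cx C b b).toSusp (Cx.one b : Cx C b b).toSusp) _ + _ = _
  rw [map_zero, LinearMap.zero_apply, zero_add]

theorem Cx.comp_one (X : Cx C a b) : Cx.comp hC.toIsLocallyFunctorial X (Cx.one a) = X := by
  refine eq_of_heq (Cx.heq rfl rfl (heq_of_eq (Susp.comp_one hC _)) ?_)
  refine HEq.trans (heq_of_eq ?_) (Mat.hcomp_one hC X.d)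
  change _ + Mat.hcomp _ (0 : Mat (Cx.one a : Cx C a a).toSusp (Cx.one a : Cx C a a).toSusp) = _
  rw [map_zero, add_zero]

end Kronecker

end Heterogeneous

/-! ### Gradings and subquotients -/

section Gradings

variable {k : Type} [Field k] {M : Type} [AddCommGroup M] [Module k M]

/-- Projections `π d` onto submodules `A d` which decompose all elements of the submodule `Z`: a
grading of `Z` by the submodules `Z ⊓ A d`, presented by linear maps on the ambient module. -/
structure IsGradingProjection (Z : Submodule k M) (A : ℤ → Submodule k M) (π : ℤ → M →ₗ[k] M) :
    Prop where
  mem : ∀ d, ∀ x ∈ Z, π d x ∈ Z ⊓ A d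
  self : ∀ d, ∀ x ∈ A d, π d x = x
  other : ∀ d e, d ≠ e → ∀ x ∈ A d, π e x = 0
  sum : ∀ x ∈ Z, ∃ s : Finset ℤ, ∀ t, s ⊆ t → ∑ d ∈ t, π d x = x

/-- A family of submodules with projections which decompose every element is a grading. -/
theorem IsGradingProjection.isInternal {A : ℤ → Submodule k M} {π : ℤ → M →ₗ[k] M}
    (h : IsGradingProjection ⊤ A π) : DirectSum.IsInternal A := by
  constructor
  · have key : ∀ e (x : DirectSum ℤ fun d => A d),
        π e (DirectSum.coeLinearMap A x) = (x e : M) := by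
      intro e x
      induction x using DirectSum.induction_on with
      | zero => simp
      | of d x =>
        have h1 : DirectSum.coeLinearMap A (DirectSum.of (fun d => A d) d x) = x :=
          DirectSum.coeLinearMap_of A d x
        rw [h1]
        by_cases hd : d = e
        · subst hd
          rw [h.self d x x.2, DirectSum.of_eq_same]
        · rw [h.other d e hd x x.2, DirectSum.of_eq_of_ne _ _ _ (Ne.symm hd)]
          rfl
      | add x y hx hy => simp [hx, hy]
    intro x y hxy
    ext e
    rw [← key, ← key]
    exact congrArg (π e) hxy
  · intro x
    obtain ⟨s, hs⟩ := h.sum x trivial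
    refine ⟨∑ d ∈ s, DirectSum.of (fun d => A d) d ⟨π d x, (h.mem d x trivial).2⟩, ?_⟩
    rw [map_sum]
    refine Eq.trans (Finset.sum_congr rfl fun d _ => ?_) (hs s subset_rfl)
    exact DirectSum.coeAddMonoidHom_of A d _

/-- Every grading is presented by projections. -/
theorem exists_isGradingProjection {A : ℤ → Submodule k M} (h : DirectSum.IsInternal A) :
    ∃ π, IsGradingProjection ⊤ A π := by
  classical
  let _ := h.chooseDecomposition
  refine ⟨fun d => (A d).subtype ∘ₗ DirectSum.component k ℤ (fun d => A d) d ∘ₗ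
    (DirectSum.decomposeLinearEquiv A).toLinearMap, ⟨fun d x _ => ⟨trivial, ?_⟩, ?_, ?_, ?_⟩⟩
  · exact Subtype.prop _
  · exact fun d x hx => DirectSum.decompose_of_mem_same A hx
  · exact fun d e hde x hx => DirectSum.decompose_of_mem_ne A hx hde
  · refine fun x _ => ⟨(DirectSum.decompose A x).support, fun t ht => ?_⟩
    refine Eq.trans (Finset.sum_subset ht fun d _ hd => ?_).symm (DirectSum.sum_support_decompose A x)
    rw [DFinsupp.notMem_support_iff] at hd
    exact congrArg Subtype.val hd

/-- A grading of `Z` whose projections preserve `B` induces a grading of the subquotient. -/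
theorem IsGradingProjection.isInternal_image {Z B : Submodule k M} {A : ℤ → Submodule k M}
    {π : ℤ → M →ₗ[k] M} (h : IsGradingProjection Z A π) (hB : ∀ d, ∀ x ∈ B, π d x ∈ B) :
    DirectSum.IsInternal fun d => SubQuot.image Z B (A d) := by
  refine IsGradingProjection.isInternal
    (π := fun d => SubQuot.map (π d) (fun x hx => (h.mem d x hx).1) (fun x _ hx => hB d x hx))
    ⟨fun d x _ => ⟨trivial, ?_⟩, fun d x hx => ?_, fun d e hde x hx => ?_, fun x _ => ?_⟩
  · obtain ⟨y, hy, rfl⟩ := SubQuot.exists_cls x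
    exact SubQuot.mem_image.2 ⟨π d y, (h.mem d y hy).1, (h.mem d y hy).2, rfl⟩
  · obtain ⟨y, hy, hA, rfl⟩ := SubQuot.mem_image.1 hx
    exact SubQuot.cls_congr _ (h.self d y hA)
  · obtain ⟨y, hy, hA, rfl⟩ := SubQuot.mem_image.1 hx
    exact (SubQuot.cls_congr _ (h.other d e hde y hA)).trans (map_zero (Submodule.mkQ _))
  · obtain ⟨y, hy, rfl⟩ := SubQuot.exists_cls x
    obtain ⟨s, hs⟩ := h.sum y hy
    refine ⟨s, fun t ht => ?_⟩
    have h1 : ∑ d ∈ t, (⟨π d y, (h.mem d y hy).1⟩ : Z) = ⟨y, hy⟩ :=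
      Subtype.ext (by simpa using hs t ht)
    have h2 := congrArg (B.submoduleOf Z).mkQ h1
    rw [map_sum] at h2
    exact h2

end Gradings

/-! ### Homotopy categories of complexes form a locally graded 2-category -/

section Homotopy

variable {k : Type} [Field k] {C : TwoCatData k}

theorem Mat.comp_mem_qDeg (hC : C.IsLocallyFunctorial) {a b : C.Obj} {X Y Z : Susp C a b}
    {m n l : ℤ} (hl : l = m + n) {B : Mat Y Z} {A : Mat X Y} (hB : B ∈ Mat.qDeg Y Z m)
    (hA : A ∈ Mat.qDeg X Y n) : Mat.comp B A ∈ Mat.qDeg X Z l := by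
  intro i j
  rw [Mat.comp_apply]
  refine Submodule.sum_mem _ fun t _ => ?_
  have := hC.vcomp_deg (hB t j) (hA i t)
  convert this using 2
  omega

/-- The internal grading of matrices is presented by projections, which are computed entrywise and
hence preserve the cohomological degree. -/
theorem Mat.exists_qDeg_projection (hI : ∀ {a b : C.Obj} (f g : C.Hom a b),
    DirectSum.IsInternal (C.deg f g)) {a b : C.Obj} (X Y : Susp C a b) :
    ∃ π, IsGradingProjection ⊤ (Mat.qDeg X Y) π ∧
      ∀ n d, ∀ A ∈ Mat.hDeg X Y n, π d A ∈ Mat.hDeg X Y n := by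
  choose ρ hρ using fun i j => exists_isGradingProjection (hI (X.obj i) (Y.obj j))
  refine ⟨fun d =>
    { toFun := fun A i j => ρ i j (d + X.q i - Y.q j) (A i j)
      map_add' := fun A B => by ext i j; exact map_add _ _ _
      map_smul' := fun c A => by ext i j; exact map_smul _ _ _ },
    ⟨fun d A _ => ⟨trivial, fun i j => ?_⟩, fun d A hA => ?_, fun d e hde A hA => ?_,
      fun A _ => ?_⟩, fun n d A hA i j h => ?_⟩
  · exact ((hρ i j).mem _ _ trivial).2
  · ext i j
    exact (hρ i j).self _ _ (hA i j)
  · ext i j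
    exact (hρ i j).other _ _ (by omega) _ (hA i j)
  · choose s hs using fun i j => (hρ i j).sum (A i j) trivial
    -- internal degrees `d` for which some entry has a nonzero component
    refine ⟨Finset.univ.biUnion fun i => Finset.univ.biUnion fun j =>
      (s i j).image (· - X.q i + Y.q j), fun t ht => ?_⟩
    ext i j
    have h1 := hs i j (t.image (· + X.q i - Y.q j)) fun e he => Finset.mem_image.2
      ⟨e - X.q i + Y.q j, ht (Finset.mem_biUnion.2 ⟨i, Finset.mem_univ _, Finset.mem_biUnion.2
        ⟨j, Finset.mem_univ _, Finset.mem_image_of_mem _ he⟩⟩), by omega⟩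
    rw [Finset.sum_image (fun x _ y _ h => by simpa using h)] at h1
    rw [Finset.sum_apply, Finset.sum_apply]
    exact h1
  · change ρ i j _ (A i j) = 0
    rw [hA i j h, map_zero]

/-- The projections of the internal grading commute with composition with a matrix of degree
zero. -/
theorem Mat.projection_comp_left (hC : C.IsLocallyFunctorial) {a b : C.Obj} {X Y Z : Susp C a b}
    {π ρ} (hπ : IsGradingProjection ⊤ (Mat.qDeg X Y) π)
    (hρ : IsGradingProjection ⊤ (Mat.qDeg X Z) ρ) {D : Mat Y Z} (hD : D ∈ Mat.qDeg Y Z 0)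
    (d : ℤ) (A : Mat X Y) : ρ d (Mat.comp D A) = Mat.comp D (π d A) := by
  obtain ⟨s, hs⟩ := hπ.sum A trivial
  have hm : ∀ e, Mat.comp D (π e A) ∈ Mat.qDeg X Z e := fun e =>
    Mat.comp_mem_qDeg hC (zero_add e).symm hD (hπ.mem e A trivial).2
  conv_lhs => rw [← hs (insert d s) (Finset.subset_insert _ _), map_sum, map_sum]
  rw [Finset.sum_eq_single d (fun e _ he => hρ.other e d he _ (hm e))
    (fun h => absurd (Finset.mem_insert_self d s) h), hρ.self d _ (hm d)]

theorem Mat.projection_comp_right (hC : C.IsLocallyFunctorial) {a b : C.Obj} {X Y Z : Susp C a b}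
    {π ρ} (hπ : IsGradingProjection ⊤ (Mat.qDeg Y Z) π)
    (hρ : IsGradingProjection ⊤ (Mat.qDeg X Z) ρ) {D : Mat X Y} (hD : D ∈ Mat.qDeg X Y 0)
    (d : ℤ) (A : Mat Y Z) : ρ d (Mat.comp A D) = Mat.comp (π d A) D := by
  obtain ⟨s, hs⟩ := hπ.sum A trivial
  have hm : ∀ e, Mat.comp (π e A) D ∈ Mat.qDeg X Z e := fun e =>
    Mat.comp_mem_qDeg hC (add_zero e).symm (hπ.mem e A trivial).2 hD
  conv_lhs => rw [← hs (insert d s) (Finset.subset_insert _ _), map_sum, LinearMap.sum_apply,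
    map_sum]
  rw [Finset.sum_eq_single d (fun e _ he => hρ.other e d he _ (hm e))
    (fun h => absurd (Finset.mem_insert_self d s) h), hρ.self d _ (hm d)]

/-- The homotopy classes of chain maps are graded by the internal degree: the differentials are of
internal degree zero, so the projections preserve chain maps and null-homotopic maps. -/
theorem Cx.isInternal (hC : C.IsLocallyFunctorial) (hI : ∀ {a b : C.Obj} (f g : C.Hom a b),
    DirectSum.IsInternal (C.deg f g)) {a b : C.Obj} (X Y : Cx C a b) :
    DirectSum.IsInternal fun d => SubQuot.image (Cx.chainMaps X Y) (Cx.nullHomotopic X Y)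
      (Mat.qDeg X.toSusp Y.toSusp d) := by
  obtain ⟨π, hπ, hh⟩ := Mat.exists_qDeg_projection hI X.toSusp Y.toSusp
  have hl := Mat.projection_comp_left hC hπ hπ Y.d_qDeg
  have hr := Mat.projection_comp_right hC hπ hπ X.d_qDeg
  refine IsGradingProjection.isInternal_image (π := π)
    ⟨fun d A hA => ⟨?_, (hπ.mem d A trivial).2⟩, hπ.self, hπ.other, fun A _ => hπ.sum A trivial⟩
    fun d A hA => ?_
  · rw [Cx.mem_chainMaps] at hA
    exact Cx.mem_chainMaps.2 ⟨hh _ _ _ hA.1, by rw [← hl, hA.2, hr]⟩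
  · rw [Cx.mem_nullHomotopic] at *
    obtain ⟨H, hH, rfl⟩ := hA
    exact ⟨π d H, hh _ _ _ hH, by rw [map_add, hl, hr]⟩

section Laws

variable (hC : C.IsLocallyFunctorial)
include hC

theorem Cx.vcomp_assoc {a b : C.Obj} {f g h l : Cx C a b} (γ : Cx.Hom2 h l) (β : Cx.Hom2 g h)
    (α : Cx.Hom2 f g) :
    Cx.vcomp hC (Cx.vcomp hC γ β) α = Cx.vcomp hC γ (Cx.vcomp hC β α) := by
  obtain ⟨z, hz, rfl⟩ := SubQuot.exists_cls γ
  obtain ⟨y, hy, rfl⟩ := SubQuot.exists_cls β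
  obtain ⟨x, hx, rfl⟩ := SubQuot.exists_cls α
  exact SubQuot.cls_congr _ (Mat.comp_assoc hC z y x)

theorem Cx.id_vcomp {a b : C.Obj} {f g : Cx C a b} (α : Cx.Hom2 f g) :
    Cx.vcomp hC (Cx.id2 hC g) α = α := by
  obtain ⟨x, hx, rfl⟩ := SubQuot.exists_cls α
  exact SubQuot.cls_congr _ (Mat.one_comp hC x)

theorem Cx.vcomp_id {a b : C.Obj} {f g : Cx C a b} (α : Cx.Hom2 f g) :
    Cx.vcomp hC α (Cx.id2 hC f) = α := by
  obtain ⟨x, hx, rfl⟩ := SubQuot.exists_cls α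
  exact SubQuot.cls_congr _ (Mat.comp_one hC x)

theorem Cx.hcomp_id {a b c : C.Obj} (g : Cx C b c) (f : Cx C a b) :
    Cx.hcomp hC (Cx.id2 hC g) (Cx.id2 hC f) = Cx.id2 hC (Cx.comp hC g f) :=
  SubQuot.cls_congr _ (Mat.hcomp_one_one hC g.toSusp f.toSusp)

theorem Cx.interchange {a b c : C.Obj} {g g' g'' : Cx C b c} {f f' f'' : Cx C a b}
    (β' : Cx.Hom2 g' g'') (β : Cx.Hom2 g g') (α' : Cx.Hom2 f' f'') (α : Cx.Hom2 f f') :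
    Cx.vcomp hC (Cx.hcomp hC β' α') (Cx.hcomp hC β α)
      = Cx.hcomp hC (Cx.vcomp hC β' β) (Cx.vcomp hC α' α) := by
  obtain ⟨y', hy', rfl⟩ := SubQuot.exists_cls β'
  obtain ⟨y, hy, rfl⟩ := SubQuot.exists_cls β
  obtain ⟨x', hx', rfl⟩ := SubQuot.exists_cls α'
  obtain ⟨x, hx, rfl⟩ := SubQuot.exists_cls α
  have h := Mat.interchange hC y' x (Cx.mem_chainMaps.1 hy).1 (Cx.mem_chainMaps.1 hx').1
  -- chain maps have cohomological degree zero, so that interchanging them causes no sign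
  rw [mul_zero, koszul_zero, one_smul] at h
  exact SubQuot.cls_congr _ h

/-- The 2-morphisms of internal degree `d`. -/
abbrev Cx.deg {a b : C.Obj} (f g : Cx C a b) (d : ℤ) : Submodule k (Cx.Hom2 f g) :=
  SubQuot.image _ _ (Mat.qDeg f.toSusp g.toSusp d)

theorem Cx.id2_deg {a b : C.Obj} (f : Cx C a b) : Cx.id2 hC f ∈ Cx.deg f f 0 :=
  SubQuot.mem_image.2 ⟨_, _, Mat.one_mem_qDeg hC f.toSusp, rfl⟩

theorem Cx.vcomp_deg {a b : C.Obj} {f g h : Cx C a b} {d e : ℤ} {β : Cx.Hom2 g h}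
    {α : Cx.Hom2 f g} (hβ : β ∈ Cx.deg g h d) (hα : α ∈ Cx.deg f g e) :
    Cx.vcomp hC β α ∈ Cx.deg f h (d + e) := by
  obtain ⟨y, hy, hy', rfl⟩ := SubQuot.mem_image.1 hβ
  obtain ⟨x, hx, hx', rfl⟩ := SubQuot.mem_image.1 hα
  exact SubQuot.mem_image.2 ⟨Mat.comp y x, _, Mat.comp_mem_qDeg hC rfl hy' hx', rfl⟩

theorem Cx.hcomp_deg {a b c : C.Obj} {g g' : Cx C b c} {f f' : Cx C a b} {d e : ℤ}
    {β : Cx.Hom2 g g'} {α : Cx.Hom2 f f'} (hβ : β ∈ Cx.deg g g' d) (hα : α ∈ Cx.deg f f' e) :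
    Cx.hcomp hC β α ∈ Cx.deg (Cx.comp hC g f) (Cx.comp hC g' f') (d + e) := by
  obtain ⟨y, hy, hy', rfl⟩ := SubQuot.mem_image.1 hβ
  obtain ⟨x, hx, hx', rfl⟩ := SubQuot.mem_image.1 hα
  exact SubQuot.mem_image.2 ⟨Mat.hcomp y x, _, Mat.hcomp_mem_qDeg hC rfl hy' hx', rfl⟩

theorem KbLoc.isLocallyFunctorial : (KbLoc hC).IsLocallyFunctorial where
  vcomp_assoc := Cx.vcomp_assoc hC
  id_vcomp := Cx.id_vcomp hC
  vcomp_id := Cx.vcomp_id hC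
  hcomp_id := Cx.hcomp_id hC
  interchange := Cx.interchange hC
  id2_deg := Cx.id2_deg hC
  vcomp_deg := Cx.vcomp_deg hC
  hcomp_deg := Cx.hcomp_deg hC

end Laws

section StrictLaws

variable (hC : C.IsLocallyGradedTwoCategory)
include hC

theorem Cx.one_hcomp {a b : C.Obj} {f f' : Cx C a b} (α : Cx.Hom2 f f') :
    HEq (Cx.hcomp hC.toIsLocallyFunctorial (Cx.id2 hC.toIsLocallyFunctorial (Cx.one b)) α) α := by
  obtain ⟨x, hx, rfl⟩ := SubQuot.exists_cls α
  exact Cx.cls_heq rfl rfl (heq_of_eq (Cx.one_comp hC f)) (heq_of_eq (Cx.one_comp hC f')) _ _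
    (Mat.one_hcomp hC x)

theorem Cx.hcomp_one {a b : C.Obj} {f f' : Cx C a b} (α : Cx.Hom2 f f') :
    HEq (Cx.hcomp hC.toIsLocallyFunctorial α (Cx.id2 hC.toIsLocallyFunctorial (Cx.one a))) α := by
  obtain ⟨x, hx, rfl⟩ := SubQuot.exists_cls α
  exact Cx.cls_heq rfl rfl (heq_of_eq (Cx.comp_one hC f)) (heq_of_eq (Cx.comp_one hC f')) _ _
    (Mat.hcomp_one hC x)

theorem Cx.hcomp_assoc {a b c d : C.Obj} {h h' : Cx C c d} {g g' : Cx C b c} {f f' : Cx C a b}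
    (γ : Cx.Hom2 h h') (β : Cx.Hom2 g g') (α : Cx.Hom2 f f') :
    HEq (Cx.hcomp hC.toIsLocallyFunctorial (Cx.hcomp hC.toIsLocallyFunctorial γ β) α)
      (Cx.hcomp hC.toIsLocallyFunctorial γ (Cx.hcomp hC.toIsLocallyFunctorial β α)) := by
  obtain ⟨z, hz, rfl⟩ := SubQuot.exists_cls γ
  obtain ⟨y, hy, rfl⟩ := SubQuot.exists_cls β
  obtain ⟨x, hx, rfl⟩ := SubQuot.exists_cls α
  exact Cx.cls_heq rfl rfl (heq_of_eq (Cx.comp_assoc hC h g f))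
    (heq_of_eq (Cx.comp_assoc hC h' g' f')) _ _ (Mat.hcomp_assoc hC z y x)

theorem KbLoc.isLocallyGradedTwoCategory :
    (KbLoc hC.toIsLocallyFunctorial).IsLocallyGradedTwoCategory where
  toIsLocallyFunctorial := KbLoc.isLocallyFunctorial hC.toIsLocallyFunctorial
  isInternal := Cx.isInternal hC.toIsLocallyFunctorial hC.isInternal
  one_comp := Cx.one_comp hC
  comp_one := Cx.comp_one hC
  comp_assoc := Cx.comp_assoc hC
  one_hcomp := Cx.one_hcomp hC
  hcomp_one := Cx.hcomp_one hC
  hcomp_assoc := Cx.hcomp_assoc hC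

end StrictLaws

end Homotopy

section TensorComplexes

variable {k : Type} [Field k] {C : TwoCatData k} {T : TensorData C}

/-! ### Tensor products of complexes with objects -/

/-- Complexes are heterogeneously equal when their terms and differentials are so entrywise. -/
theorem Cx.heq_of_apply {a a' b b' : C.Obj} (ha : a = a') (hb : b = b') {X : Cx C a b}
    {X' : Cx C a' b'} (hl : X.len = X'.len)
    (ho : ∀ (i : Fin X.len) (i' : Fin X'.len), (i : ℕ) = i' → HEq (X.obj i) (X'.obj i'))
    (hh : ∀ (i : Fin X.len) (i' : Fin X'.len), (i : ℕ) = i' → X.h i = X'.h i')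
    (hq : ∀ (i : Fin X.len) (i' : Fin X'.len), (i : ℕ) = i' → X.q i = X'.q i')
    (hd : ∀ (i : Fin X.len) (i' : Fin X'.len) (j : Fin X.len) (j' : Fin X'.len),
      (i : ℕ) = i' → (j : ℕ) = j' → HEq (X.d i j) (X'.d i' j')) : HEq X X' := by
  have hS := Susp.heq ha hb hl ho hh hq
  exact Cx.heq ha hb hS (Mat.heq ha hb hS hS hd)

theorem Mat.left_one (hT : T.IsLocallyFunctorial) (a : C.Obj) {b b' : C.Obj} (X : Susp C b b') :
    Mat.left T a (Mat.one X) = Mat.one (X.left T a) := by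
  funext i j
  change T.left2 a (Mat.one X i j) = _
  by_cases h : i = j
  · subst h
    rw [Mat.one_self, Mat.one_self, hT.left2_id2]
  · exact ((congrArg (T.left2 a) (Mat.one_ne X h)).trans (map_zero _)).trans
      (Mat.one_ne (X.left T a) h).symm

theorem Mat.right_one (hT : T.IsLocallyFunctorial) {a a' : C.Obj} (X : Susp C a a') (b : C.Obj) :
    Mat.right T b (Mat.one X) = Mat.one (X.right T b) := by
  funext i j
  change T.right2 b (Mat.one X i j) = _
  by_cases h : i = j
  · subst h
    rw [Mat.one_self, Mat.one_self, hT.right2_id2]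
  · exact ((congrArg (T.right2 b) (Mat.one_ne X h)).trans (map_zero _)).trans
      (Mat.one_ne (X.right T b) h).symm

section LocalLaws

variable (hC : C.IsLocallyFunctorial) (hT : T.IsLocallyFunctorial)

theorem Cx.left2_id2 (a : C.Obj) {b b' : C.Obj} (g : Cx C b b') :
    Cx.left2 hT a (Cx.id2 hC g) = Cx.id2 hC (Cx.left hT a g) :=
  SubQuot.cls_congr _ (Mat.left_one hT a g.toSusp)

theorem Cx.left2_vcomp (a : C.Obj) {b b' : C.Obj} {g g' g'' : Cx C b b'} (β' : Cx.Hom2 g' g'')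
    (β : Cx.Hom2 g g') :
    Cx.left2 hT a (Cx.vcomp hC β' β) = Cx.vcomp hC (Cx.left2 hT a β') (Cx.left2 hT a β) := by
  obtain ⟨y, hy, rfl⟩ := SubQuot.exists_cls β'
  obtain ⟨x, hx, rfl⟩ := SubQuot.exists_cls β
  exact SubQuot.cls_congr _ (Mat.left_comp hT a y x)

theorem Cx.left2_deg (a : C.Obj) {b b' : C.Obj} {g g' : Cx C b b'} {d : ℤ} {β : Cx.Hom2 g g'}
    (hβ : β ∈ Cx.deg g g' d) : Cx.left2 hT a β ∈ Cx.deg (Cx.left hT a g) (Cx.left hT a g') d := by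
  obtain ⟨x, hx, hx', rfl⟩ := SubQuot.mem_image.1 hβ
  exact SubQuot.mem_image.2 ⟨Mat.left T a x, _, fun i j => hT.left2_deg a (hx' i j), rfl⟩

theorem Cx.right2_id2 {a a' : C.Obj} (f : Cx C a a') (b : C.Obj) :
    Cx.right2 hT b (Cx.id2 hC f) = Cx.id2 hC (Cx.right hT f b) :=
  SubQuot.cls_congr _ (Mat.right_one hT f.toSusp b)

theorem Cx.right2_vcomp {a a' : C.Obj} {f f' f'' : Cx C a a'} (b : C.Obj) (α' : Cx.Hom2 f' f'')
    (α : Cx.Hom2 f f') :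
    Cx.right2 hT b (Cx.vcomp hC α' α) = Cx.vcomp hC (Cx.right2 hT b α') (Cx.right2 hT b α) := by
  obtain ⟨y, hy, rfl⟩ := SubQuot.exists_cls α'
  obtain ⟨x, hx, rfl⟩ := SubQuot.exists_cls α
  exact SubQuot.cls_congr _ (Mat.right_comp hT b y x)

theorem Cx.right2_deg {a a' : C.Obj} {f f' : Cx C a a'} (b : C.Obj) {d : ℤ} {α : Cx.Hom2 f f'}
    (hα : α ∈ Cx.deg f f' d) :
    Cx.right2 hT b α ∈ Cx.deg (Cx.right hT f b) (Cx.right hT f' b) d := by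
  obtain ⟨x, hx, hx', rfl⟩ := SubQuot.mem_image.1 hα
  exact SubQuot.mem_image.2 ⟨Mat.right T b x, _, fun i j => hT.right2_deg b (hx' i j), rfl⟩

theorem KbTensor.isLocallyFunctorial : (KbTensor hC hT).IsLocallyFunctorial where
  left2_id2 := Cx.left2_id2 hC hT
  left2_vcomp := Cx.left2_vcomp hC hT
  left2_deg := Cx.left2_deg hT
  right2_id2 := Cx.right2_id2 hC hT
  right2_vcomp := Cx.right2_vcomp hC hT
  right2_deg := Cx.right2_deg hT

end LocalLaws

section StrictLaws

variable {hC : C.IsLocallyGradedTwoCategory} {τ : T.Tensorator} (hM : IsSemistrictMonoidal hC T τ)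
include hM

local notation "hF" => TwoCatData.IsLocallyGradedTwoCategory.toIsLocallyFunctorial hC
local notation "hL" => IsSemistrictMonoidal.toIsLocallyFunctorial hM

theorem Cx.left_one (a b : C.Obj) : Cx.left hL a (Cx.one b) = Cx.one (T.obj a b) := by
  refine eq_of_heq (Cx.heq_of_apply rfl rfl rfl (fun _ _ _ => heq_of_eq (hM.left_one a b))
    (fun _ _ _ => rfl) (fun _ _ _ => rfl) fun i i' j j' _ _ => ?_)
  refine HEq.trans (heq_of_eq (map_zero (T.left2 a))) ?_
  exact TwoCatData.zero_heq rfl rfl (heq_of_eq (hM.left_one a b)) (heq_of_eq (hM.left_one a b))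

theorem Cx.right_one (a b : C.Obj) : Cx.right hL (Cx.one a) b = Cx.one (T.obj a b) := by
  refine eq_of_heq (Cx.heq_of_apply rfl rfl rfl (fun _ _ _ => heq_of_eq (hM.right_one a b))
    (fun _ _ _ => rfl) (fun _ _ _ => rfl) fun i i' j j' _ _ => ?_)
  refine HEq.trans (heq_of_eq (map_zero (T.right2 b))) ?_
  exact TwoCatData.zero_heq rfl rfl (heq_of_eq (hM.right_one a b)) (heq_of_eq (hM.right_one a b))

theorem Susp.left_comp (a : C.Obj) {b b' b'' : C.Obj} (Y : Susp C b' b'') (X : Susp C b b') :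
    (Y.comp X).left T a = (Y.left T a).comp (X.left T a) :=
  Susp.ext' rfl (fun i i' h => by obtain rfl := Fin.ext h; exact hM.left_comp a _ _)
    (fun i i' h => by obtain rfl := Fin.ext h; rfl) (fun i i' h => by obtain rfl := Fin.ext h; rfl)

theorem Susp.right_comp {a a' a'' : C.Obj} (Y : Susp C a' a'') (X : Susp C a a') (b : C.Obj) :
    (Y.comp X).right T b = (Y.right T b).comp (X.right T b) :=
  Susp.ext' rfl (fun i i' h => by obtain rfl := Fin.ext h; exact hM.right_comp _ _ b)
    (fun i i' h => by obtain rfl := Fin.ext h; rfl) (fun i i' h => by obtain rfl := Fin.ext h; rfl)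

theorem Mat.left_hcomp (a : C.Obj) {b b' b'' : C.Obj} {Y Y' : Susp C b' b''} {X X' : Susp C b b'}
    (G : Mat Y Y') (F : Mat X X') :
    HEq (Mat.left T a (Mat.hcomp G F)) (Mat.hcomp (Mat.left T a G) (Mat.left T a F)) := by
  refine Mat.heq rfl rfl (heq_of_eq (Susp.left_comp hM a _ _))
    (heq_of_eq (Susp.left_comp hM a _ _)) fun p p' r r' hp hr => ?_
  obtain rfl := Fin.ext hp
  obtain rfl := Fin.ext hr
  refine HEq.trans (heq_of_eq (map_smul (T.left2 a) _ _)) ?_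
  exact TwoCatData.smul_heq rfl rfl (heq_of_eq (hM.left_comp a _ _))
    (heq_of_eq (hM.left_comp a _ _)) rfl (hM.left2_hcomp a _ _)

theorem Mat.right_hcomp {a a' a'' : C.Obj} {Y Y' : Susp C a' a''} {X X' : Susp C a a'} (b : C.Obj)
    (G : Mat Y Y') (F : Mat X X') :
    HEq (Mat.right T b (Mat.hcomp G F)) (Mat.hcomp (Mat.right T b G) (Mat.right T b F)) := by
  refine Mat.heq rfl rfl (heq_of_eq (Susp.right_comp hM _ _ b))
    (heq_of_eq (Susp.right_comp hM _ _ b)) fun p p' r r' hp hr => ?_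
  obtain rfl := Fin.ext hp
  obtain rfl := Fin.ext hr
  refine HEq.trans (heq_of_eq (map_smul (T.right2 b) _ _)) ?_
  exact TwoCatData.smul_heq rfl rfl (heq_of_eq (hM.right_comp _ _ b))
    (heq_of_eq (hM.right_comp _ _ b)) rfl (hM.right2_hcomp b _ _)

theorem Cx.left_comp (a : C.Obj) {b b' b'' : C.Obj} (Y : Cx C b' b'') (X : Cx C b b') :
    Cx.left hL a (Cx.comp hF Y X) = Cx.comp hF (Cx.left hL a Y) (Cx.left hL a X) := by
  have hS := heq_of_eq (Susp.left_comp hM a Y.toSusp X.toSusp)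
  refine eq_of_heq (Cx.heq rfl rfl hS ?_)
  change HEq (Mat.left T a (Mat.hcomp Y.d (Mat.one X.toSusp) + Mat.hcomp (Mat.one Y.toSusp) X.d))
    (Mat.hcomp (Mat.left T a Y.d) (Mat.one (X.toSusp.left T a)) +
      Mat.hcomp (Mat.one (Y.toSusp.left T a)) (Mat.left T a X.d))
  rw [map_add, ← Mat.left_one hL, ← Mat.left_one hL]
  exact Mat.add_heq rfl rfl hS hS (Mat.left_hcomp hM a _ _) (Mat.left_hcomp hM a _ _)

theorem Cx.right_comp {a a' a'' : C.Obj} (Y : Cx C a' a'') (X : Cx C a a') (b : C.Obj) :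
    Cx.right hL (Cx.comp hF Y X) b = Cx.comp hF (Cx.right hL Y b) (Cx.right hL X b) := by
  have hS := heq_of_eq (Susp.right_comp hM Y.toSusp X.toSusp b)
  refine eq_of_heq (Cx.heq rfl rfl hS ?_)
  change HEq (Mat.right T b (Mat.hcomp Y.d (Mat.one X.toSusp) + Mat.hcomp (Mat.one Y.toSusp) X.d))
    (Mat.hcomp (Mat.right T b Y.d) (Mat.one (X.toSusp.right T b)) +
      Mat.hcomp (Mat.one (Y.toSusp.right T b)) (Mat.right T b X.d))
  rw [map_add, ← Mat.right_one hL, ← Mat.right_one hL]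
  exact Mat.add_heq rfl rfl hS hS (Mat.right_hcomp hM b _ _) (Mat.right_hcomp hM b _ _)

theorem Cx.left2_hcomp (a : C.Obj) {b b' b'' : C.Obj} {g' h' : Cx C b' b''} {g h : Cx C b b'}
    (β' : Cx.Hom2 g' h') (β : Cx.Hom2 g h) :
    HEq (Cx.left2 hL a (Cx.hcomp hF β' β)) (Cx.hcomp hF (Cx.left2 hL a β') (Cx.left2 hL a β)) := by
  obtain ⟨y, hy, rfl⟩ := SubQuot.exists_cls β'
  obtain ⟨x, hx, rfl⟩ := SubQuot.exists_cls β
  exact Cx.cls_heq rfl rfl (heq_of_eq (Cx.left_comp hM a g' g))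
    (heq_of_eq (Cx.left_comp hM a h' h)) _ _ (Mat.left_hcomp hM a y x)

theorem Cx.right2_hcomp {a a' a'' : C.Obj} {f' h' : Cx C a' a''} {f h : Cx C a a'} (b : C.Obj)
    (α' : Cx.Hom2 f' h') (α : Cx.Hom2 f h) :
    HEq (Cx.right2 hL b (Cx.hcomp hF α' α))
      (Cx.hcomp hF (Cx.right2 hL b α') (Cx.right2 hL b α)) := by
  obtain ⟨y, hy, rfl⟩ := SubQuot.exists_cls α'
  obtain ⟨x, hx, rfl⟩ := SubQuot.exists_cls α
  exact Cx.cls_heq rfl rfl (heq_of_eq (Cx.right_comp hM f' f b))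
    (heq_of_eq (Cx.right_comp hM h' h b)) _ _ (Mat.right_hcomp hM b y x)

theorem Cx.unit_left {b b' : C.Obj} (g : Cx C b b') : HEq (Cx.left hL T.unit g) g := by
  refine Cx.heq_of_apply (hM.unit_obj b) (hM.unit_obj b') rfl (fun i i' h => ?_) (fun i i' h => ?_)
    (fun i i' h => ?_) fun i i' j j' h h' => ?_
  · obtain rfl := Fin.ext h; exact hM.unit_left _
  · obtain rfl := Fin.ext h; rfl
  · obtain rfl := Fin.ext h; rfl
  · obtain rfl := Fin.ext h; obtain rfl := Fin.ext h'; exact hM.unit_left2 _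

theorem Cx.right_unit {a a' : C.Obj} (f : Cx C a a') : HEq (Cx.right hL f T.unit) f := by
  refine Cx.heq_of_apply (hM.obj_unit a) (hM.obj_unit a') rfl (fun i i' h => ?_) (fun i i' h => ?_)
    (fun i i' h => ?_) fun i i' j j' h h' => ?_
  · obtain rfl := Fin.ext h; exact hM.right_unit _
  · obtain rfl := Fin.ext h; rfl
  · obtain rfl := Fin.ext h; rfl
  · obtain rfl := Fin.ext h; obtain rfl := Fin.ext h'; exact hM.right2_unit _

theorem Cx.left_left (a b : C.Obj) {c c' : C.Obj} (h : Cx C c c') :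
    HEq (Cx.left hL (T.obj a b) h) (Cx.left hL a (Cx.left hL b h)) := by
  refine Cx.heq_of_apply (hM.obj_assoc a b c) (hM.obj_assoc a b c') rfl (fun i i' h => ?_)
    (fun i i' h => ?_) (fun i i' h => ?_) fun i i' j j' h h' => ?_
  · obtain rfl := Fin.ext h; exact hM.left_left a b _
  · obtain rfl := Fin.ext h; rfl
  · obtain rfl := Fin.ext h; rfl
  · obtain rfl := Fin.ext h; obtain rfl := Fin.ext h'; exact hM.left2_left2 a b _

theorem Cx.right_left (a : C.Obj) {b b' : C.Obj} (g : Cx C b b') (c : C.Obj) :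
    HEq (Cx.right hL (Cx.left hL a g) c) (Cx.left hL a (Cx.right hL g c)) := by
  refine Cx.heq_of_apply (hM.obj_assoc a b c) (hM.obj_assoc a b' c) rfl (fun i i' h => ?_)
    (fun i i' h => ?_) (fun i i' h => ?_) fun i i' j j' h h' => ?_
  · obtain rfl := Fin.ext h; exact hM.right_left a _ c
  · obtain rfl := Fin.ext h; rfl
  · obtain rfl := Fin.ext h; rfl
  · obtain rfl := Fin.ext h; obtain rfl := Fin.ext h'; exact hM.right2_left2 a _ c

theorem Cx.right_right {a a' : C.Obj} (f : Cx C a a') (b c : C.Obj) :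
    HEq (Cx.right hL (Cx.right hL f b) c) (Cx.right hL f (T.obj b c)) := by
  refine Cx.heq_of_apply (hM.obj_assoc a b c) (hM.obj_assoc a' b c) rfl (fun i i' h => ?_)
    (fun i i' h => ?_) (fun i i' h => ?_) fun i i' j j' h h' => ?_
  · obtain rfl := Fin.ext h; exact hM.right_right _ b c
  · obtain rfl := Fin.ext h; rfl
  · obtain rfl := Fin.ext h; rfl
  · obtain rfl := Fin.ext h; obtain rfl := Fin.ext h'; exact hM.right2_right2 _ b c

theorem Cx.unit_left2 {b b' : C.Obj} {g g' : Cx C b b'} (β : Cx.Hom2 g g') :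
    HEq (Cx.left2 hL T.unit β) β := by
  obtain ⟨x, hx, rfl⟩ := SubQuot.exists_cls β
  refine Cx.cls_heq_of_apply (hM.unit_obj b) (hM.unit_obj b') (Cx.unit_left hM g)
    (Cx.unit_left hM g') _ _ fun i i' j j' h h' => ?_
  obtain rfl := Fin.ext h; obtain rfl := Fin.ext h'; exact hM.unit_left2 _

theorem Cx.right2_unit {a a' : C.Obj} {f f' : Cx C a a'} (α : Cx.Hom2 f f') :
    HEq (Cx.right2 hL T.unit α) α := by
  obtain ⟨x, hx, rfl⟩ := SubQuot.exists_cls α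
  refine Cx.cls_heq_of_apply (hM.obj_unit a) (hM.obj_unit a') (Cx.right_unit hM f)
    (Cx.right_unit hM f') _ _ fun i i' j j' h h' => ?_
  obtain rfl := Fin.ext h; obtain rfl := Fin.ext h'; exact hM.right2_unit _

theorem Cx.left2_left2 (a b : C.Obj) {c c' : C.Obj} {h h' : Cx C c c'} (γ : Cx.Hom2 h h') :
    HEq (Cx.left2 hL (T.obj a b) γ) (Cx.left2 hL a (Cx.left2 hL b γ)) := by
  obtain ⟨x, hx, rfl⟩ := SubQuot.exists_cls γ
  refine Cx.cls_heq_of_apply (hM.obj_assoc a b c) (hM.obj_assoc a b c') (Cx.left_left hM a b h)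
    (Cx.left_left hM a b h') _ _ fun i i' j j' h h' => ?_
  obtain rfl := Fin.ext h; obtain rfl := Fin.ext h'; exact hM.left2_left2 a b _

theorem Cx.right2_left2 (a : C.Obj) {b b' : C.Obj} {g g' : Cx C b b'} (β : Cx.Hom2 g g')
    (c : C.Obj) :
    HEq (Cx.right2 hL c (Cx.left2 hL a β)) (Cx.left2 hL a (Cx.right2 hL c β)) := by
  obtain ⟨x, hx, rfl⟩ := SubQuot.exists_cls β
  refine Cx.cls_heq_of_apply (hM.obj_assoc a b c) (hM.obj_assoc a b' c) (Cx.right_left hM a g c)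
    (Cx.right_left hM a g' c) _ _ fun i i' j j' h h' => ?_
  obtain rfl := Fin.ext h; obtain rfl := Fin.ext h'; exact hM.right2_left2 a _ c

theorem Cx.right2_right2 {a a' : C.Obj} {f f' : Cx C a a'} (α : Cx.Hom2 f f') (b c : C.Obj) :
    HEq (Cx.right2 hL c (Cx.right2 hL b α)) (Cx.right2 hL (T.obj b c) α) := by
  obtain ⟨x, hx, rfl⟩ := SubQuot.exists_cls α
  refine Cx.cls_heq_of_apply (hM.obj_assoc a b c) (hM.obj_assoc a' b c) (Cx.right_right hM f b c)
    (Cx.right_right hM f' b c) _ _ fun i i' j j' h h' => ?_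
  obtain rfl := Fin.ext h; obtain rfl := Fin.ext h'; exact hM.right2_right2 _ b c

end StrictLaws

end TensorComplexes

section Tensorators

variable {k : Type} [Field k] {C : TwoCatData k} {T : TensorData C}

/-! ### The Koszul-signed tensorator of complexes -/

section Entries

variable {a a' b b' : C.Obj} (τ : T.Tensorator) (f : Susp C a a') (g : Susp C b b')

/-- The entry of the Koszul-signed tensorator from the term with indices `(i, j)` to the term with
indices `(j', i')`. It is nonzero only if `i = i'` and `j = j'`; the four indices are kept apart since
this equality is not definitional for lexicographic indices. -/
def tensoratorEntry (i : Fin f.len) (j j' : Fin g.len) (i' : Fin f.len) :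
    C.Hom2 (C.comp (T.right (f.obj i) b') (T.left a (g.obj j)))
      (C.comp (T.left a' (g.obj j')) (T.right (f.obj i') b)) :=
  if e : i = i' ∧ j = j' then
    koszul k (f.h i * g.h j) •
      C.vcomp (C.eqTo (show C.comp (T.left a' (g.obj j)) (T.right (f.obj i) b)
        = C.comp (T.left a' (g.obj j')) (T.right (f.obj i') b) by rw [e.1, e.2]))
      (τ (f.obj i) (g.obj j))
  else 0

/-- The matrix underlying the Koszul-signed tensorator; it does not involve the differentials. -/
def Mat.tensorator : Mat ((f.right T b').comp (g.left T a)) ((g.left T a').comp (f.right T b)) :=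
  fun p r => tensoratorEntry τ f g p.divNat p.modNat r.divNat r.modNat

theorem tensoratorEntry_self (hC : C.IsLocallyFunctorial) (i : Fin f.len) (j : Fin g.len) :
    tensoratorEntry τ f g i j j i = koszul k (f.h i * g.h j) • τ (f.obj i) (g.obj j) := by
  rw [tensoratorEntry, dif_pos ⟨rfl, rfl⟩]
  exact congrArg _ (hC.id_vcomp _)

theorem tensoratorEntry_ne {i i' : Fin f.len} {j j' : Fin g.len} (h : ¬(i = i' ∧ j = j')) :
    tensoratorEntry τ f g i j j' i' = 0 := dif_neg h

end Entries

theorem koszul_eq_of_even {m n l : ℤ} (h : m = n + 2 * l) : koszul k m = koszul k n := by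
  rw [h, koszul, koszul, Int.negOnePow_add, Int.negOnePow_two_mul, mul_one]

section Naturality

variable {hC : C.IsLocallyGradedTwoCategory} {τ : T.Tensorator} (hM : IsSemistrictMonoidal hC T τ)
include hM

/-- The signed tensorator is natural with respect to arbitrary matrices in the first argument, of any
cohomological degree: the Koszul signs of both composites agree. -/
theorem Mat.tensorator_natural_left {a a' b b' : C.Obj} {f f' : Susp C a a'} (α : Mat f f')
    (g : Susp C b b') :
    Mat.comp (Mat.tensorator τ f' g) (Mat.hcomp (Mat.right T b' α) (Mat.one (g.left T a)))
      = Mat.comp (Mat.hcomp (Mat.one (g.left T a')) (Mat.right T b α)) (Mat.tensorator τ f g) := by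
  funext p r
  have h1 := Fin.sum_divNat_modNat fun (i : Fin f'.len) (j : Fin g.len) =>
    C.vcomp (tensoratorEntry τ f' g i j r.divNat r.modNat)
      (koszul k ((g.h j - g.h p.modNat) * f.h p.divNat) •
        C.hcomp (T.right2 b' (α p.divNat i)) (Mat.one (g.left T a) p.modNat j))
  have h2 := Fin.sum_divNat_modNat fun (j : Fin g.len) (i : Fin f.len) =>
    C.vcomp (koszul k ((f'.h r.modNat - f.h i) * g.h j) •
        C.hcomp (Mat.one (g.left T a') j r.divNat) (T.right2 b (α i r.modNat)))
      (tensoratorEntry τ f g p.divNat p.modNat j i)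
  refine h1.trans (Eq.trans ?_ h2.symm)
  generalize (p.divNat : Fin f.len) = i
  generalize (p.modNat : Fin g.len) = j
  generalize (r.divNat : Fin g.len) = j'
  generalize (r.modNat : Fin f'.len) = i'
  rw [Finset.sum_eq_single i', Finset.sum_eq_single j', Finset.sum_eq_single j,
    Finset.sum_eq_single i]
  · by_cases h : j = j'
    · subst h
      rw [tensoratorEntry_self _ _ _ hC.toIsLocallyFunctorial,
        tensoratorEntry_self _ _ _ hC.toIsLocallyFunctorial, Mat.one_self (g.left T a),
        Mat.one_self (g.left T a')]
      simp only [map_smul, LinearMap.smul_apply, smul_smul, ← koszul_add]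
      rw [hM.tensorator_natural_left]
      congr 2
      ring
    · rw [Mat.one_ne (g.left T a) h, Mat.one_ne (g.left T a') h]
      simp only [map_zero, smul_zero, LinearMap.zero_apply]
  · intro i₁ _ h
    rw [tensoratorEntry_ne τ f g fun e => h e.1.symm, map_zero]
  · simp
  · intro j₁ _ h
    refine Finset.sum_eq_zero fun i₁ _ => ?_
    rw [tensoratorEntry_ne τ f g fun e => h e.2.symm, map_zero]
  · simp
  · intro j₁ _ h
    rw [tensoratorEntry_ne τ f' g fun e => h e.2, map_zero, LinearMap.zero_apply]
  · simp
  · intro i₁ _ h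
    refine Finset.sum_eq_zero fun j₁ _ => ?_
    rw [tensoratorEntry_ne τ f' g fun e => h e.1, map_zero, LinearMap.zero_apply]
  · simp

/-- The signed tensorator is natural with respect to arbitrary matrices in the second argument. -/
theorem Mat.tensorator_natural_right {a a' b b' : C.Obj} (f : Susp C a a') {g g' : Susp C b b'}
    (β : Mat g g') :
    Mat.comp (Mat.tensorator τ f g') (Mat.hcomp (Mat.one (f.right T b')) (Mat.left T a β))
      = Mat.comp (Mat.hcomp (Mat.left T a' β) (Mat.one (f.right T b))) (Mat.tensorator τ f g) := by
  funext p r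
  have h1 := Fin.sum_divNat_modNat fun (i : Fin f.len) (j : Fin g'.len) =>
    C.vcomp (tensoratorEntry τ f g' i j r.divNat r.modNat)
      (koszul k ((g'.h j - g.h p.modNat) * f.h p.divNat) •
        C.hcomp (Mat.one (f.right T b') p.divNat i) (T.left2 a (β p.modNat j)))
  have h2 := Fin.sum_divNat_modNat fun (j : Fin g.len) (i : Fin f.len) =>
    C.vcomp (koszul k ((f.h r.modNat - f.h i) * g.h j) •
        C.hcomp (T.left2 a' (β j r.divNat)) (Mat.one (f.right T b) i r.modNat))
      (tensoratorEntry τ f g p.divNat p.modNat j i)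
  refine h1.trans (Eq.trans ?_ h2.symm)
  generalize (p.divNat : Fin f.len) = i
  generalize (p.modNat : Fin g.len) = j
  generalize (r.divNat : Fin g'.len) = j'
  generalize (r.modNat : Fin f.len) = i'
  rw [Finset.sum_eq_single i', Finset.sum_eq_single j', Finset.sum_eq_single j,
    Finset.sum_eq_single i]
  · by_cases h : i = i'
    · subst h
      rw [tensoratorEntry_self _ _ _ hC.toIsLocallyFunctorial,
        tensoratorEntry_self _ _ _ hC.toIsLocallyFunctorial, Mat.one_self (f.right T b'),
        Mat.one_self (f.right T b)]
      simp only [map_smul, LinearMap.smul_apply, smul_smul, ← koszul_add]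
      rw [hM.tensorator_natural_right]
      congr 1
      exact koszul_eq_of_even (l := f.h i * (g'.h j' - g.h j)) (by ring)
    · rw [Mat.one_ne (f.right T b') h, Mat.one_ne (f.right T b) h]
      simp only [map_zero, smul_zero, LinearMap.zero_apply]
  · intro i₁ _ h
    rw [tensoratorEntry_ne τ f g fun e => h e.1.symm, map_zero]
  · simp
  · intro j₁ _ h
    refine Finset.sum_eq_zero fun i₁ _ => ?_
    rw [tensoratorEntry_ne τ f g fun e => h e.2.symm, map_zero]
  · simp
  · intro j₁ _ h
    rw [tensoratorEntry_ne τ f g' fun e => h e.2, map_zero, LinearMap.zero_apply]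
  · simp
  · intro i₁ _ h
    refine Finset.sum_eq_zero fun j₁ _ => ?_
    rw [tensoratorEntry_ne τ f g' fun e => h e.1, map_zero, LinearMap.zero_apply]
  · simp

end Naturality

end Tensorators

section Tensorators

variable {k : Type} [Field k] {C : TwoCatData k} {T : TensorData C}

section Degrees

variable (hC : C.IsLocallyFunctorial) (τ : T.Tensorator) {a a' b b' : C.Obj} (f : Susp C a a')
  (g : Susp C b b')

theorem Mat.tensorator_mem_hDeg : Mat.tensorator τ f g ∈ Mat.hDeg _ _ 0 := fun p r h =>
  tensoratorEntry_ne τ f g fun e => h (by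
    change f.h p.divNat + g.h p.modNat - (g.h r.divNat + f.h r.modNat) = 0
    rw [← e.1, ← e.2]
    ring)

include hC in
theorem Mat.tensorator_mem_qDeg (hτ : ∀ i j, τ (f.obj i) (g.obj j) ∈ C.deg _ _ 0) :
    Mat.tensorator τ f g ∈ Mat.qDeg _ _ 0 := by
  intro p r
  change tensoratorEntry τ f g p.divNat p.modNat r.divNat r.modNat ∈
    C.deg _ _ (0 + (f.q p.divNat + g.q p.modNat) - (g.q r.divNat + f.q r.modNat))
  by_cases e : (p.divNat : Fin f.len) = r.modNat ∧ (p.modNat : Fin g.len) = r.divNat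
  · rw [← e.1, ← e.2, tensoratorEntry_self τ f g hC]
    refine Submodule.smul_mem _ _ ?_
    have h0 : 0 + (f.q p.divNat + g.q p.modNat) - (g.q p.modNat + f.q p.divNat) = 0 := by ring
    rw [h0]
    exact hτ _ _
  · rw [tensoratorEntry_ne τ f g e]
    exact Submodule.zero_mem _

variable (σ : ∀ (i : Fin f.len) (j : Fin g.len),
  C.Hom2 (C.comp (T.left a' (g.obj j)) (T.right (f.obj i) b))
    (C.comp (T.right (f.obj i) b') (T.left a (g.obj j))))

/-- The entry from the term with indices `(j, i)` to the term with indices `(i', j')` of the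
Koszul-signed matrix determined by a family of 2-morphisms opposite to the tensorators. -/
def tensoratorInvEntry (j : Fin g.len) (i i' : Fin f.len) (j' : Fin g.len) :
    C.Hom2 (C.comp (T.left a' (g.obj j)) (T.right (f.obj i) b))
      (C.comp (T.right (f.obj i') b') (T.left a (g.obj j'))) :=
  if e : i = i' ∧ j = j' then
    koszul k (f.h i * g.h j) •
      C.vcomp (C.eqTo (show C.comp (T.right (f.obj i) b') (T.left a (g.obj j))
        = C.comp (T.right (f.obj i') b') (T.left a (g.obj j')) by rw [e.1, e.2])) (σ i j)
  else 0

/-- The Koszul-signed matrix determined by a family of 2-morphisms opposite to the tensorators. -/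
def Mat.tensoratorInv : Mat ((g.left T a').comp (f.right T b)) ((f.right T b').comp (g.left T a)) :=
  fun p r => tensoratorInvEntry f g σ p.divNat p.modNat r.divNat r.modNat

include hC in
theorem tensoratorInvEntry_self (i : Fin f.len) (j : Fin g.len) :
    tensoratorInvEntry f g σ j i i j = koszul k (f.h i * g.h j) • σ i j := by
  rw [tensoratorInvEntry, dif_pos ⟨rfl, rfl⟩]
  exact congrArg _ (hC.id_vcomp _)

theorem tensoratorInvEntry_ne {i i' : Fin f.len} {j j' : Fin g.len} (h : ¬(i = i' ∧ j = j')) :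
    tensoratorInvEntry f g σ j i i' j' = 0 := dif_neg h

theorem Mat.tensoratorInv_mem_hDeg : Mat.tensoratorInv f g σ ∈ Mat.hDeg _ _ 0 := fun p r h =>
  tensoratorInvEntry_ne f g σ fun e => h (by
    change g.h p.divNat + f.h p.modNat - (f.h r.divNat + g.h r.modNat) = 0
    rw [← e.1, ← e.2]
    ring)

theorem koszul_mul_self (n : ℤ) : koszul k n * koszul k n = 1 := by
  rw [← koszul_add, ← koszul_zero (k := k)]
  exact koszul_eq_of_even (l := n) (by ring)

include hC in
theorem Mat.tensoratorInv_comp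
    (h : ∀ i j, C.vcomp (σ i j) (τ (f.obj i) (g.obj j)) = C.id2 _) :
    Mat.comp (Mat.tensoratorInv f g σ) (Mat.tensorator τ f g) = Mat.one _ := by
  funext p r
  have h1 := Fin.sum_divNat_modNat fun (j : Fin g.len) (i : Fin f.len) =>
    C.vcomp (tensoratorInvEntry f g σ j i r.divNat r.modNat)
      (tensoratorEntry τ f g p.divNat p.modNat j i)
  refine h1.trans ?_
  rw [Finset.sum_eq_single p.modNat, Finset.sum_eq_single p.divNat]
  · by_cases e : p = r
    · subst e
      rw [tensoratorEntry_self τ f g hC, tensoratorInvEntry_self hC, Mat.one_self, map_smul,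
        map_smul, LinearMap.smul_apply, smul_smul, koszul_mul_self, h, one_smul]
    · rw [Mat.one_ne _ e, tensoratorInvEntry_ne f g σ fun e' => e (Fin.divNat_modNat_ext e'.1 e'.2),
        map_zero, LinearMap.zero_apply]
  · intro i _ hi
    rw [tensoratorEntry_ne τ f g fun e => hi e.1.symm, map_zero]
  · simp
  · intro j _ hj
    refine Finset.sum_eq_zero fun i _ => ?_
    rw [tensoratorEntry_ne τ f g fun e => hj e.2.symm, map_zero]
  · simp

include hC in
theorem Mat.comp_tensoratorInv
    (h : ∀ i j, C.vcomp (τ (f.obj i) (g.obj j)) (σ i j) = C.id2 _) :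
    Mat.comp (Mat.tensorator τ f g) (Mat.tensoratorInv f g σ) = Mat.one _ := by
  funext p r
  have h1 := Fin.sum_divNat_modNat fun (i : Fin f.len) (j : Fin g.len) =>
    C.vcomp (tensoratorEntry τ f g i j r.divNat r.modNat)
      (tensoratorInvEntry f g σ p.divNat p.modNat i j)
  refine h1.trans ?_
  rw [Finset.sum_eq_single p.modNat, Finset.sum_eq_single p.divNat]
  · by_cases e : p = r
    · subst e
      rw [tensoratorEntry_self τ f g hC, tensoratorInvEntry_self hC, Mat.one_self, map_smul,
        map_smul, LinearMap.smul_apply, smul_smul, koszul_mul_self, h, one_smul]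
    · rw [Mat.one_ne _ e, tensoratorEntry_ne τ f g fun e' => e (Fin.divNat_modNat_ext e'.2 e'.1),
        map_zero, LinearMap.zero_apply]
  · intro j _ hj
    rw [tensoratorInvEntry_ne f g σ fun e => hj e.2.symm, map_zero]
  · simp
  · intro i _ hi
    refine Finset.sum_eq_zero fun j _ => ?_
    rw [tensoratorInvEntry_ne f g σ fun e => hi e.1.symm, map_zero]
  · simp

end Degrees

/-- The inverse of a chain map is a chain map. -/
theorem Cx.inv_mem_chainMaps (hC : C.IsLocallyFunctorial) {a b : C.Obj} {X Y : Cx C a b}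
    {K : Mat X.toSusp Y.toSusp} {S : Mat Y.toSusp X.toSusp} (hK : K ∈ Cx.chainMaps X Y)
    (hS : S ∈ Mat.hDeg Y.toSusp X.toSusp 0) (h1 : Mat.comp S K = Mat.one _)
    (h2 : Mat.comp K S = Mat.one _) : S ∈ Cx.chainMaps Y X := by
  refine Cx.mem_chainMaps.2 ⟨hS, ?_⟩
  calc Mat.comp X.d S = Mat.comp (Mat.comp S K) (Mat.comp X.d S) := by rw [h1, Mat.one_comp hC]
    _ = Mat.comp S (Mat.comp (Mat.comp K X.d) S) := by simp only [Mat.comp_assoc hC]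
    _ = Mat.comp S (Mat.comp Y.d (Mat.comp K S)) := by
      rw [← (Cx.mem_chainMaps.1 hK).2, Mat.comp_assoc hC]
    _ = Mat.comp S Y.d := by rw [h2, Mat.comp_one hC]

section Classes

variable {hC : C.IsLocallyGradedTwoCategory} {τ : T.Tensorator} (hM : IsSemistrictMonoidal hC T τ)
include hM

local notation "hF" => TwoCatData.IsLocallyGradedTwoCategory.toIsLocallyFunctorial hC
local notation "hL" => IsSemistrictMonoidal.toIsLocallyFunctorial hM

/-- The signed tensorator intertwines the total differentials, by naturality with respect to the
matrices `f.d` and `g.d` of the two summands of the total differential. -/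
theorem koszulTensorator_mem_chainMaps {a a' b b' : C.Obj} (f : Cx C a a') (g : Cx C b b') :
    koszulTensorator hF hL τ f g ∈ Cx.chainMaps _ _ := by
  refine Cx.mem_chainMaps.2 ⟨Mat.tensorator_mem_hDeg τ f.toSusp g.toSusp, ?_⟩
  change Mat.comp (Mat.hcomp (Mat.left T a' g.d) (Mat.one (f.toSusp.right T b)) +
      Mat.hcomp (Mat.one (g.toSusp.left T a')) (Mat.right T b f.d))
        (Mat.tensorator τ f.toSusp g.toSusp)
    = Mat.comp (Mat.tensorator τ f.toSusp g.toSusp)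
      (Mat.hcomp (Mat.right T b' f.d) (Mat.one (g.toSusp.left T a)) +
      Mat.hcomp (Mat.one (f.toSusp.right T b')) (Mat.left T a g.d))
  rw [map_add, map_add, LinearMap.add_apply, Mat.tensorator_natural_left hM,
    Mat.tensorator_natural_right hM, add_comm]

/-- The tensorator of two complexes: the homotopy class of the Koszul-signed tensorator. -/
def Cx.tensorator {a a' b b' : C.Obj} (f : Cx C a a') (g : Cx C b b') :
    Cx.Hom2 (Cx.comp hF (Cx.right hL f b') (Cx.left hL a g))
      (Cx.comp hF (Cx.left hL a' g) (Cx.right hL f b)) :=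
  SubQuot.cls _ (koszulTensorator_mem_chainMaps hM f g)

theorem Cx.tensorator_deg {a a' b b' : C.Obj} (f : Cx C a a') (g : Cx C b b') :
    Cx.tensorator hM f g ∈ Cx.deg (Cx.comp hF (Cx.right hL f b') (Cx.left hL a g))
      (Cx.comp hF (Cx.left hL a' g) (Cx.right hL f b)) 0 :=
  SubQuot.mem_image.2 ⟨_, _, Mat.tensorator_mem_qDeg hF τ f.toSusp g.toSusp
    (fun _ _ => hM.tensorator_deg _ _), rfl⟩

theorem Cx.tensorator_iso {a a' b b' : C.Obj} (f : Cx C a a') (g : Cx C b b') :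
    ∃ σ : Cx.Hom2 (Cx.comp hF (Cx.left hL a' g) (Cx.right hL f b))
        (Cx.comp hF (Cx.right hL f b') (Cx.left hL a g)),
      Cx.vcomp hF σ (Cx.tensorator hM f g) = Cx.id2 hF _ ∧
      Cx.vcomp hF (Cx.tensorator hM f g) σ = Cx.id2 hF _ := by
  choose σ hσ hσ' using fun i j => hM.tensorator_iso (f.obj i) (g.obj j)
  have h1 := Mat.tensoratorInv_comp hF τ f.toSusp g.toSusp σ hσ
  have h2 := Mat.comp_tensoratorInv hF τ f.toSusp g.toSusp σ hσ'
  have hS := Cx.inv_mem_chainMaps hF (koszulTensorator_mem_chainMaps hM f g)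
    (Mat.tensoratorInv_mem_hDeg f.toSusp g.toSusp σ) h1 h2
  exact ⟨SubQuot.cls _ hS, SubQuot.cls_congr _ h1, SubQuot.cls_congr _ h2⟩

theorem Cx.tensorator_natural_left {a a' b b' : C.Obj} {f f' : Cx C a a'} (α : Cx.Hom2 f f')
    (g : Cx C b b') :
    Cx.vcomp hF (Cx.tensorator hM f' g)
        (Cx.hcomp hF (Cx.right2 hL b' α) (Cx.id2 hF (Cx.left hL a g)))
      = Cx.vcomp hF (Cx.hcomp hF (Cx.id2 hF (Cx.left hL a' g)) (Cx.right2 hL b α))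
        (Cx.tensorator hM f g) := by
  obtain ⟨x, hx, rfl⟩ := SubQuot.exists_cls α
  exact SubQuot.cls_congr _ (Mat.tensorator_natural_left hM x g.toSusp)

theorem Cx.tensorator_natural_right {a a' b b' : C.Obj} (f : Cx C a a') {g g' : Cx C b b'}
    (β : Cx.Hom2 g g') :
    Cx.vcomp hF (Cx.tensorator hM f g')
        (Cx.hcomp hF (Cx.id2 hF (Cx.right hL f b')) (Cx.left2 hL a β))
      = Cx.vcomp hF (Cx.hcomp hF (Cx.left2 hL a' β) (Cx.id2 hF (Cx.right hL f b)))
        (Cx.tensorator hM f g) := by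
  obtain ⟨x, hx, rfl⟩ := SubQuot.exists_cls β
  exact SubQuot.cls_congr _ (Mat.tensorator_natural_right hM f.toSusp x)

omit hM in
theorem Cx.comp_heq (hC : C.IsLocallyFunctorial) {a a' b b' c c' : C.Obj} (ha : a = a')
    (hb : b = b') (hc : c = c') {g : Cx C b c} {g' : Cx C b' c'} {f : Cx C a b} {f' : Cx C a' b'} (hg : HEq g g')
    (hf : HEq f f') : HEq (Cx.comp hC g f) (Cx.comp hC g' f') := by
  subst ha hb hc; cases hf; cases hg; rfl

theorem tensoratorEntry_left (a : C.Obj) {b b' c c' : C.Obj} (g : Susp C b b') (h : Susp C c c')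
    (i : Fin g.len) (j j' : Fin h.len) (i' : Fin g.len) :
    HEq (tensoratorEntry τ (g.left T a) h i j j' i')
      (T.left2 a (tensoratorEntry τ g h i j j' i')) := by
  have hs : ∀ (u : C.Hom b b') (v : C.Hom c c'), HEq
      (C.comp (T.right (T.left a u) c') (T.left (T.obj a b) v))
      (T.left a (C.comp (T.right u c') (T.left b v))) := fun u v =>
    (TwoCatData.comp_heq (hM.obj_assoc a b c) (hM.obj_assoc a b c') (hM.obj_assoc a b' c')
      (hM.right_left a u c') (hM.left_left a b v)).trans (heq_of_eq (hM.left_comp a _ _).symm)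
  have ht : ∀ (u : C.Hom b b') (v : C.Hom c c'), HEq
      (C.comp (T.left (T.obj a b') v) (T.right (T.left a u) c))
      (T.left a (C.comp (T.left b' v) (T.right u c))) := fun u v =>
    (TwoCatData.comp_heq (hM.obj_assoc a b c) (hM.obj_assoc a b' c) (hM.obj_assoc a b' c')
      (hM.left_left a b' v) (hM.right_left a u c)).trans (heq_of_eq (hM.left_comp a _ _).symm)
  by_cases e : i = i' ∧ j = j'
  · obtain ⟨rfl, rfl⟩ := e
    rw [tensoratorEntry_self τ (g.left T a) h hF, tensoratorEntry_self τ g h hF, map_smul]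
    exact TwoCatData.smul_heq (hM.obj_assoc a b c) (hM.obj_assoc a b' c') (hs _ _) (ht _ _) rfl
      (hM.tensorator_left a _ _)
  · rw [tensoratorEntry_ne τ (g.left T a) h e, tensoratorEntry_ne τ g h e, map_zero]
    exact TwoCatData.zero_heq (hM.obj_assoc a b c) (hM.obj_assoc a b' c') (hs _ _) (ht _ _)

theorem Cx.tensorator_left (a : C.Obj) {b b' c c' : C.Obj} (g : Cx C b b') (h : Cx C c c') :
    HEq (Cx.tensorator hM (Cx.left hL a g) h) (Cx.left2 hL a (Cx.tensorator hM g h)) := by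
  refine Cx.cls_heq_of_apply (hM.obj_assoc a b c) (hM.obj_assoc a b' c')
    ((Cx.comp_heq hF (hM.obj_assoc a b c) (hM.obj_assoc a b c') (hM.obj_assoc a b' c')
      (Cx.right_left hM a g c') (Cx.left_left hM a b h)).trans
        (heq_of_eq (Cx.left_comp hM a _ _).symm))
    ((Cx.comp_heq hF (hM.obj_assoc a b c) (hM.obj_assoc a b' c) (hM.obj_assoc a b' c')
      (Cx.left_left hM a b' h) (Cx.right_left hM a g c)).trans
        (heq_of_eq (Cx.left_comp hM a _ _).symm)) _ _ fun p p' r r' hp hr => ?_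
  obtain rfl := Fin.ext hp
  obtain rfl := Fin.ext hr
  exact tensoratorEntry_left hM a g.toSusp h.toSusp _ _ _ _

theorem tensoratorEntry_mid {a a' c c' : C.Obj} (f : Susp C a a') (b : C.Obj) (h : Susp C c c')
    (i : Fin f.len) (j j' : Fin h.len) (i' : Fin f.len) :
    HEq (tensoratorEntry τ (f.right T b) h i j j' i')
      (tensoratorEntry τ f (h.left T b) i j j' i') := by
  have hs : ∀ (u : C.Hom a a') (v : C.Hom c c'), HEq
      (C.comp (T.right (T.right u b) c') (T.left (T.obj a b) v))
      (C.comp (T.right u (T.obj b c')) (T.left a (T.left b v))) := fun u v =>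
    TwoCatData.comp_heq (hM.obj_assoc a b c) (hM.obj_assoc a b c') (hM.obj_assoc a' b c')
      (hM.right_right u b c') (hM.left_left a b v)
  have ht : ∀ (u : C.Hom a a') (v : C.Hom c c'), HEq
      (C.comp (T.left (T.obj a' b) v) (T.right (T.right u b) c))
      (C.comp (T.left a' (T.left b v)) (T.right u (T.obj b c))) := fun u v =>
    TwoCatData.comp_heq (hM.obj_assoc a b c) (hM.obj_assoc a' b c) (hM.obj_assoc a' b c')
      (hM.left_left a' b v) (hM.right_right u b c)
  by_cases e : i = i' ∧ j = j'
  · obtain ⟨rfl, rfl⟩ := e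
    rw [tensoratorEntry_self τ (f.right T b) h hF, tensoratorEntry_self τ f (h.left T b) hF]
    exact TwoCatData.smul_heq (hM.obj_assoc a b c) (hM.obj_assoc a' b c') (hs _ _) (ht _ _) rfl
      (hM.tensorator_mid _ b _)
  · rw [tensoratorEntry_ne τ (f.right T b) h e, tensoratorEntry_ne τ f (h.left T b) e]
    exact TwoCatData.zero_heq (hM.obj_assoc a b c) (hM.obj_assoc a' b c') (hs _ _) (ht _ _)

theorem Cx.tensorator_mid {a a' c c' : C.Obj} (f : Cx C a a') (b : C.Obj) (h : Cx C c c') :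
    HEq (Cx.tensorator hM (Cx.right hL f b) h) (Cx.tensorator hM f (Cx.left hL b h)) := by
  refine Cx.cls_heq_of_apply (hM.obj_assoc a b c) (hM.obj_assoc a' b c')
    (Cx.comp_heq hF (hM.obj_assoc a b c) (hM.obj_assoc a b c') (hM.obj_assoc a' b c')
      (Cx.right_right hM f b c') (Cx.left_left hM a b h))
    (Cx.comp_heq hF (hM.obj_assoc a b c) (hM.obj_assoc a' b c) (hM.obj_assoc a' b c')
      (Cx.left_left hM a' b h) (Cx.right_right hM f b c)) _ _ fun p p' r r' hp hr => ?_
  obtain rfl := Fin.ext hp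
  obtain rfl := Fin.ext hr
  exact tensoratorEntry_mid hM f.toSusp b h.toSusp _ _ _ _

theorem tensoratorEntry_right {a a' b b' : C.Obj} (f : Susp C a a') (g : Susp C b b') (c : C.Obj)
    (i : Fin f.len) (j j' : Fin g.len) (i' : Fin f.len) :
    HEq (tensoratorEntry τ f (g.right T c) i j j' i')
      (T.right2 c (tensoratorEntry τ f g i j j' i')) := by
  have hs : ∀ (u : C.Hom a a') (v : C.Hom b b'), HEq
      (C.comp (T.right u (T.obj b' c)) (T.left a (T.right v c)))
      (T.right (C.comp (T.right u b') (T.left a v)) c) := fun u v =>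
    (TwoCatData.comp_heq (hM.obj_assoc a b c).symm (hM.obj_assoc a b' c).symm
      (hM.obj_assoc a' b' c).symm (hM.right_right u b' c).symm (hM.right_left a v c).symm).trans
        (heq_of_eq (hM.right_comp _ _ c).symm)
  have ht : ∀ (u : C.Hom a a') (v : C.Hom b b'), HEq
      (C.comp (T.left a' (T.right v c)) (T.right u (T.obj b c)))
      (T.right (C.comp (T.left a' v) (T.right u b)) c) := fun u v =>
    (TwoCatData.comp_heq (hM.obj_assoc a b c).symm (hM.obj_assoc a' b c).symm
      (hM.obj_assoc a' b' c).symm (hM.right_left a' v c).symm (hM.right_right u b c).symm).trans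
        (heq_of_eq (hM.right_comp _ _ c).symm)
  by_cases e : i = i' ∧ j = j'
  · obtain ⟨rfl, rfl⟩ := e
    rw [tensoratorEntry_self τ f (g.right T c) hF, tensoratorEntry_self τ f g hF, map_smul]
    exact TwoCatData.smul_heq (hM.obj_assoc a b c).symm (hM.obj_assoc a' b' c).symm (hs _ _)
      (ht _ _) rfl (hM.tensorator_right _ _ c)
  · rw [tensoratorEntry_ne τ f (g.right T c) e, tensoratorEntry_ne τ f g e, map_zero]
    exact TwoCatData.zero_heq (hM.obj_assoc a b c).symm (hM.obj_assoc a' b' c).symm (hs _ _)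
      (ht _ _)

theorem Cx.tensorator_right {a a' b b' : C.Obj} (f : Cx C a a') (g : Cx C b b') (c : C.Obj) :
    HEq (Cx.tensorator hM f (Cx.right hL g c)) (Cx.right2 hL c (Cx.tensorator hM f g)) := by
  refine Cx.cls_heq_of_apply (hM.obj_assoc a b c).symm (hM.obj_assoc a' b' c).symm
    ((Cx.comp_heq hF (hM.obj_assoc a b c).symm (hM.obj_assoc a b' c).symm (hM.obj_assoc a' b' c).symm
      (Cx.right_right hM f b' c).symm (Cx.right_left hM a g c).symm).trans
        (heq_of_eq (Cx.right_comp hM _ _ c).symm))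
    ((Cx.comp_heq hF (hM.obj_assoc a b c).symm (hM.obj_assoc a' b c).symm (hM.obj_assoc a' b' c).symm
      (Cx.right_left hM a' g c).symm (Cx.right_right hM f b c).symm).trans
        (heq_of_eq (Cx.right_comp hM _ _ c).symm)) _ _ fun p p' r r' hp hr => ?_
  obtain rfl := Fin.ext hp
  obtain rfl := Fin.ext hr
  exact tensoratorEntry_right hM f.toSusp g.toSusp c _ _ _ _

theorem tensoratorEntry_one_left (a : C.Obj) {b b' : C.Obj} (g : Susp C b b')
    (i i' : Fin (Cx.one a : Cx C a a).len) (j j' : Fin g.len) :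
    HEq (tensoratorEntry τ (Cx.one a : Cx C a a).toSusp g i j j' i')
      (Mat.one (g.left T a) j j') := by
  obtain rfl : i = i' := Subsingleton.elim (α := Fin 1) _ _
  by_cases e : j = j'
  · subst e
    rw [tensoratorEntry_self τ (Cx.one a : Cx C a a).toSusp g hF, Mat.one_self (g.left T a)]
    have h1 : koszul k ((Cx.one a : Cx C a a).h i * g.h j) = 1 := by
      rw [show (Cx.one a : Cx C a a).h i = 0 from rfl, zero_mul, koszul_zero]
    rw [h1, one_smul]
    exact hM.tensorator_one_left a _
  · rw [tensoratorEntry_ne τ (Cx.one a : Cx C a a).toSusp g fun e' => e e'.2,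
      Mat.one_ne (g.left T a) e]
    refine TwoCatData.zero_heq rfl rfl (heq_of_eq ?_) (heq_of_eq ?_)
    · exact (congrArg (C.comp · _) (hM.right_one a b')).trans (hC.one_comp _)
    · exact (congrArg (C.comp _) (hM.right_one a b)).trans (hC.comp_one _)

theorem Cx.tensorator_one_left (a : C.Obj) {b b' : C.Obj} (g : Cx C b b') :
    HEq (Cx.tensorator hM (Cx.one a) g) (Cx.id2 hF (Cx.left hL a g)) := by
  refine Cx.cls_heq_of_apply rfl rfl
    (heq_of_eq (by rw [Cx.right_one hM, Cx.one_comp hC]))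
    (heq_of_eq (by rw [Cx.right_one hM, Cx.comp_one hC])) _ _ fun p p' r r' hp hr => ?_
  obtain rfl : p.modNat = p' := Fin.ext ((Nat.mod_eq_of_lt (hp ▸ p'.2)).trans hp)
  obtain rfl : r.divNat = r' := Fin.ext (Eq.trans (Nat.div_one _) hr)
  exact tensoratorEntry_one_left hM a g.toSusp _ _ _ _

theorem tensoratorEntry_one_right {a a' : C.Obj} (f : Susp C a a') (b : C.Obj) (i i' : Fin f.len)
    (j j' : Fin (Cx.one b : Cx C b b).len) :
    HEq (tensoratorEntry τ f (Cx.one b : Cx C b b).toSusp i j j' i')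
      (Mat.one (f.right T b) i i') := by
  obtain rfl : j = j' := Subsingleton.elim (α := Fin 1) _ _
  by_cases e : i = i'
  · subst e
    rw [tensoratorEntry_self τ f (Cx.one b : Cx C b b).toSusp hF, Mat.one_self (f.right T b)]
    have h1 : koszul k (f.h i * (Cx.one b : Cx C b b).h j) = 1 := by
      rw [show (Cx.one b : Cx C b b).h j = 0 from rfl, mul_zero, koszul_zero]
    rw [h1, one_smul]
    exact hM.tensorator_one_right _ b
  · rw [tensoratorEntry_ne τ f (Cx.one b : Cx C b b).toSusp fun e' => e e'.1,
      Mat.one_ne (f.right T b) e]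
    refine TwoCatData.zero_heq rfl rfl (heq_of_eq ?_) (heq_of_eq ?_)
    · exact (congrArg (C.comp _) (hM.left_one a b)).trans (hC.comp_one _)
    · exact (congrArg (C.comp · _) (hM.left_one a' b)).trans (hC.one_comp _)

theorem Cx.tensorator_one_right {a a' : C.Obj} (f : Cx C a a') (b : C.Obj) :
    HEq (Cx.tensorator hM f (Cx.one b)) (Cx.id2 hF (Cx.right hL f b)) := by
  refine Cx.cls_heq_of_apply rfl rfl
    (heq_of_eq (by rw [Cx.left_one hM, Cx.comp_one hC]))
    (heq_of_eq (by rw [Cx.left_one hM, Cx.one_comp hC])) _ _ fun p p' r r' hp hr => ?_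
  obtain rfl : p.divNat = p' := Fin.ext (Eq.trans (Nat.div_one _) hp)
  obtain rfl : r.modNat = r' := Fin.ext ((Nat.mod_eq_of_lt (hr ▸ r'.2)).trans hr)
  exact tensoratorEntry_one_right hM f.toSusp b _ _ _ _

end Classes

end Tensorators

section Tensorators

variable {k : Type} [Field k] {C : TwoCatData k} {T : TensorData C}

theorem TwoCatData.eqTo_vcomp_heq (hC : C.IsLocallyFunctorial) {a b : C.Obj} {f g g' : C.Hom a b}
    (e : g = g') (x : C.Hom2 f g) : HEq (C.vcomp (C.eqTo e) x) x := by
  subst e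
  exact heq_of_eq (hC.id_vcomp x)

theorem Fin.sum_divNat_divNat {M : Type} [AddCommMonoid M] {l m n : ℕ}
    (F : Fin l → Fin m → Fin n → M) :
    ∑ p : Fin (l * m * n), F p.divNat.divNat p.divNat.modNat p.modNat = ∑ i, ∑ j, ∑ s, F i j s :=
  (Fin.sum_divNat_modNat fun (q : Fin (l * m)) s => F q.divNat q.modNat s).trans
    (Fin.sum_divNat_modNat fun i j => ∑ s, F i j s)

theorem Cx.mem_chainMaps_of_heq {a b : C.Obj} {X Y Y' : Cx C a b} (hY : Y = Y')
    {A : Mat X.toSusp Y.toSusp} {A' : Mat X.toSusp Y'.toSusp} (h : HEq A A')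
    (hA : A ∈ Cx.chainMaps X Y) : A' ∈ Cx.chainMaps X Y' := by
  subst hY; cases h; exact hA

theorem Cx.one_mem_chainMaps (hC : C.IsLocallyFunctorial) {a b : C.Obj} (X : Cx C a b) :
    Mat.one X.toSusp ∈ Cx.chainMaps X X :=
  Cx.mem_chainMaps.2 ⟨Mat.one_mem_hDeg _, by rw [Mat.one_comp hC, Mat.comp_one hC]⟩

theorem Cx.hcomp_mem_chainMaps (hC : C.IsLocallyFunctorial) {a b c : C.Obj} {Y Y' : Cx C b c}
    {X X' : Cx C a b} {G : Mat Y.toSusp Y'.toSusp} {F : Mat X.toSusp X'.toSusp}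
    (hG : G ∈ Cx.chainMaps Y Y') (hF : F ∈ Cx.chainMaps X X') :
    Mat.hcomp G F ∈ Cx.chainMaps (Cx.comp hC Y X) (Cx.comp hC Y' X') := by
  rw [Cx.mem_chainMaps] at hG hF
  refine Cx.mem_chainMaps.2 ⟨Mat.hcomp_mem_hDeg (by norm_num) hG.1 hF.1, ?_⟩
  refine (Mat.totalD_comp hC _ X'.d_hDeg _ hG.1).trans
    (Eq.trans ?_ (Mat.comp_totalD hC _ Y.d_hDeg _ hF.1).symm)
  rw [hG.2, hF.2, koszul_zero, one_smul, one_smul]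

section Classes

variable {hC : C.IsLocallyGradedTwoCategory} {τ : T.Tensorator} (hM : IsSemistrictMonoidal hC T τ)

local notation "hF" => TwoCatData.IsLocallyGradedTwoCategory.toIsLocallyFunctorial hC
local notation "hL" => IsSemistrictMonoidal.toIsLocallyFunctorial hM

/-! ### Multiplicativity of the tensorator -/

section Right

variable (hC τ) {a a' b b' b'' : C.Obj} (f : Susp C a a') (g' : Susp C b' b'') (g : Susp C b b')

/-- The entry of `τ f g' ∘₁ id` from the term with indices `((i₁, l₁), j₁)` to the term with
indices `((l, i), j)`, where the target is bracketed to the right. -/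
def compRightEntry (i₁ : Fin f.len) (l₁ : Fin g'.len) (j₁ : Fin g.len) (l : Fin g'.len)
    (i : Fin f.len) (j : Fin g.len) :
    C.Hom2 (C.comp (C.comp (T.right (f.obj i₁) b'') (T.left a (g'.obj l₁))) (T.left a (g.obj j₁)))
      (C.comp (T.left a' (g'.obj l)) (C.comp (T.right (f.obj i) b') (T.left a (g.obj j)))) :=
  C.vcomp (C.eqTo (hC.comp_assoc _ _ _))
    (koszul k ((g.h j - g.h j₁) * (f.h i₁ + g'.h l₁)) •
      C.hcomp (tensoratorEntry τ f g' i₁ l₁ l i) (Mat.one (g.left T a) j₁ j))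

/-- The matrix of `τ f g' ∘₁ id`, with the target bracketed to the right. -/
def Mat.compRight : Mat (((f.right T b'').comp (g'.left T a)).comp (g.left T a))
    ((g'.left T a').comp ((f.right T b').comp (g.left T a))) := fun p q =>
  compRightEntry hC τ f g' g p.divNat.divNat p.divNat.modNat p.modNat q.divNat q.modNat.divNat
    q.modNat.modNat

theorem Mat.heq_compRight :
    HEq (Mat.hcomp (Mat.tensorator τ f g') (Mat.one (g.left T a))) (Mat.compRight hC τ f g' g) := by
  refine Mat.heq rfl rfl HEq.rfl (heq_of_eq (Susp.comp_assoc hC _ _ _)) fun p p' q q' hp hq => ?_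
  obtain rfl := Fin.ext hp
  obtain ⟨h1, h2, h3⟩ := Fin.divNat_divNat_eq hq
  have key : ∀ (i₁ : Fin f.len) (l₁ : Fin g'.len) (j₁ : Fin g.len) (l l' : Fin g'.len)
      (i i' : Fin f.len) (j j' : Fin g.len), l = l' → i = i' → j = j' →
      HEq (koszul k ((g.h j - g.h j₁) * (f.h i₁ + g'.h l₁)) •
        C.hcomp (tensoratorEntry τ f g' i₁ l₁ l i) (Mat.one (g.left T a) j₁ j))
      (compRightEntry hC τ f g' g i₁ l₁ j₁ l' i' j') := by
    rintro i₁ l₁ j₁ l _ i _ j _ rfl rfl rfl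
    exact (TwoCatData.eqTo_vcomp_heq hF _ _).symm
  exact key _ _ _ _ _ _ _ _ _ h1 h2 h3

theorem compRightEntry_ne {i₁ i : Fin f.len} {l₁ l : Fin g'.len} {j₁ j : Fin g.len}
    (h : ¬((i₁ = i ∧ l₁ = l) ∧ j₁ = j)) : compRightEntry hC τ f g' g i₁ l₁ j₁ l i j = 0 := by
  rw [compRightEntry]
  by_cases h1 : i₁ = i ∧ l₁ = l
  · rw [Mat.one_ne (g.left T a) fun h2 => h ⟨h1, h2⟩]
    simp only [map_zero, smul_zero]
  · rw [tensoratorEntry_ne τ f g' h1]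
    simp only [map_zero, LinearMap.zero_apply, smul_zero]

theorem compRightEntry_self (i : Fin f.len) (l : Fin g'.len) (j : Fin g.len) :
    compRightEntry hC τ f g' g i l j l i j = koszul k (f.h i * g'.h l) •
      C.vcomp (C.eqTo (hC.comp_assoc _ _ _))
        (C.hcomp (τ (f.obj i) (g'.obj l)) (C.id2 (T.left a (g.obj j)))) := by
  rw [compRightEntry, tensoratorEntry_self τ f g' hF, Mat.one_self (g.left T a), sub_self, zero_mul,
    koszul_zero, one_smul, map_smul, LinearMap.smul_apply, map_smul]

include hM in
/-- In the threefold sum of the matrix product, only the term with the indices of the source is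
nonzero; there the claim is the multiplicativity of `τ`. -/
theorem tensoratorEntry_comp_right (i : Fin f.len) (m m' : Fin (g'.comp g).len) (i' : Fin f.len)
    {i₁ i₂ : Fin f.len} {l₁ l₂ : Fin g'.len} {j₁ j₂ : Fin g.len} (hi : i₁ = i) (hi' : i₂ = i')
    (hl : l₁ = m.divNat) (hj : j₁ = m.modNat) (hl' : l₂ = m'.divNat) (hj' : j₂ = m'.modNat) :
    HEq (tensoratorEntry τ f (g'.comp g) i m m' i')
      (∑ l, ∑ i, ∑ j, C.vcomp
        (koszul k (((g.h j₂ + f.h i₂) - (f.h i + g.h j)) * g'.h l) •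
          C.hcomp (Mat.one (g'.left T a') l l₂) (tensoratorEntry τ f g i j j₂ i₂))
        (compRightEntry hC τ f g' g i₁ l₁ j₁ l i j)) := by
  subst hi hi' hl hj hl' hj'
  have hs : C.comp (T.right (f.obj i₁) b'') (T.left a (C.comp (g'.obj m.divNat) (g.obj m.modNat)))
      = C.comp (C.comp (T.right (f.obj i₁) b'') (T.left a (g'.obj m.divNat)))
        (T.left a (g.obj m.modNat)) := by
    rw [hM.left_comp, hC.comp_assoc]
  have ht : C.comp (T.left a' (C.comp (g'.obj m'.divNat) (g.obj m'.modNat))) (T.right (f.obj i₂) b)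
      = C.comp (T.left a' (g'.obj m'.divNat)) (C.comp (T.left a' (g.obj m'.modNat))
        (T.right (f.obj i₂) b)) := by
    rw [hM.left_comp, hC.comp_assoc]
  rw [Finset.sum_eq_single m.divNat, Finset.sum_eq_single i₁, Finset.sum_eq_single m.modNat]
  · rw [compRightEntry_self]
    by_cases e : i₁ = i₂ ∧ m = m'
    · obtain ⟨rfl, rfl⟩ := e
      rw [tensoratorEntry_self τ f (g'.comp g) hF, tensoratorEntry_self τ f g hF,
        Mat.one_self (g'.left T a')]
      simp only [map_smul, LinearMap.smul_apply, smul_smul, ← koszul_add]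
      refine TwoCatData.smul_heq rfl rfl (heq_of_eq hs) (heq_of_eq ht) ?_
        (hM.tensorator_comp_right _ _ _)
      congr 1
      ring
    · rw [tensoratorEntry_ne τ f (g'.comp g) e]
      have h0 : C.hcomp (Mat.one (g'.left T a') m.divNat m'.divNat)
          (tensoratorEntry τ f g i₁ m.modNat m'.modNat i₂) = 0 := by
        by_cases h1 : m.divNat = m'.divNat
        · rw [tensoratorEntry_ne τ f g fun h2 => e ⟨h2.1, Fin.divNat_modNat_ext h1 h2.2⟩, map_zero]
        · rw [Mat.one_ne (g'.left T a') h1, map_zero, LinearMap.zero_apply]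
      rw [h0, smul_zero, map_zero, LinearMap.zero_apply]
      exact TwoCatData.zero_heq rfl rfl (heq_of_eq hs) (heq_of_eq ht)
  · intro j _ h
    rw [compRightEntry_ne hC τ f g' g fun e => h e.2.symm, map_zero]
  · simp
  · intro i _ h
    refine Finset.sum_eq_zero fun j _ => ?_
    rw [compRightEntry_ne hC τ f g' g fun e => h e.1.1.symm, map_zero]
  · simp
  · intro l _ h
    refine Finset.sum_eq_zero fun i _ => Finset.sum_eq_zero fun j _ => ?_
    rw [compRightEntry_ne hC τ f g' g fun e => h e.1.2.symm, map_zero]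
  · simp

end Right

theorem Cx.tensorator_comp_right {a a' b b' b'' : C.Obj} (f : Cx C a a') (g' : Cx C b' b'')
    (g : Cx C b b') :
    HEq (Cx.tensorator hM f (Cx.comp hF g' g))
      (Cx.vcomp hF (Cx.hcomp hF (Cx.id2 hF (Cx.left hL a' g')) (Cx.tensorator hM f g))
        (Cx.vcomp hF ((KbLoc hF).eqTo (Cx.comp_assoc hC (Cx.left hL a' g') (Cx.right hL f b')
            (Cx.left hL a g)))
          (Cx.hcomp hF (Cx.tensorator hM f g') (Cx.id2 hF (Cx.left hL a g))))) := by
  have e := Cx.comp_assoc hC (Cx.left hL a' g') (Cx.right hL f b') (Cx.left hL a g)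
  have h1 := Mat.heq_compRight hC τ f.toSusp g'.toSusp g.toSusp
  have hm : Mat.hcomp (Mat.tensorator τ f.toSusp g'.toSusp) (Mat.one (g.toSusp.left T a)) ∈
      Cx.chainMaps (Cx.comp hF (Cx.comp hF (Cx.right hL f b'') (Cx.left hL a g')) (Cx.left hL a g))
        (Cx.comp hF (Cx.comp hF (Cx.left hL a' g') (Cx.right hL f b')) (Cx.left hL a g)) :=
    Cx.hcomp_mem_chainMaps hF (koszulTensorator_mem_chainMaps hM f g')
      (Cx.one_mem_chainMaps hF (Cx.left hL a g))
  -- the identification of the two bracketings is absorbed into the first factor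
  have hm' := Cx.mem_chainMaps_of_heq e h1 hm
  have h2 := TwoCatData.vcomp_eqTo_vcomp (C := KbLoc hF) (KbLoc.isLocallyFunctorial hF) e
    (Cx.hcomp hF (Cx.id2 hF (Cx.left hL a' g')) (Cx.tensorator hM f g))
    (x := SubQuot.cls _ hm) (x' := SubQuot.cls _ hm')
    (Cx.cls_heq rfl rfl HEq.rfl (heq_of_eq e) _ _ h1)
  refine HEq.trans ?_ (heq_of_eq h2.symm)
  refine Cx.cls_heq_of_apply rfl rfl
    (heq_of_eq (by rw [Cx.left_comp hM, Cx.comp_assoc hC]))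
    (heq_of_eq (by rw [Cx.left_comp hM, Cx.comp_assoc hC])) _ _ fun p p' r r' hp hr => ?_
  obtain ⟨h1, h2, h3⟩ := Fin.divNat_divNat_eq hp.symm
  obtain ⟨h1', h2', h3'⟩ := Fin.divNat_divNat_eq hr
  refine HEq.trans (tensoratorEntry_comp_right hC τ hM f.toSusp g'.toSusp g.toSusp _ _ _ _
    h1 h3'.symm h2 h3 h1'.symm h2'.symm) (heq_of_eq ?_)
  refine Eq.trans (Finset.sum_congr rfl fun l _ => (Fin.sum_divNat_modNat _).symm)
    (Fin.sum_divNat_modNat _).symm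

section Left

variable (hC τ) {a a' a'' b b' : C.Obj} (f' : Susp C a' a'') (f : Susp C a a') (g : Susp C b b')

/-- The entry of `id ∘₁ τ f g` from the term with indices `(i₁', (i₁, j₁))` to the term with
indices `((i', j), i)`, where the target is bracketed to the left. -/
def compLeftEntry (i₁' : Fin f'.len) (i₁ : Fin f.len) (j₁ : Fin g.len) (i' : Fin f'.len)
    (j : Fin g.len) (i : Fin f.len) :
    C.Hom2 (C.comp (T.right (f'.obj i₁') b') (C.comp (T.right (f.obj i₁) b') (T.left a (g.obj j₁))))
      (C.comp (C.comp (T.right (f'.obj i') b') (T.left a' (g.obj j))) (T.right (f.obj i) b)) :=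
  C.vcomp (C.eqTo (hC.comp_assoc _ _ _).symm)
    (koszul k (((g.h j + f.h i) - (f.h i₁ + g.h j₁)) * f'.h i₁') •
      C.hcomp (Mat.one (f'.right T b') i₁' i') (tensoratorEntry τ f g i₁ j₁ j i))

/-- The matrix of `id ∘₁ τ f g`, with the target bracketed to the left. -/
def Mat.compLeft : Mat ((f'.right T b').comp ((f.right T b').comp (g.left T a)))
    (((f'.right T b').comp (g.left T a')).comp (f.right T b)) := fun p q =>
  compLeftEntry hC τ f' f g p.divNat p.modNat.divNat p.modNat.modNat q.divNat.divNat
    q.divNat.modNat q.modNat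

theorem Mat.heq_compLeft :
    HEq (Mat.hcomp (Mat.one (f'.right T b')) (Mat.tensorator τ f g)) (Mat.compLeft hC τ f' f g) := by
  refine Mat.heq rfl rfl HEq.rfl (heq_of_eq (Susp.comp_assoc hC _ _ _).symm)
    fun p p' q q' hp hq => ?_
  obtain rfl := Fin.ext hp
  obtain ⟨h1, h2, h3⟩ := Fin.divNat_divNat_eq hq.symm
  have key : ∀ (i₁' : Fin f'.len) (i₁ : Fin f.len) (j₁ : Fin g.len) (l l' : Fin f'.len)
      (j j' : Fin g.len) (i i' : Fin f.len), l' = l → j' = j → i' = i →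
      HEq (koszul k (((g.h j + f.h i) - (f.h i₁ + g.h j₁)) * f'.h i₁') •
        C.hcomp (Mat.one (f'.right T b') i₁' l) (tensoratorEntry τ f g i₁ j₁ j i))
      (compLeftEntry hC τ f' f g i₁' i₁ j₁ l' j' i') := by
    rintro i₁' i₁ j₁ l _ j _ i _ rfl rfl rfl
    exact (TwoCatData.eqTo_vcomp_heq hF _ _).symm
  exact key _ _ _ _ _ _ _ _ _ h1 h2 h3

theorem compLeftEntry_ne {i₁' i' : Fin f'.len} {i₁ i : Fin f.len} {j₁ j : Fin g.len}
    (h : ¬(i₁' = i' ∧ (i₁ = i ∧ j₁ = j))) : compLeftEntry hC τ f' f g i₁' i₁ j₁ i' j i = 0 := by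
  rw [compLeftEntry]
  by_cases h1 : i₁ = i ∧ j₁ = j
  · rw [Mat.one_ne (f'.right T b') fun h2 => h ⟨h2, h1⟩]
    simp only [map_zero, LinearMap.zero_apply, smul_zero]
  · rw [tensoratorEntry_ne τ f g h1]
    simp only [map_zero, smul_zero]

theorem compLeftEntry_self (i' : Fin f'.len) (i : Fin f.len) (j : Fin g.len) :
    compLeftEntry hC τ f' f g i' i j i' j i = koszul k (f.h i * g.h j) •
      C.vcomp (C.eqTo (hC.comp_assoc _ _ _).symm)
        (C.hcomp (C.id2 (T.right (f'.obj i') b')) (τ (f.obj i) (g.obj j))) := by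
  rw [compLeftEntry, tensoratorEntry_self τ f g hF, Mat.one_self (f'.right T b'),
    add_comm (g.h j), sub_self, zero_mul, koszul_zero, one_smul, map_smul, map_smul]

include hM in
/-- In the threefold sum of the matrix product, only the term with the indices of the source is
nonzero; there the claim is the multiplicativity of `τ`. -/
theorem tensoratorEntry_comp_left (m m' : Fin (f'.comp f).len) (j j' : Fin g.len)
    {i₁' i₂' : Fin f'.len} {i₁ i₂ : Fin f.len} {j₁ j₂ : Fin g.len} (hj : j₁ = j) (hj' : j₂ = j')
    (hl : i₁' = m.divNat) (hi : i₁ = m.modNat) (hl' : i₂' = m'.divNat) (hi' : i₂ = m'.modNat) :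
    HEq (tensoratorEntry τ (f'.comp f) g m j j' m')
      (∑ l, ∑ j, ∑ i, C.vcomp
        (koszul k ((f.h i₂ - f.h i) * (f'.h l + g.h j)) •
          C.hcomp (tensoratorEntry τ f' g l j j₂ i₂') (Mat.one (f.right T b) i i₂))
        (compLeftEntry hC τ f' f g i₁' i₁ j₁ l j i)) := by
  subst hi hi' hl hj hl' hj'
  have hs : C.comp (T.right (C.comp (f'.obj m.divNat) (f.obj m.modNat)) b') (T.left a (g.obj j₁))
      = C.comp (T.right (f'.obj m.divNat) b') (C.comp (T.right (f.obj m.modNat) b')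
        (T.left a (g.obj j₁))) := by
    rw [hM.right_comp, hC.comp_assoc]
  have ht : C.comp (T.left a'' (g.obj j₂)) (T.right (C.comp (f'.obj m'.divNat) (f.obj m'.modNat)) b)
      = C.comp (C.comp (T.left a'' (g.obj j₂)) (T.right (f'.obj m'.divNat) b))
        (T.right (f.obj m'.modNat) b) := by
    rw [hM.right_comp, hC.comp_assoc]
  rw [Finset.sum_eq_single m.divNat, Finset.sum_eq_single j₁, Finset.sum_eq_single m.modNat]
  · rw [compLeftEntry_self]
    by_cases e : m = m' ∧ j₁ = j₂
    · obtain ⟨rfl, rfl⟩ := e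
      rw [tensoratorEntry_self τ (f'.comp f) g hF, tensoratorEntry_self τ f' g hF,
        Mat.one_self (f.right T b)]
      simp only [map_smul, LinearMap.smul_apply, smul_smul, ← koszul_add]
      refine TwoCatData.smul_heq rfl rfl (heq_of_eq hs) (heq_of_eq ht) ?_
        (hM.tensorator_comp_left _ _ _)
      congr 1
      ring
    · rw [tensoratorEntry_ne τ (f'.comp f) g e]
      have h0 : C.hcomp (tensoratorEntry τ f' g m.divNat j₁ j₂ m'.divNat)
          (Mat.one (f.right T b) m.modNat m'.modNat) = 0 := by
        by_cases h1 : m.modNat = m'.modNat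
        · rw [tensoratorEntry_ne τ f' g fun h2 => e ⟨Fin.divNat_modNat_ext h2.1 h1, h2.2⟩, map_zero,
            LinearMap.zero_apply]
        · rw [Mat.one_ne (f.right T b) h1, map_zero]
      rw [h0, smul_zero, map_zero, LinearMap.zero_apply]
      exact TwoCatData.zero_heq rfl rfl (heq_of_eq hs) (heq_of_eq ht)
  · intro i _ h
    rw [compLeftEntry_ne hC τ f' f g fun e => h e.2.1.symm, map_zero]
  · simp
  · intro j _ h
    refine Finset.sum_eq_zero fun i _ => ?_
    rw [compLeftEntry_ne hC τ f' f g fun e => h e.2.2.symm, map_zero]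
  · simp
  · intro l _ h
    refine Finset.sum_eq_zero fun j _ => Finset.sum_eq_zero fun i _ => ?_
    rw [compLeftEntry_ne hC τ f' f g fun e => h e.1.symm, map_zero]
  · simp

end Left

theorem Cx.tensorator_comp_left {a a' a'' b b' : C.Obj} (f' : Cx C a' a'') (f : Cx C a a')
    (g : Cx C b b') :
    HEq (Cx.tensorator hM (Cx.comp hF f' f) g)
      (Cx.vcomp hF (Cx.hcomp hF (Cx.tensorator hM f' g) (Cx.id2 hF (Cx.right hL f b)))
        (Cx.vcomp hF ((KbLoc hF).eqTo (Cx.comp_assoc hC (Cx.right hL f' b') (Cx.left hL a' g)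
            (Cx.right hL f b)).symm)
          (Cx.hcomp hF (Cx.id2 hF (Cx.right hL f' b')) (Cx.tensorator hM f g)))) := by
  have e := (Cx.comp_assoc hC (Cx.right hL f' b') (Cx.left hL a' g) (Cx.right hL f b)).symm
  have h1 := Mat.heq_compLeft hC τ f'.toSusp f.toSusp g.toSusp
  have hm : Mat.hcomp (Mat.one (f'.toSusp.right T b')) (Mat.tensorator τ f.toSusp g.toSusp) ∈
      Cx.chainMaps (Cx.comp hF (Cx.right hL f' b') (Cx.comp hF (Cx.right hL f b') (Cx.left hL a g)))
        (Cx.comp hF (Cx.right hL f' b') (Cx.comp hF (Cx.left hL a' g) (Cx.right hL f b))) :=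
    Cx.hcomp_mem_chainMaps hF (Cx.one_mem_chainMaps hF (Cx.right hL f' b'))
      (koszulTensorator_mem_chainMaps hM f g)
  -- the identification of the two bracketings is absorbed into the first factor
  have hm' := Cx.mem_chainMaps_of_heq e h1 hm
  have h2 := TwoCatData.vcomp_eqTo_vcomp (C := KbLoc hF) (KbLoc.isLocallyFunctorial hF) e
    (Cx.hcomp hF (Cx.tensorator hM f' g) (Cx.id2 hF (Cx.right hL f b)))
    (x := SubQuot.cls _ hm) (x' := SubQuot.cls _ hm')
    (Cx.cls_heq rfl rfl HEq.rfl (heq_of_eq e) _ _ h1)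
  refine HEq.trans ?_ (heq_of_eq h2.symm)
  refine Cx.cls_heq_of_apply rfl rfl
    (heq_of_eq (by rw [Cx.right_comp hM, Cx.comp_assoc hC]))
    (heq_of_eq (by rw [Cx.right_comp hM, Cx.comp_assoc hC])) _ _ fun p p' r r' hp hr => ?_
  obtain ⟨h1, h2, h3⟩ := Fin.divNat_divNat_eq hp
  obtain ⟨h1', h2', h3'⟩ := Fin.divNat_divNat_eq hr.symm
  refine HEq.trans (tensoratorEntry_comp_left hC τ hM f'.toSusp f.toSusp g.toSusp _ _ _ _
    h3.symm h1' h1.symm h2.symm h2' h3') (heq_of_eq ?_)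
  exact (Fin.sum_divNat_divNat _).symm

set_option maxHeartbeats 2000000 in
/-- The homotopy categories of complexes over a semistrict monoidal 2-category form a semistrict
monoidal 2-category. -/
theorem KbLoc.isSemistrictMonoidal :
    IsSemistrictMonoidal (KbLoc.isLocallyGradedTwoCategory hC) (KbTensor hF hL)
      (Cx.tensorator hM) where
  toIsLocallyFunctorial := KbTensor.isLocallyFunctorial hF hL
  left_one := Cx.left_one hM
  left_comp := Cx.left_comp hM
  left2_hcomp := Cx.left2_hcomp hM
  right_one := Cx.right_one hM
  right_comp := Cx.right_comp hM
  right2_hcomp := Cx.right2_hcomp hM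
  unit_obj := hM.unit_obj
  unit_left := Cx.unit_left hM
  unit_left2 := Cx.unit_left2 hM
  obj_unit := hM.obj_unit
  right_unit := Cx.right_unit hM
  right2_unit := Cx.right2_unit hM
  obj_assoc := hM.obj_assoc
  left_left := Cx.left_left hM
  left2_left2 := Cx.left2_left2 hM
  right_left := Cx.right_left hM
  right2_left2 := Cx.right2_left2 hM
  right_right := Cx.right_right hM
  right2_right2 := Cx.right2_right2 hM
  tensorator_deg := Cx.tensorator_deg hM
  tensorator_iso := Cx.tensorator_iso hM
  tensorator_left := Cx.tensorator_left hM
  tensorator_mid := Cx.tensorator_mid hM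
  tensorator_right := Cx.tensorator_right hM
  tensorator_one_left := Cx.tensorator_one_left hM
  tensorator_one_right := Cx.tensorator_one_right hM
  tensorator_natural_left := Cx.tensorator_natural_left hM
  tensorator_natural_right := Cx.tensorator_natural_right hM
  tensorator_comp_right := Cx.tensorator_comp_right hM
  tensorator_comp_left := Cx.tensorator_comp_left hM

end Classes

end Tensorators

/-! ### The diagrams form a locally graded 2-category -/

section DiagLaws

theorem DWord.heq {m m' n n' : ℕ} (hm : m = m') (hn : n = n') {f : DWord m n} {f' : DWord m' n'}
    (h : f.letters = f'.letters) : HEq f f' := by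
  subst hm hn
  obtain ⟨l, _, _⟩ := f
  obtain ⟨l', _, _⟩ := f'
  obtain rfl : l = l' := h
  rfl

theorem DWord.ext' {m n : ℕ} {f f' : DWord m n} (h : f.letters = f'.letters) : f = f' :=
  eq_of_heq (DWord.heq rfl rfl h)

/-- Classes of equal linear combinations of diagrams are heterogeneously equal as soon as their
boundary words have the same letters. -/
theorem DWord.cls_heq {m m' n n' : ℕ} (hm : m = m') (hn : n = n') {f g : DWord m n}
    {f' g' : DWord m' n'} (hf : f.letters = f'.letters) (hg : g.letters = g'.letters) {x x' : Alg}
    (hx : x ∈ paths m f.letters g.letters) (hx' : x' ∈ paths m' f'.letters g'.letters)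
    (h : x = x') :
    HEq (SubQuot.cls x hx : DWord.Hom2 f g) (SubQuot.cls x' hx' : DWord.Hom2 f' g') := by
  subst hm hn h
  obtain rfl := DWord.ext' hf
  obtain rfl := DWord.ext' hg
  rfl

theorem whisk_nil_nil (x : Alg) : whisk [] [] x = x := by
  have : whisk [] [] = AlgHom.id ℂ Alg := by
    ext s
    simp [whisk, Step.whisk]
  exact DFunLike.congr_fun this x

theorem whisk_st (u v l r : List ℕ) (g : Gen) : whisk u v (st l g r) = st (u ++ l) g (r ++ v) := by
  simp [whisk, st, Step.whisk]

theorem juxtapose_assoc (u v s t : List ℕ) (z y x : Alg) :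
    juxtapose (u ++ s) t (juxtapose u v z y) x
      = juxtapose u (v ++ t) z (juxtapose s t y x) := by
  simp [juxtapose_apply, whisk_whisk, mul_assoc]

/-- The algebra homomorphism which records the degrees of diagrams as exponents. -/
noncomputable def degMap : Alg →ₐ[ℂ] AddMonoidAlgebra Alg ℤ :=
  FreeAlgebra.lift ℂ fun s => AddMonoidAlgebra.single s.gen.degree (FreeAlgebra.ι ℂ s)

/-- `x` is a linear combination of words in the steps of total degree `d`, where the steps need not
be composable. -/
def IsHomogeneous (x : Alg) (d : ℤ) : Prop := degMap x = AddMonoidAlgebra.single d x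

theorem degMap_st (l : List ℕ) (g : Gen) (r : List ℕ) :
    degMap (st l g r) = AddMonoidAlgebra.single g.degree (st l g r) := by
  simp [degMap, st]

theorem IsHomogeneous.mul {x y : Alg} {d e : ℤ} (hx : IsHomogeneous x d) (hy : IsHomogeneous y e) :
    IsHomogeneous (x * y) (d + e) := by
  rw [IsHomogeneous, map_mul, hx, hy, AddMonoidAlgebra.single_mul_single]

theorem isHomogeneous_diag (L : List Step) :
    IsHomogeneous (diag L) (L.map fun s => s.gen.degree).sum := by
  induction L with
  | nil => exact map_one degMap
  | cons s L ih =>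
    rw [diag_cons, List.map_cons, List.sum_cons]
    exact IsHomogeneous.mul (degMap_st s.l s.gen s.r) ih

theorem IsHomogeneous.whisk {x : Alg} {d : ℤ} (hx : IsHomogeneous x d) (u v : List ℕ) :
    IsHomogeneous (SoergelGray.whisk u v x) d := by
  have h : degMap.comp (SoergelGray.whisk u v) =
      (AddMonoidAlgebra.mapAlgHom ℤ (SoergelGray.whisk u v)).comp degMap := by
    refine FreeAlgebra.hom_ext (funext fun s => ?_)
    change degMap (SoergelGray.whisk u v (st s.l s.gen s.r)) =
      AddMonoidAlgebra.mapAlgHom ℤ (SoergelGray.whisk u v) (degMap (st s.l s.gen s.r))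
    rw [whisk_st, degMap_st, degMap_st, AddMonoidAlgebra.mapAlgHom_single]
    exact congrArg _ (whisk_st u v s.l s.r s.gen).symm
  have h1 := DFunLike.congr_fun h x
  have h2 : degMap x = AddMonoidAlgebra.single d x := hx
  rw [AlgHom.comp_apply, AlgHom.comp_apply, h2, AddMonoidAlgebra.mapAlgHom_single] at h1
  exact h1

set_option linter.unusedSimpArgs false in
/-- All the defining relations are homogeneous. -/
theorem BasicRel.isHomogeneous {n : ℕ} {s t : List ℕ} {ρ : Alg} (h : BasicRel n s t ρ) :
    ∃ d, IsHomogeneous ρ d := by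
  cases h
  case interchange s s' t t' L M hL hM =>
    refine ⟨(L.map fun s => s.gen.degree).sum + (M.map fun s => s.gen.degree).sum, ?_⟩
    have h1 := ((isHomogeneous_diag L).whisk [] t).mul ((isHomogeneous_diag M).whisk s' [])
    have h2 := ((isHomogeneous_diag M).whisk s []).mul ((isHomogeneous_diag L).whisk [] t')
    rw [IsHomogeneous, map_sub, h1, h2, add_comm, ← AddMonoidAlgebra.single_sub]
  all_goals
    simp only [IsHomogeneous, cap, cup, map_sub, map_add, map_mul, map_one, map_smul,
      degMap_st, AddMonoidAlgebra.single_mul_single, Gen.degree, AddMonoidAlgebra.one_def,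
      AddMonoidAlgebra.smul_single, ← AddMonoidAlgebra.single_sub,
      ← AddMonoidAlgebra.single_add, Int.reduceAdd, Int.reduceNeg]
    exact ⟨_, rfl⟩

/-- The homogeneous component of degree `d`. -/
noncomputable def degComp (d : ℤ) : Alg →ₗ[ℂ] Alg where
  toFun x := (degMap x).coeff d
  map_add' x y := by rw [map_add, AddMonoidAlgebra.coeff_add]; rfl
  map_smul' c x := by rw [map_smul, AddMonoidAlgebra.coeff_smul]; rfl

theorem IsHomogeneous.degComp_eq {x : Alg} {d : ℤ} (h : IsHomogeneous x d) (e : ℤ) :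
    degComp e x = if d = e then x else 0 := by
  change (degMap x).coeff e = _
  rw [show degMap x = AddMonoidAlgebra.single d x from h, AddMonoidAlgebra.coeff_single,
    Finsupp.single_apply]

theorem isHomogeneous_of_mem {n : ℕ} {w w' : List ℕ} {d : ℤ} {x : Alg}
    (hx : x ∈ homogeneous n w w' d) : IsHomogeneous x d := by
  induction hx using Submodule.span_induction with
  | mem x h =>
    obtain ⟨L, -, hd, rfl⟩ := h
    exact hd ▸ isHomogeneous_diag L
  | zero => rw [IsHomogeneous, map_zero, AddMonoidAlgebra.single_zero]
  | add x y _ _ hx hy => rw [IsHomogeneous, map_add, hx, hy, ← AddMonoidAlgebra.single_add]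
  | smul c x _ hx => rw [IsHomogeneous, map_smul, hx, AddMonoidAlgebra.smul_single]

/-- Taking components of fixed degree is a grading of the linear combinations of diagrams. -/
theorem isGradingProjection_degComp (n : ℕ) (w w' : List ℕ) :
    IsGradingProjection (paths n w w') (homogeneous n w w') degComp where
  mem d := map_mem_of_span (degComp d) (N := paths n w w' ⊓ homogeneous n w w' d) (by
    rintro _ ⟨L, hL, rfl⟩
    rw [(isHomogeneous_diag L).degComp_eq]
    split_ifs with h
    · exact ⟨diag_mem_paths hL, Submodule.subset_span ⟨L, hL, h, rfl⟩⟩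
    · exact Submodule.zero_mem _)
  self d x hx := by rw [(isHomogeneous_of_mem hx).degComp_eq, if_pos rfl]
  other d e hde x hx := by rw [(isHomogeneous_of_mem hx).degComp_eq, if_neg hde]
  sum x hx := by
    induction hx using Submodule.span_induction with
    | mem x h =>
      obtain ⟨L, -, rfl⟩ := h
      refine ⟨{(L.map fun s => s.gen.degree).sum}, fun t ht => ?_⟩
      simp only [(isHomogeneous_diag L).degComp_eq]
      rw [Finset.sum_ite_eq, if_pos (ht (Finset.mem_singleton_self _))]
    | zero => exact ⟨∅, fun t _ => by simp⟩
    | add x y _ _ hx hy =>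
      obtain ⟨s, hs⟩ := hx
      obtain ⟨s', hs'⟩ := hy
      refine ⟨s ∪ s', fun t ht => ?_⟩
      simp only [map_add, Finset.sum_add_distrib]
      rw [hs t (Finset.union_subset_left ht), hs' t (Finset.union_subset_right ht)]
    | smul c x _ hx =>
      obtain ⟨s, hs⟩ := hx
      refine ⟨s, fun t ht => ?_⟩
      simp only [map_smul, ← Finset.smul_sum]
      rw [hs t ht]

/-- The relations form a graded submodule, as they are generated by homogeneous elements. -/
theorem degComp_mem_relations {n : ℕ} {w w' : List ℕ} (d : ℤ) :
    ∀ x ∈ relations n w w', degComp d x ∈ relations n w w' :=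
  map_mem_of_span (degComp d) (by
    rintro _ ⟨u, v, s, t, ρ, L, M, hρ, hL, hM, rfl⟩
    obtain ⟨e, he⟩ := hρ.isHomogeneous
    rw [(((isHomogeneous_diag L).mul (he.whisk u v)).mul (isHomogeneous_diag M)).degComp_eq]
    split_ifs
    · exact Submodule.subset_span ⟨u, v, s, t, ρ, L, M, hρ, hL, hM, rfl⟩
    · exact Submodule.zero_mem _)

theorem Diag.isLocallyGradedTwoCategory : Diag.IsLocallyGradedTwoCategory where
  toIsLocallyFunctorial := Diag.isLocallyFunctorial
  isInternal := fun {a _} f g => (isGradingProjection_degComp a f.letters g.letters).isInternal_image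
    fun d => degComp_mem_relations d
  one_comp := fun f => DWord.ext' rfl
  comp_one := fun f => DWord.ext' (List.append_nil _)
  comp_assoc := fun h g f => DWord.ext' (List.append_assoc _ _ _)
  one_hcomp := by
    intro a b f f' α
    obtain ⟨x, hx, rfl⟩ := SubQuot.exists_cls α
    refine DWord.cls_heq rfl rfl rfl rfl _ hx ?_
    change juxtapose [] f.letters 1 x = x
    rw [juxtapose_apply, map_one, one_mul, whisk_nil_nil]
  hcomp_one := by
    intro a b f f' α
    obtain ⟨x, hx, rfl⟩ := SubQuot.exists_cls α
    refine DWord.cls_heq rfl rfl (List.append_nil _) (List.append_nil _) _ hx ?_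
    change juxtapose f'.letters [] x 1 = x
    rw [juxtapose_apply, map_one, mul_one, whisk_nil_nil]
  hcomp_assoc := by
    intro a b c d h h' g g' f f' γ β α
    obtain ⟨z, hz, rfl⟩ := SubQuot.exists_cls γ
    obtain ⟨y, hy, rfl⟩ := SubQuot.exists_cls β
    obtain ⟨x, hx, rfl⟩ := SubQuot.exists_cls α
    exact DWord.cls_heq rfl rfl (List.append_assoc _ _ _) (List.append_assoc _ _ _) _ _
      (juxtapose_assoc _ _ _ _ z y x)

end DiagLaws

/-! ### Equality of diagrams modulo relations -/

section Crossings

variable {n : ℕ}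

/-- Two linear combinations of diagrams from `w` to `w'` are equal modulo the relations.
That both are such combinations is part of the definition, so that composition preserves it. -/
structure DEq (n : ℕ) (w w' : List ℕ) (x y : Alg) : Prop where
  left_mem : x ∈ paths n w w'
  right_mem : y ∈ paths n w w'
  sub_mem : x - y ∈ relations n w w'

theorem DEq.refl {w w' : List ℕ} {x : Alg} (h : x ∈ paths n w w') : DEq n w w' x x :=
  ⟨h, h, by rw [sub_self]; exact Submodule.zero_mem _⟩

theorem DEq.symm {w w' : List ℕ} {x y : Alg} (h : DEq n w w' x y) : DEq n w w' y x :=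
  ⟨h.2, h.1, by rw [← neg_sub]; exact Submodule.neg_mem _ h.3⟩

theorem DEq.trans {w w' : List ℕ} {x y z : Alg} (h : DEq n w w' x y) (h' : DEq n w w' y z) :
    DEq n w w' x z :=
  ⟨h.1, h'.2, by rw [← sub_add_sub_cancel x y z]; exact Submodule.add_mem _ h.3 h'.3⟩

theorem DEq.add {w w' : List ℕ} {x y x' y' : Alg} (h : DEq n w w' x y) (h' : DEq n w w' x' y') :
    DEq n w w' (x + x') (y + y') :=
  ⟨Submodule.add_mem _ h.1 h'.1, Submodule.add_mem _ h.2 h'.2, by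
    rw [add_sub_add_comm]; exact Submodule.add_mem _ h.3 h'.3⟩

theorem DEq.smul {w w' : List ℕ} {x y : Alg} (c : ℂ) (h : DEq n w w' x y) :
    DEq n w w' (c • x) (c • y) :=
  ⟨Submodule.smul_mem _ c h.1, Submodule.smul_mem _ c h.2, by
    rw [← smul_sub]; exact Submodule.smul_mem _ c h.3⟩

theorem DEq.mul {w w' w'' : List ℕ} {x y x' y' : Alg} (h : DEq n w w' x y)
    (h' : DEq n w' w'' x' y') : DEq n w w'' (x * x') (y * y') :=
  ⟨mul_mem_paths _ h.1 _ h'.1, mul_mem_paths _ h.2 _ h'.2, by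
    rw [show x * x' - y * y' = (x - y) * x' + y * (x' - y') by noncomm_ring]
    exact Submodule.add_mem _ (mul_mem_relations_left _ h.3 _ h'.1)
      (mul_mem_relations_right _ h.2 _ h'.3)⟩

theorem DEq.whisk {w w' : List ℕ} {x y : Alg} (u v : List ℕ) (h : DEq n w w' x y) :
    DEq n (u ++ w ++ v) (u ++ w' ++ v) (SoergelGray.whisk u v x) (SoergelGray.whisk u v y) :=
  ⟨whisk_mem_paths u v _ h.1, whisk_mem_paths u v _ h.2, by
    rw [← map_sub]; exact whisk_mem_relations u v _ h.3⟩

/-- Change of the boundary words along equalities. -/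
theorem DEq.cast {w w' v v' : List ℕ} {x y : Alg} (h : DEq n w w' x y) (hw : w = v) (hw' : w' = v') :
    DEq n v v' x y := by
  subst hw hw'
  exact h

theorem DEq.cls_eq {w w' : List ℕ} {x y : Alg} (h : DEq n w w' x y) :
    (SubQuot.cls x h.1 : DHom n w w') = SubQuot.cls y h.2 := SubQuot.cls_eq _ _ h.3

theorem DEq.interchange {s s' t t' : List ℕ} {x y : Alg} (hx : x ∈ paths n s s')
    (hy : y ∈ paths n t t') : DEq n (s ++ t) (s' ++ t')
      (SoergelGray.whisk [] t x * SoergelGray.whisk s' [] y)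
      (SoergelGray.whisk s [] y * SoergelGray.whisk [] t' x) := by
  refine ⟨?_, ?_, interchange_mem_relations x hx y hy⟩
  · exact mul_mem_paths _ (whisk_mem_paths [] t x hx) _ (by simpa using whisk_mem_paths s' [] y hy)
  · refine mul_mem_paths (w' := s ++ t') _ ?_ _ (whisk_mem_paths [] t' x hx)
    simpa using whisk_mem_paths s [] y hy

theorem st_mem_paths {g : Gen} (hg : g.Ok n) (l r : List ℕ) :
    st l g r ∈ paths n (l ++ g.src ++ r) (l ++ g.tgt ++ r) := by
  have h : IsPath n (l ++ g.src ++ r) [⟨l, g, r⟩] (l ++ g.tgt ++ r) := ⟨hg, rfl, rfl⟩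
  simpa [diag, st] using diag_mem_paths h

/-- A basic relation between two elements that are known to be combinations of diagrams. -/
theorem BasicRel.dEq {s t : List ℕ} {x y : Alg} (h : BasicRel n s t (x - y))
    (hx : x ∈ paths n s t) (hy : y ∈ paths n s t) : DEq n s t x y := by
  refine ⟨hx, hy, Submodule.subset_span ⟨[], [], s, t, _, [], [], h, ?_, ?_, ?_⟩⟩
  · simp [IsPath]
  · simp [IsPath]
  · rw [diag_nil, one_mul, mul_one, whisk_nil_nil]

/-! ### Cups, caps and crossings of distant strands -/

theorem cap_mem_paths {i : ℕ} (hi : IsColor n i) (l r : List ℕ) :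
    cap i l r ∈ paths n (l ++ [i, i] ++ r) (l ++ [] ++ r) :=
  mul_mem_paths _ (st_mem_paths (g := .merge i) hi l r) _ (st_mem_paths (g := .enddot i) hi l r)

theorem cup_mem_paths {i : ℕ} (hi : IsColor n i) (l r : List ℕ) :
    cup i l r ∈ paths n (l ++ [] ++ r) (l ++ [i, i] ++ r) :=
  mul_mem_paths _ (st_mem_paths (g := .startdot i) hi l r) _ (st_mem_paths (g := .split i) hi l r)

theorem whisk_cap (u v l r : List ℕ) (i : ℕ) : whisk u v (cap i l r) = cap i (u ++ l) (r ++ v) := by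
  simp only [cap, map_mul, whisk_st]

theorem whisk_cup (u v l r : List ℕ) (i : ℕ) : whisk u v (cup i l r) = cup i (u ++ l) (r ++ v) := by
  simp only [cup, map_mul, whisk_st]

section OneColor

variable {i : ℕ} (hi : IsColor n i)
include hi

theorem unit_left_dEq : DEq n [i] [i] (st [] (.startdot i) [i] * st [] (.merge i) []) 1 :=
  (BasicRel.unit_left hi).dEq (mul_mem_paths _ (st_mem_paths (g := .startdot i) hi [] [i]) _
    (st_mem_paths (g := .merge i) hi [] [])) (one_mem_paths _ _)

theorem unit_right_dEq : DEq n [i] [i] (st [i] (.startdot i) [] * st [] (.merge i) []) 1 :=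
  (BasicRel.unit_right hi).dEq (mul_mem_paths _ (st_mem_paths (g := .startdot i) hi [i] []) _
    (st_mem_paths (g := .merge i) hi [] [])) (one_mem_paths _ _)

theorem counit_left_dEq : DEq n [i] [i] (st [] (.split i) [] * st [] (.enddot i) [i]) 1 :=
  (BasicRel.counit_left hi).dEq (mul_mem_paths _ (st_mem_paths (g := .split i) hi [] []) _
    (st_mem_paths (g := .enddot i) hi [] [i])) (one_mem_paths _ _)

theorem counit_right_dEq : DEq n [i] [i] (st [] (.split i) [] * st [i] (.enddot i) []) 1 :=
  (BasicRel.counit_right hi).dEq (mul_mem_paths _ (st_mem_paths (g := .split i) hi [] []) _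
    (st_mem_paths (g := .enddot i) hi [i] [])) (one_mem_paths _ _)

theorem frobenius_left_dEq : DEq n [i, i] [i, i] (st [] (.split i) [i] * st [i] (.merge i) [])
    (st [] (.merge i) [] * st [] (.split i) []) :=
  (BasicRel.frobenius_left hi).dEq
    (mul_mem_paths _ (st_mem_paths (g := .split i) hi [] [i]) _
      (st_mem_paths (g := .merge i) hi [i] []))
    (mul_mem_paths _ (st_mem_paths (g := .merge i) hi [] []) _
      (st_mem_paths (g := .split i) hi [] []))

theorem frobenius_right_dEq : DEq n [i, i] [i, i] (st [i] (.split i) [] * st [] (.merge i) [i])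
    (st [] (.merge i) [] * st [] (.split i) []) :=
  (BasicRel.frobenius_right hi).dEq
    (mul_mem_paths _ (st_mem_paths (g := .split i) hi [i] []) _
      (st_mem_paths (g := .merge i) hi [] [i]))
    (mul_mem_paths _ (st_mem_paths (g := .merge i) hi [] []) _
      (st_mem_paths (g := .split i) hi [] []))

/-- A split is a cup followed by a merge. -/
theorem split_dEq : DEq n [i] [i, i] (st [] (.split i) [])
    (cup i [] [i] * st [i] (.merge i) []) := by
  have h1 := (DEq.refl (st_mem_paths (g := .startdot i) hi [] [i])).mul (frobenius_left_dEq hi)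
  have h2 := (unit_left_dEq hi).mul (DEq.refl (st_mem_paths (g := .split i) hi [] []))
  rw [one_mul, mul_assoc] at h2
  rw [← mul_assoc] at h1
  exact (h1.trans h2).symm

/-- A start dot is a cup whose right end is capped off by an end dot. -/
theorem startdot_dEq :
    DEq n [] [i] (st [] (.startdot i) []) (cup i [] [] * st [i] (.enddot i) []) := by
  have h := (DEq.refl (st_mem_paths (g := .startdot i) hi [] [])).mul (counit_right_dEq hi)
  rw [mul_one, ← mul_assoc] at h
  exact h.symm

/-- Cup and cap are adjoint: a bent strand can be straightened. -/
theorem zigzag_left_dEq : DEq n [i] [i] (cup i [] [i] * cap i [i] []) 1 := by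
  have h := (split_dEq hi).symm.mul (DEq.refl (st_mem_paths (g := .enddot i) hi [i] []))
  rw [mul_assoc] at h
  exact h.trans (counit_right_dEq hi)

/-- Cup and cap are adjoint: the other way to bend a strand. -/
theorem zigzag_right_dEq : DEq n [i] [i] (cup i [i] [] * cap i [] [i]) 1 := by
  have h1 := (DEq.refl (st_mem_paths (g := .startdot i) hi [i] [])).mul (frobenius_right_dEq hi)
  have h2 := (unit_right_dEq hi).mul (DEq.refl (st_mem_paths (g := .split i) hi [] []))
  rw [one_mul, mul_assoc] at h2
  have h3 := ((h1.trans h2).mul (DEq.refl (st_mem_paths (g := .enddot i) hi [] [i]))).trans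
    (counit_left_dEq hi)
  simp only [mul_assoc] at h3
  simp only [cup, cap, mul_assoc]
  exact h3

end OneColor

section TwoColors

variable {i j : ℕ} (hi : IsColor n i) (hj : IsColor n j) (hij : Distant i j)

theorem Distant.symm {i j : ℕ} (h : Distant i j) : Distant j i := Or.symm h

include hi hj hij

theorem cross_mem_paths (l r : List ℕ) :
    st l (.cross i j) r ∈ paths n (l ++ [i, j] ++ r) (l ++ [j, i] ++ r) :=
  st_mem_paths (g := .cross i j) ⟨hi, hj, hij⟩ l r

theorem enddot_slide_dEq :
    DEq n [i, j] [j] (st [] (.enddot i) [j]) (st [] (.cross i j) [] * st [j] (.enddot i) []) :=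
  ((BasicRel.cross_dot hi hj hij).dEq (mul_mem_paths _ (cross_mem_paths hi hj hij [] []) _
    (st_mem_paths (g := .enddot i) hi [j] [])) (st_mem_paths (g := .enddot i) hi [] [j])).symm

theorem merge_slide_dEq : DEq n [i, i, j] [j, i] (st [] (.merge i) [j] * st [] (.cross i j) [])
    (st [i] (.cross i j) [] * st [] (.cross i j) [i] * st [j] (.merge i) []) :=
  (BasicRel.cross_merge hi hj hij).dEq
    (mul_mem_paths _ (st_mem_paths (g := .merge i) hi [] [j]) _ (cross_mem_paths hi hj hij [] []))
    (mul_mem_paths _ (mul_mem_paths _ (cross_mem_paths hi hj hij [i] []) _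
      (cross_mem_paths hi hj hij [] [i])) _ (st_mem_paths (g := .merge i) hi [j] []))

theorem cross_rotation_dEq : DEq n [j, i] [i, j] (st [] (.cross j i) [])
    (cup i [] [j, i] * st [i] (.cross i j) [i] * cap i [i, j] []) :=
  ((BasicRel.cross_rotation hi hj hij).dEq
    (mul_mem_paths _ (mul_mem_paths _ (cup_mem_paths hi [] [j, i]) _
      (cross_mem_paths hi hj hij [i] [i])) _ (cap_mem_paths hi [i, j] []))
    (cross_mem_paths hj hi hij.symm [] [])).symm

/-- A cap slides through a distant strand, as the merge and the end dot do. -/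
theorem cap_slide_dEq : DEq n [i, i, j] [j] (cap i [] [j])
    (st [i] (.cross i j) [] * st [] (.cross i j) [i] * cap i [j] []) := by
  have h1 := (DEq.refl (st_mem_paths (g := .merge i) hi [] [j])).mul (enddot_slide_dEq hi hj hij)
  have h2 := (merge_slide_dEq hi hj hij).mul (DEq.refl (st_mem_paths (g := .enddot i) hi [j] []))
  rw [← mul_assoc] at h1
  have h3 := h1.trans h2
  simp only [mul_assoc] at h3
  simp only [cap, mul_assoc]
  exact h3

/-- The second Reidemeister move for distant strands: the second crossing is a rotation of the first
one, past which the cap of the rotation slides, and the cup and the cap then form a zigzag. -/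
theorem cross_mul_cross_dEq :
    DEq n [i, j] [i, j] (st [] (.cross i j) [] * st [] (.cross j i) []) 1 := by
  have h1 := (DEq.refl (cross_mem_paths hi hj hij [] [])).mul (cross_rotation_dEq hi hj hij)
  have h2 := (DEq.interchange (cup_mem_paths hi [] []) (cross_mem_paths hi hj hij [] [])).symm.mul
    (DEq.refl (mul_mem_paths _ (cross_mem_paths hi hj hij [i] [i]) _ (cap_mem_paths hi [i, j] [])))
  have h3 := (DEq.refl (cup_mem_paths hi [] [i, j])).mul
    ((cap_slide_dEq hi hj hij).symm.whisk [i] [])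
  have h4 := (zigzag_left_dEq hi).whisk [] [j]
  simp only [whisk_st, whisk_cup, whisk_cap, map_mul, map_one, List.nil_append, List.append_nil,
    List.cons_append, mul_assoc] at h1 h2 h3 h4
  exact h1.trans (h2.trans (h3.trans h4))

/-- A cup slides through a distant strand. By the rotation relation and a
zigzag, letting one leg of the cup cross the strand from either side gives the same diagram; the
crossing of the other leg is then undone by the second Reidemeister move. -/
theorem cup_slide_dEq : DEq n [j] [j, i, i]
    (cup i [] [j] * (st [i] (.cross i j) [] * st [] (.cross i j) [i])) (cup i [j] []) := by
  -- the cup with one leg across the strand, rewritten by rotating the crossing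
  have a1 := (DEq.refl (cup_mem_paths hi [j] [])).mul ((cross_rotation_dEq hi hj hij).whisk [] [i])
  have a2 := (DEq.interchange (cup_mem_paths hi [] []) (cup_mem_paths hi [j] [])).symm.mul
    (DEq.refl (mul_mem_paths _ (cross_mem_paths hi hj hij [i] [i, i]) _
      (cap_mem_paths hi [i, j] [i])))
  have a3 := (DEq.refl (cup_mem_paths hi [] [j])).mul
    ((DEq.interchange (cross_mem_paths hi hj hij [i] []) (cup_mem_paths hi [] [])).symm.mul
      (DEq.refl (cap_mem_paths hi [i, j] [i])))
  have a4 := (DEq.refl (mul_mem_paths _ (cup_mem_paths hi [] [j]) _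
    (cross_mem_paths hi hj hij [i] []))).mul ((zigzag_right_dEq hi).whisk [i, j] [])
  simp only [whisk_st, whisk_cup, whisk_cap, map_mul, map_one, List.nil_append, List.append_nil,
    List.cons_append, mul_assoc, mul_one] at a1 a2 a3 a4
  -- add the crossing of the other leg
  have h1 := (a1.trans (a2.trans (a3.trans a4))).symm.mul
    (DEq.refl (cross_mem_paths hi hj hij [] [i]))
  have h2 := (DEq.refl (cup_mem_paths hi [j] [])).mul
    ((cross_mul_cross_dEq hj hi hij.symm).whisk [] [i])
  simp only [whisk_st, map_mul, map_one, List.nil_append, List.cons_append, mul_assoc, mul_one]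
    at h1 h2
  exact h1.trans h2

end TwoColors

end Crossings

/-! ### Shuffle crossings of words -/

section Shuffles

variable {n : ℕ}

/-- The shuffle crossing as an element of `Alg`. -/
noncomputable def cr (u v : List ℕ) : Alg := diag (crossing u v)

theorem cr_nil_left (v : List ℕ) : cr [] v = 1 := rfl

theorem crossRow_eq_crossing (i : ℕ) (v : List ℕ) : diag (crossRow i v) = cr [i] v := by
  rw [cr, crossing, crossing, List.map_nil, List.nil_append, ← whisk_diag, whisk_nil_nil]

theorem cr_cons (i : ℕ) (u v : List ℕ) :
    cr (i :: u) v = whisk [i] [] (cr u v) * whisk [] u (cr [i] v) := by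
  rw [← crossRow_eq_crossing, cr, cr, crossing, diag_append, whisk_diag, whisk_diag]

theorem cr_nil_right (u : List ℕ) : cr u [] = 1 := by
  induction u with
  | nil => rfl
  | cons i u ih =>
    rw [cr_cons, ih, ← crossRow_eq_crossing, crossRow, diag_nil, map_one, map_one, one_mul]

theorem cr_singleton_cons (i j : ℕ) (v : List ℕ) :
    cr [i] (j :: v) = st [] (.cross i j) v * whisk [j] [] (cr [i] v) := by
  rw [← crossRow_eq_crossing, ← crossRow_eq_crossing, crossRow, diag_cons, whisk_diag]
  rfl

theorem cr_singleton_singleton (i j : ℕ) : cr [i] [j] = st [] (.cross i j) [] := by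
  rw [cr_singleton_cons, cr_nil_right, map_one, mul_one]

/-- Unlike in the second argument, in the first argument this holds without using relations. -/
theorem cr_append_left (u₁ u₂ v : List ℕ) :
    cr (u₁ ++ u₂) v = whisk u₁ [] (cr u₂ v) * whisk [] u₂ (cr u₁ v) := by
  induction u₁ with
  | nil => simp [cr_nil_left, whisk_nil_nil]
  | cons i u₁ ih =>
    rw [List.cons_append, cr_cons, ih, cr_cons i u₁]
    simp [whisk_whisk, mul_assoc]

theorem cr_singleton_append (i : ℕ) (v₁ v₂ : List ℕ) :
    cr [i] (v₁ ++ v₂) = whisk [] v₂ (cr [i] v₁) * whisk v₁ [] (cr [i] v₂) := by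
  induction v₁ with
  | nil => simp [cr_nil_right, whisk_nil_nil]
  | cons j v₁ ih =>
    rw [List.cons_append, cr_singleton_cons, ih, cr_singleton_cons i j v₁]
    simp [whisk_whisk, mul_assoc, whisk_st]

theorem map_shift_crossRow (a i : ℕ) (v : List ℕ) :
    (crossRow i v).map (Step.shift a) = crossRow (a + i) (v.map (a + ·)) := by
  induction v with
  | nil => rfl
  | cons j v ih =>
    simp [crossRow, ← ih, Step.shift, Step.whisk, Gen.shift]

theorem shift_cr (a : ℕ) (u v : List ℕ) :
    shift a (cr u v) = cr (u.map (a + ·)) (v.map (a + ·)) := by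
  induction u with
  | nil => exact map_one (shift a)
  | cons i u ih =>
    rw [cr_cons, map_mul, shift_whisk, shift_whisk, ih, ← crossRow_eq_crossing, shift_diag,
      map_shift_crossRow, crossRow_eq_crossing]
    exact (cr_cons (a + i) (u.map (a + ·)) _).symm

/-- All colors of `u` are distant from all colors of `v`; this includes that they are colors of the
object `n`, unless one of the words is empty. -/
def Crossable (n : ℕ) (u v : List ℕ) : Prop := ∀ i ∈ u, ∀ j ∈ v, (Gen.cross i j).Ok n

theorem Crossable.symm {u v : List ℕ} (h : Crossable n u v) : Crossable n v u :=
  fun i hi j hj => ⟨(h j hj i hi).2.1, (h j hj i hi).1, (h j hj i hi).2.2.symm⟩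

theorem crossable_append_left {u₁ u₂ v : List ℕ} :
    Crossable n (u₁ ++ u₂) v ↔ Crossable n u₁ v ∧ Crossable n u₂ v :=
  ⟨fun h => ⟨fun i hi => h i (by simp [hi]), fun i hi => h i (by simp [hi])⟩,
    fun h i hi => (List.mem_append.1 hi).elim (h.1 i) (h.2 i)⟩

theorem crossable_append_right {u v₁ v₂ : List ℕ} :
    Crossable n u (v₁ ++ v₂) ↔ Crossable n u v₁ ∧ Crossable n u v₂ :=
  ⟨fun h => ⟨fun i hi j hj => h i hi j (by simp [hj]), fun i hi j hj => h i hi j (by simp [hj])⟩,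
    fun h i hi j hj => (List.mem_append.1 hj).elim (h.1 i hi j) (h.2 i hi j)⟩

theorem Crossable.cr_mem {u v : List ℕ} (h : Crossable n u v) :
    cr u v ∈ paths n (u ++ v) (v ++ u) :=
  diag_mem_paths (isPath_crossing u v h)

theorem whisk_mem_paths_left {w w' : List ℕ} (u : List ℕ) {x : Alg} (hx : x ∈ paths n w w') :
    whisk u [] x ∈ paths n (u ++ w) (u ++ w') := by
  simpa using whisk_mem_paths u [] x hx

theorem whisk_mem_paths_right {w w' : List ℕ} (v : List ℕ) {x : Alg} (hx : x ∈ paths n w w') :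
    whisk [] v x ∈ paths n (w ++ v) (w' ++ v) :=
  whisk_mem_paths [] v x hx

theorem DEq.whisk_left {w w' : List ℕ} {x y : Alg} (u : List ℕ) (h : DEq n w w' x y) :
    DEq n (u ++ w) (u ++ w') (SoergelGray.whisk u [] x) (SoergelGray.whisk u [] y) :=
  (h.whisk u []).cast (List.append_nil _) (List.append_nil _)

theorem DEq.whisk_right {w w' : List ℕ} {x y : Alg} (v : List ℕ) (h : DEq n w w' x y) :
    DEq n (w ++ v) (w' ++ v) (SoergelGray.whisk [] v x) (SoergelGray.whisk [] v y) :=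
  h.whisk [] v

/-- Crossing a concatenation of words amounts to crossing one word after the other. -/
theorem cr_append_right_dEq {u v₁ v₂ : List ℕ} (h₁ : Crossable n u v₁) (h₂ : Crossable n u v₂) :
    DEq n (u ++ (v₁ ++ v₂)) (v₁ ++ v₂ ++ u) (cr u (v₁ ++ v₂))
      (whisk [] v₂ (cr u v₁) * whisk v₁ [] (cr u v₂)) := by
  induction u with
  | nil =>
    simp only [cr_nil_left, map_one, mul_one]
    exact (DEq.refl (one_mem_paths n (v₁ ++ v₂))).cast rfl (List.append_nil _).symm
  | cons i u ih =>
    have e₁ := (crossable_append_left (u₁ := [i])).1 h₁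
    have e₂ := (crossable_append_left (u₁ := [i])).1 h₂
    have a1 := ((ih e₁.2 e₂.2).whisk_left [i]).mul
      (((DEq.refl (crossable_append_right.2 ⟨e₁.1, e₂.1⟩).cr_mem).whisk_right u).cast
        (List.append_assoc [i] _ _) rfl)
    have a2 := (DEq.interchange e₁.1.cr_mem e₂.2.cr_mem).symm
    have a3 := ((DEq.refl (whisk_mem_paths_left [i] (whisk_mem_paths_right v₂ e₁.2.cr_mem))).mul
      ((a2.cast (v := [i] ++ (v₁ ++ u ++ v₂)) (v' := v₁ ++ ([i] ++ v₂) ++ u) (by simp) (by simp)).mul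
      ((DEq.refl (whisk_mem_paths_right u (whisk_mem_paths_left v₁ e₂.1.cr_mem))))))
    rw [cr_cons, cr_cons i u v₁, cr_cons i u v₂]
    rw [cr_singleton_append] at a1 ⊢
    simp only [map_mul, whisk_whisk, List.nil_append, List.append_nil, mul_assoc] at a1 a2 a3 ⊢
    exact (a1.trans (a3.cast (by simp) (by simp))).cast (by simp) (by simp)

theorem cr_singleton_mul_dEq {i : ℕ} {v : List ℕ} (h : Crossable n [i] v) :
    DEq n (i :: v) (i :: v) (cr [i] v * cr v [i]) 1 := by
  induction v with
  | nil =>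
    rw [cr_nil_left, cr_nil_right, mul_one]
    exact DEq.refl (one_mem_paths _ _)
  | cons j v ih =>
    have e := (crossable_append_right (v₁ := [j])).1 h
    obtain ⟨hi, hj, hij⟩ := e.1 i (by simp) j (by simp)
    have a1 := (DEq.refl (cross_mem_paths hi hj hij [] v)).mul (((ih e.2).whisk_left [j]).mul
      (DEq.refl (cross_mem_paths hj hi hij.symm [] v)))
    have a2 := (cross_mul_cross_dEq hi hj hij).whisk_right v
    rw [cr_singleton_cons, cr_cons j, cr_singleton_singleton]
    simp only [map_mul, map_one, one_mul, whisk_st, List.nil_append, mul_assoc] at a1 a2 ⊢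
    exact a1.trans a2

/-- Shuffle crossings are invertible. -/
theorem cr_mul_cr_dEq {u v : List ℕ} (h : Crossable n u v) :
    DEq n (u ++ v) (u ++ v) (cr u v * cr v u) 1 := by
  induction u with
  | nil =>
    rw [cr_nil_left, cr_nil_right, mul_one]
    exact DEq.refl (one_mem_paths _ _)
  | cons i u ih =>
    have e := (crossable_append_left (u₁ := [i])).1 h
    have a0 := (DEq.refl h.cr_mem).mul (cr_append_right_dEq e.1.symm e.2.symm)
    have a1 := (DEq.refl (whisk_mem_paths_left [i] e.2.cr_mem)).mul
      ((((cr_singleton_mul_dEq e.1).whisk_right u).cast (v := [i] ++ (v ++ u))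
        (v' := [i] ++ (v ++ u)) (by simp) (by simp)).mul
      (DEq.refl (whisk_mem_paths_left [i] e.2.symm.cr_mem)))
    have a2 := (ih e.2).whisk_left [i]
    rw [cr_cons] at a0
    rw [cr_cons]
    simp only [map_mul, map_one, one_mul, mul_assoc, List.cons_append, List.nil_append]
      at a0 a1 a2 ⊢
    exact a0.trans (a1.trans a2)

/-! ### Diagrams slide through distant strands -/

/-- The combination of diagrams `x` from `s` to `t`, with the strands `v` to its right, may be moved
through these strands. -/
def Slides (n : ℕ) (v s t : List ℕ) (x : Alg) : Prop :=
  DEq n (s ++ v) (v ++ t) (whisk [] v x * cr t v) (cr s v * whisk v [] x)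

theorem Slides.mul {v s t r : List ℕ} {x y : Alg} (hx : x ∈ paths n s t) (hy : y ∈ paths n t r)
    (h : Slides n v s t x) (h' : Slides n v t r y) : Slides n v s r (x * y) := by
  have a1 := (DEq.refl (whisk_mem_paths_right v hx)).mul h'
  have a2 := DEq.mul h (DEq.refl (whisk_mem_paths_left v hy))
  simp only [Slides, map_mul, mul_assoc] at a1 a2 ⊢
  exact a1.trans a2

theorem Slides.congr {v s t : List ℕ} {x y : Alg} (hs : Crossable n s v) (ht : Crossable n t v)
    (hxy : DEq n s t x y) (h : Slides n v s t y) : Slides n v s t x :=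
  ((hxy.whisk_right v).mul (DEq.refl ht.cr_mem)).trans
    (h.trans ((DEq.refl hs.cr_mem).mul (hxy.whisk_left v)).symm)

theorem Slides.one {v s : List ℕ} (hs : Crossable n s v) : Slides n v s s 1 := by
  simp only [Slides, map_one, one_mul, mul_one]
  exact DEq.refl hs.cr_mem

theorem Slides.zero (v s t : List ℕ) : Slides n v s t 0 := by
  simp only [Slides, map_zero, zero_mul, mul_zero]
  exact DEq.refl (Submodule.zero_mem _)

theorem Slides.add {v s t : List ℕ} {x y : Alg} (h : Slides n v s t x) (h' : Slides n v s t y) :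
    Slides n v s t (x + y) := by
  simpa only [Slides, map_add, add_mul, mul_add] using DEq.add h h'

theorem Slides.smul {v s t : List ℕ} {x : Alg} (c : ℂ) (h : Slides n v s t x) :
    Slides n v s t (c • x) := by
  simpa only [Slides, map_smul, smul_mul_assoc, mul_smul_comm] using DEq.smul c h

theorem Slides.whisk_left {v s t u : List ℕ} {x : Alg} (hx : x ∈ paths n s t)
    (hs : Crossable n s v) (hu : Crossable n u v) (h : Slides n v s t x) :
    Slides n v (u ++ s) (u ++ t) (whisk u [] x) := by
  have a1 := (DEq.whisk_left u h).mul
    ((DEq.refl (whisk_mem_paths_right t hu.cr_mem)).cast (List.append_assoc _ _ _) rfl)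
  have a2 := (DEq.refl (whisk_mem_paths_left u hs.cr_mem)).mul
    ((DEq.interchange hu.cr_mem hx).symm.cast (List.append_assoc _ _ _) rfl)
  rw [Slides, cr_append_left, cr_append_left]
  simp only [map_mul, whisk_whisk, List.nil_append, List.append_nil, mul_assoc] at a1 a2 ⊢
  exact (a1.trans a2).cast (List.append_assoc _ _ _).symm (List.append_assoc _ _ _)

theorem Slides.whisk_right {v s t u : List ℕ} {x : Alg} (hx : x ∈ paths n s t)
    (ht : Crossable n t v) (hu : Crossable n u v) (h : Slides n v s t x) :
    Slides n v (s ++ u) (t ++ u) (whisk [] u x) := by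
  have a1 := (DEq.interchange hx hu.cr_mem).mul
    ((DEq.refl (whisk_mem_paths_right u ht.cr_mem)).cast (List.append_assoc _ _ _) rfl)
  have a2 := (DEq.refl (whisk_mem_paths_left s hu.cr_mem)).mul
    ((DEq.whisk_right u h).cast (List.append_assoc _ _ _) rfl)
  rw [Slides, cr_append_left, cr_append_left]
  simp only [map_mul, whisk_whisk, List.nil_append, List.append_nil, mul_assoc] at a1 a2 ⊢
  exact (a1.trans a2).cast (List.append_assoc _ _ _).symm (List.append_assoc _ _ _)

theorem Slides.append {v₁ v₂ s t : List ℕ} {x : Alg} (hs₁ : Crossable n s v₁)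
    (hs₂ : Crossable n s v₂) (ht₁ : Crossable n t v₁) (ht₂ : Crossable n t v₂)
    (hx : x ∈ paths n s t) (h₁ : Slides n v₁ s t x) (h₂ : Slides n v₂ s t x) :
    Slides n (v₁ ++ v₂) s t x := by
  have a1 := (DEq.refl (whisk_mem_paths_right (v₁ ++ v₂) hx)).mul (cr_append_right_dEq ht₁ ht₂)
  have a2 := (DEq.whisk_right v₂ h₁).mul
    ((DEq.refl (whisk_mem_paths_left v₁ ht₂.cr_mem)).cast (List.append_assoc _ _ _).symm rfl)
  have a3 := (DEq.refl (whisk_mem_paths_right v₂ hs₁.cr_mem)).mul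
    ((DEq.whisk_left v₁ h₂).cast (List.append_assoc _ _ _).symm rfl)
  have a4 := (cr_append_right_dEq hs₁ hs₂).symm.mul
    (DEq.refl (whisk_mem_paths_left (v₁ ++ v₂) hx))
  simp only [Slides, map_mul, whisk_whisk, List.nil_append, List.append_nil, mul_assoc]
    at a1 a2 a3 a4 ⊢
  exact a1.trans (((a2.trans a3).cast (List.append_assoc _ _ _) (List.append_assoc _ _ _).symm).trans
    a4)

/-- The generator `g` can be moved through a strand of color `j`: its colors are distant from `j`,
and its variable is invariant under the transposition `(j, j + 1)`. -/
def Gen.Apart (j : ℕ) : Gen → Prop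
  | merge i => Distant i j
  | split i => Distant i j
  | startdot i => Distant i j
  | enddot i => Distant i j
  | six i i' => Distant i j ∧ Distant i' j
  | cross i i' => Distant i j ∧ Distant i' j
  | box k => k ≠ j ∧ k ≠ j + 1

theorem crossable_cons {i : ℕ} {u v : List ℕ} :
    Crossable n (i :: u) v ↔ Crossable n [i] v ∧ Crossable n u v :=
  crossable_append_left (u₁ := [i])

theorem crossable_nil {v : List ℕ} : Crossable n [] v := fun _ h => absurd h (by simp)

theorem crossable_singleton {i j : ℕ} :
    Crossable n [i] [j] ↔ IsColor n i ∧ IsColor n j ∧ Distant i j := by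
  simp [Crossable, Gen.Ok]

theorem Gen.Ok.crossable {g : Gen} {j : ℕ} (hg : g.Ok n) (hj : IsColor n j) (h : g.Apart j) :
    Crossable n g.src [j] ∧ Crossable n g.tgt [j] := by
  cases g
  case box k => exact ⟨crossable_nil, crossable_nil⟩
  case six i i' =>
    have h1 := crossable_singleton.2 ⟨hg.1, hj, h.1⟩
    have h2 := crossable_singleton.2 ⟨hg.2.1, hj, h.2⟩
    simp [Gen.src, Gen.tgt, crossable_cons (u := _ :: _), h1, h2]
  case cross i i' =>
    have h1 := crossable_singleton.2 ⟨hg.1, hj, h.1⟩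
    have h2 := crossable_singleton.2 ⟨hg.2.1, hj, h.2⟩
    simp [Gen.src, Gen.tgt, crossable_cons (u := _ :: _), h1, h2]
  all_goals
    have h1 := crossable_singleton.2 ⟨hg, hj, h⟩
    simp [Gen.src, Gen.tgt, crossable_cons (u := _ :: _), h1, crossable_nil]

/-- The defining relations say that most of the generators slide through a distant strand; the
remaining ones are obtained from these and cups. -/
theorem Gen.Ok.slides {g : Gen} {j : ℕ} (hg : g.Ok n) (hj : IsColor n j) (h : g.Apart j) :
    Slides n [j] g.src g.tgt (st [] g []) := by
  have cc : ∀ i i', cr [i, i'] [j] = st [i] (.cross i' j) [] * st [] (.cross i j) [i'] := by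
    intro i i'
    rw [cr_cons, cr_singleton_singleton, cr_singleton_singleton, whisk_st, whisk_st]
    rfl
  have ccc : ∀ i i' l, cr [i, i', l] [j] =
      st [i, i'] (.cross l j) [] * (st [i] (.cross i' j) [l] * st [] (.cross i j) [i', l]) := by
    intro i i' l
    rw [cr_cons, cc, cr_singleton_singleton, map_mul, whisk_st, whisk_st, whisk_st, mul_assoc]
    rfl
  have hmerge : ∀ i, IsColor n i → Distant i j → Slides n [j] [i, i] [i] (st [] (.merge i) []) := by
    intro i hi h
    have := merge_slide_dEq hi hj h
    rw [Slides, cc, cr_singleton_singleton, whisk_st, whisk_st]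
    exact this
  have henddot : ∀ i, IsColor n i → Distant i j → Slides n [j] [i] [] (st [] (.enddot i) []) := by
    intro i hi h
    have := enddot_slide_dEq hi hj h
    rw [Slides, cr_nil_left, cr_singleton_singleton, whisk_st, whisk_st, mul_one]
    exact this
  have hcup : ∀ i, IsColor n i → Distant i j → Slides n [j] [] [i, i] (cup i [] []) := by
    intro i hi h
    have := cup_slide_dEq hi hj h
    rw [Slides, cr_nil_left, cc, whisk_cup, whisk_cup, one_mul]
    exact this
  cases g
  case merge i => exact hmerge i hg h
  case enddot i => exact henddot i hg h
  case startdot i =>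
    have hij := crossable_singleton.2 ⟨hg, hj, h⟩
    have h1 := (henddot i hg h).whisk_left (st_mem_paths (g := .enddot i) hg [] []) hij hij
    have h2 := Slides.mul (cup_mem_paths hg [] []) (whisk_mem_paths_left [i]
      (st_mem_paths (g := .enddot i) hg [] [])) (hcup i hg h) h1
    rw [whisk_st] at h2
    exact Slides.congr crossable_nil hij (startdot_dEq hg) h2
  case split i =>
    have hij := crossable_singleton.2 ⟨hg, hj, h⟩
    have hii := crossable_cons.2 ⟨hij, hij⟩
    have h1 := (hmerge i hg h).whisk_left (st_mem_paths (g := .merge i) hg [] []) hii hij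
    have h2 := (hcup i hg h).whisk_right (cup_mem_paths hg [] []) hii hij
    have h3 := Slides.mul (whisk_mem_paths_right [i] (cup_mem_paths hg [] []))
      (whisk_mem_paths_left [i] (st_mem_paths (g := .merge i) hg [] [])) h2 h1
    rw [whisk_st, whisk_cup] at h3
    exact Slides.congr hij hii (split_dEq hg) h3
  case six i i' =>
    have hi := fun l r => cross_mem_paths hg.1 hj h.1 l r
    have hi' := fun l r => cross_mem_paths hg.2.1 hj h.2 l r
    have h1 := (BasicRel.six_cross hg.1 hg.2.1 hj hg.2.2 h.1 h.2).dEq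
      (mul_mem_paths _ (mul_mem_paths _ (mul_mem_paths _
        (st_mem_paths (g := .six i i') hg [] [j]) _ (hi' [i', i] [])) _ (hi [i'] [i'])) _
        (hi' [] [i, i']))
      (mul_mem_paths _ (mul_mem_paths _ (mul_mem_paths _ (hi [i, i'] []) _ (hi' [i] [i])) _
        (hi [] [i', i])) _ (st_mem_paths (g := .six i i') hg [j] []))
    rw [Slides, Gen.src, Gen.tgt, ccc, ccc, whisk_st, whisk_st]
    simp only [mul_assoc] at h1 ⊢
    exact h1
  case cross i i' =>
    have hi := fun l r => cross_mem_paths hg.1 hj h.1 l r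
    have hi' := fun l r => cross_mem_paths hg.2.1 hj h.2 l r
    have h1 := (BasicRel.cross_cross hg.1 hg.2.1 hj hg.2.2 h.1 h.2).dEq
      (mul_mem_paths _ (mul_mem_paths _ (st_mem_paths (g := .cross i i') hg [] [j]) _
        (hi [i'] [])) _ (hi' [] [i]))
      (mul_mem_paths _ (mul_mem_paths _ (hi' [i] []) _ (hi [] [i'])) _
        (st_mem_paths (g := .cross i i') hg [j] []))
    rw [Slides, Gen.src, Gen.tgt, cc, cc, whisk_st, whisk_st]
    simp only [mul_assoc] at h1 ⊢
    exact h1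
  case box k =>
    have h1 := BasicRel.box_slide hj hg
    rw [if_neg h.1, if_neg h.2, sub_zero, zero_smul, sub_zero,
      Equiv.swap_apply_of_ne_of_ne h.1 h.2] at h1
    have h2 := h1.dEq (st_mem_paths (g := .box k) hg [] [j]) (st_mem_paths (g := .box k) hg [j] [])
    rw [Slides, Gen.src, Gen.tgt, cr_nil_left, whisk_st, whisk_st, mul_one, one_mul]
    exact h2

/-- The step `s` can be moved through the strands `v`. -/
def Step.Apart (n : ℕ) (v : List ℕ) (s : Step) : Prop :=
  s.gen.Ok n ∧ Crossable n s.l v ∧ Crossable n s.r v ∧ ∀ j ∈ v, IsColor n j ∧ s.gen.Apart j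

theorem Gen.Ok.crossable_word {g : Gen} {v : List ℕ} (hg : g.Ok n)
    (h : ∀ j ∈ v, IsColor n j ∧ g.Apart j) : Crossable n g.src v ∧ Crossable n g.tgt v :=
  ⟨fun i hi j hj => (hg.crossable (h j hj).1 (h j hj).2).1 i hi j (by simp),
    fun i hi j hj => (hg.crossable (h j hj).1 (h j hj).2).2 i hi j (by simp)⟩

theorem Gen.Ok.slides_word {g : Gen} {v : List ℕ} (hg : g.Ok n)
    (h : ∀ j ∈ v, IsColor n j ∧ g.Apart j) : Slides n v g.src g.tgt (st [] g []) := by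
  have hx : st [] g [] ∈ paths n g.src g.tgt := by simpa using st_mem_paths hg [] []
  induction v with
  | nil =>
    rw [Slides, cr_nil_right, cr_nil_right, whisk_nil_nil, mul_one, one_mul]
    exact (DEq.refl hx).cast (List.append_nil _).symm rfl
  | cons j v ih =>
    have h1 : ∀ l ∈ v, IsColor n l ∧ g.Apart l := fun l hl => h l (List.mem_cons_of_mem _ hl)
    obtain ⟨hj, hgj⟩ := h j List.mem_cons_self
    have c1 := hg.crossable hj hgj
    have c2 := hg.crossable_word h1
    exact Slides.append (v₁ := [j]) c1.1 c2.1 c1.2 c2.2 hx (hg.slides hj hgj) (ih h1)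

theorem Step.Apart.slides {s : Step} {v : List ℕ} (h : s.Apart n v) :
    Slides n v (s.l ++ s.gen.src ++ s.r) (s.l ++ s.gen.tgt ++ s.r) (st s.l s.gen s.r) := by
  obtain ⟨hg, hl, hr, hv⟩ := h
  have hx : st [] s.gen [] ∈ paths n s.gen.src s.gen.tgt := by simpa using st_mem_paths hg [] []
  have c := hg.crossable_word hv
  have h1 := (hg.slides_word hv).whisk_left hx c.1 hl
  have h2 := h1.whisk_right (whisk_mem_paths_left s.l hx) (crossable_append_left.2 ⟨hl, c.2⟩) hr
  rw [whisk_whisk, whisk_st] at h2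
  simpa using h2

/-- Diagrams all of whose steps are apart from the strands `v` slide through these strands. -/
theorem slides_diag {v : List ℕ} : ∀ {L : List Step} {w w' : List ℕ}, IsPath n w L w' →
    Crossable n w v → (∀ s ∈ L, s.Apart n v) → Slides n v w w' (diag L)
  | [], _, _, h, hw, _ => by cases h; exact Slides.one hw
  | s :: L, w, w', h, hw, hL => by
    obtain ⟨hg, rfl, h'⟩ := h
    have hs := hL s List.mem_cons_self
    have c := hg.crossable_word hs.2.2.2
    rw [diag_cons]
    refine Slides.mul (st_mem_paths hg s.l s.r) (diag_mem_paths h') hs.slides ?_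
    exact slides_diag h' (crossable_append_left.2 ⟨crossable_append_left.2 ⟨hs.2.1, c.2⟩,
      hs.2.2.1⟩) fun t ht => hL t (List.mem_cons_of_mem _ ht)

/-- If a diagram slides through the strands `v` to its right, then also through the strands `v` to its
left, since shuffle crossings are invertible. -/
theorem Slides.symm {v s t : List ℕ} {x : Alg} (hx : x ∈ paths n s t) (hs : Crossable n s v)
    (ht : Crossable n t v) (h : Slides n v s t x) :
    DEq n (v ++ s) (t ++ v) (whisk v [] x * cr v t) (cr v s * whisk [] v x) := by
  have a1 := (cr_mul_cr_dEq hs.symm).symm.mul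
    (DEq.refl (mul_mem_paths _ (whisk_mem_paths_left v hx) _ ht.symm.cr_mem))
  have a2 := (DEq.refl hs.symm.cr_mem).mul ((DEq.symm h).mul (DEq.refl ht.symm.cr_mem))
  have a3 := (DEq.refl (mul_mem_paths _ hs.symm.cr_mem _ (whisk_mem_paths_right v hx))).mul
    (cr_mul_cr_dEq ht)
  simp only [mul_assoc, one_mul, mul_one] at a1 a2 a3
  exact a1.trans (a2.trans a3)

end Shuffles

/-! ### The diagrams form a semistrict monoidal 2-category -/

section DiagMonoidal

/-- Variant of `DWord.cls_heq` for combinations of diagrams which are equal modulo the relations. -/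
theorem DWord.cls_heq_of_dEq {m m' n n' : ℕ} (hm : m = m') (hn : n = n') {f g : DWord m n}
    {f' g' : DWord m' n'} (hf : f.letters = f'.letters) (hg : g.letters = g'.letters) {x x' : Alg}
    (hx : x ∈ paths m f.letters g.letters) (hx' : x' ∈ paths m' f'.letters g'.letters)
    (h : DEq m f.letters g.letters x x') :
    HEq (SubQuot.cls x hx : DWord.Hom2 f g) (SubQuot.cls x' hx' : DWord.Hom2 f' g') := by
  subst hm hn
  obtain rfl := DWord.ext' hf
  obtain rfl := DWord.ext' hg
  exact heq_of_eq h.cls_eq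

theorem map_zero_add (l : List ℕ) : l.map (0 + ·) = l := by simp

theorem map_add_add (a b : ℕ) (l : List ℕ) : l.map (a + b + ·) = (l.map (b + ·)).map (a + ·) := by
  simp [add_assoc]

theorem shift_zero (x : Alg) : shift 0 x = x := by
  have : shift 0 = AlgHom.id ℂ Alg := by
    ext ⟨l, g, r⟩
    cases g <;> simp [shift, Step.shift, Gen.shift]
  exact DFunLike.congr_fun this x

theorem shift_add (a b : ℕ) (x : Alg) : shift (a + b) x = shift a (shift b x) := by
  have : shift (a + b) = (shift a).comp (shift b) := by
    ext ⟨l, g, r⟩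
    cases g <;> simp [shift, Step.shift, Gen.shift, add_assoc]
  exact DFunLike.congr_fun this x

theorem shift_juxtapose (a : ℕ) (u v : List ℕ) (y x : Alg) :
    shift a (juxtapose u v y x)
      = juxtapose (u.map (a + ·)) (v.map (a + ·)) (shift a y) (shift a x) := by
  rw [juxtapose_apply, juxtapose_apply, map_mul, shift_whisk, shift_whisk]
  rfl

/-- The colors of the object `a` are distant from the colors of the object `b`, shifted by `a`. -/
theorem crossable_tensor {a b : ℕ} {u v : List ℕ} (hu : ∀ i ∈ u, IsColor a i)
    (hv : ∀ j ∈ v, IsColor b j) : Crossable (a + b) u (v.map (a + ·)) := by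
  intro i hi j hj
  obtain ⟨l, hl, rfl⟩ := List.mem_map.1 hj
  refine ⟨(hu i hi).mono b, (hv l hl).shift a, Or.inl ?_⟩
  have h3 := (hu i hi).2
  have h4 := (hv l hl).1
  omega

theorem Gen.Ok.isColor_tgt {n : ℕ} {g : Gen} (hg : g.Ok n) : ∀ i ∈ g.tgt, IsColor n i := by
  cases g
  case six i j => simpa [Gen.tgt] using ⟨hg.2.1, hg.1, hg.2.1⟩
  case cross i j => simpa [Gen.tgt] using ⟨hg.2.1, hg.1⟩
  case box k => exact fun _ h => absurd h List.not_mem_nil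
  case enddot i => exact fun _ h => absurd h List.not_mem_nil
  all_goals simpa [Gen.tgt] using (show IsColor n _ from hg)

/-- The steps of a diagram over `n` involve colors of `n` only. -/
theorem IsPath.isColor {n : ℕ} : ∀ {L : List Step} {w w' : List ℕ}, IsPath n w L w' →
    (∀ i ∈ w, IsColor n i) →
    ∀ s ∈ L, s.gen.Ok n ∧ (∀ i ∈ s.l, IsColor n i) ∧ ∀ i ∈ s.r, IsColor n i
  | [], _, _, _, _ => by simp
  | s :: L, w, w', h, hw => by
    obtain ⟨hg, rfl, h'⟩ := h
    simp only [List.mem_append] at hw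
    have hl : ∀ i ∈ s.l, IsColor n i := fun i hi => hw i (Or.inl (Or.inl hi))
    have hr : ∀ i ∈ s.r, IsColor n i := fun i hi => hw i (Or.inr hi)
    intro t ht
    rcases List.mem_cons.1 ht with rfl | ht
    · exact ⟨hg, hl, hr⟩
    · refine h'.isColor (fun i hi => ?_) t ht
      simp only [List.mem_append] at hi
      rcases hi with (hi | hi) | hi
      exacts [hl i hi, hg.isColor_tgt i hi, hr i hi]

/-- The generators over `a` are apart from all colors `j > a`; for boxes this uses `k ≤ a < j`. -/
theorem Gen.Ok.apart_of_lt {a j : ℕ} {g : Gen} (hg : g.Ok a) (hj : a < j) : g.Apart j := by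
  have h : ∀ i, IsColor a i → Distant i j := fun i hi => Or.inl (by have := hi.2; omega)
  cases g
  case six i i' => exact ⟨h _ hg.1, h _ hg.2.1⟩
  case cross i i' => exact ⟨h _ hg.1, h _ hg.2.1⟩
  case box k =>
    have := hg.2
    exact ⟨by omega, by omega⟩
  all_goals exact h _ hg

/-- Shifted generators are apart from the colors `j < a`; for boxes this uses `j + 1 < a + k`. -/
theorem Gen.Ok.shift_apart {a b j : ℕ} {g : Gen} (hg : g.Ok b) (hj : IsColor a j) :
    (g.shift a).Apart j := by
  have h : ∀ i, IsColor b i → Distant (a + i) j := fun i hi => Or.inr (by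
    have := hi.1
    have := hj.2
    omega)
  cases g
  case six i i' => exact ⟨h _ hg.1, h _ hg.2.1⟩
  case cross i i' => exact ⟨h _ hg.1, h _ hg.2.1⟩
  case box k =>
    have h1 : 1 ≤ k := hg.1
    have h2 := hj.2
    exact ⟨by omega, by omega⟩
  all_goals exact h _ hg

/-- Diagrams over `a` slide through strands which belong to the second tensor factor. -/
theorem slides_of_mem_paths {a b : ℕ} {u u' v : List ℕ} (hu : ∀ i ∈ u, IsColor a i)
    (hv : ∀ j ∈ v, IsColor b j) {x : Alg} (hx : x ∈ paths a u u') :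
    Slides (a + b) (v.map (a + ·)) u u' x := by
  induction hx using Submodule.span_induction with
  | mem x h =>
    obtain ⟨L, hL, rfl⟩ := h
    refine slides_diag (hL.mono b) (crossable_tensor hu hv) fun s hs => ?_
    obtain ⟨hg, hl, hr⟩ := hL.isColor hu s hs
    refine ⟨hg.mono b, crossable_tensor hl hv, crossable_tensor hr hv, fun j hj => ?_⟩
    obtain ⟨l, hl, rfl⟩ := List.mem_map.1 hj
    exact ⟨(hv l hl).shift a, hg.apart_of_lt (by have := (hv l hl).1; omega)⟩
  | zero => exact Slides.zero _ _ _
  | add x y _ _ hx hy => exact hx.add hy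
  | smul c x _ hx => exact hx.smul c

/-- Diagrams of the second tensor factor slide through strands of the first one. -/
theorem slides_shift_of_mem_paths {a b : ℕ} {u v v' : List ℕ} (hu : ∀ i ∈ u, IsColor a i)
    (hv : ∀ j ∈ v, IsColor b j) {x : Alg} (hx : x ∈ paths b v v') :
    Slides (a + b) u (v.map (a + ·)) (v'.map (a + ·)) (shift a x) := by
  induction hx using Submodule.span_induction with
  | mem x h =>
    obtain ⟨L, hL, rfl⟩ := h
    rw [shift_diag]
    refine slides_diag (hL.shift a) (crossable_tensor hu hv).symm fun t ht => ?_
    obtain ⟨s, hs, rfl⟩ := List.mem_map.1 ht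
    obtain ⟨hg, hl, hr⟩ := hL.isColor hv s hs
    exact ⟨hg.shift a, (crossable_tensor hu hl).symm, (crossable_tensor hu hr).symm,
      fun j hj => ⟨(hu j hj).mono b, hg.shift_apart (hu j hj)⟩⟩
  | zero => rw [map_zero]; exact Slides.zero _ _ _
  | add x y _ _ hx hy => rw [map_add]; exact hx.add hy
  | smul c x _ hx => rw [map_smul]; exact hx.smul c

theorem sum_degree_crossing (u v : List ℕ) :
    ((crossing u v).map fun s => s.gen.degree).sum = 0 := by
  have hrow : ∀ (i : ℕ) (v : List ℕ), ∀ s ∈ crossRow i v, s.gen.degree = 0 := by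
    intro i v
    induction v with
    | nil => simp [crossRow]
    | cons j v ih =>
      intro s hs
      rcases List.mem_cons.1 hs with rfl | hs
      · rfl
      · obtain ⟨t, ht, rfl⟩ := List.mem_map.1 hs
        exact ih t ht
  have h : ∀ s ∈ crossing u v, s.gen.degree = 0 := by
    induction u with
    | nil => simp [crossing]
    | cons i u ih =>
      intro s hs
      rcases List.mem_append.1 hs with hs | hs
      · obtain ⟨t, ht, rfl⟩ := List.mem_map.1 hs
        exact ih t ht
      · obtain ⟨t, ht, rfl⟩ := List.mem_map.1 hs
        exact hrow i v t ht
  exact List.sum_eq_zero fun d hd => by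
    obtain ⟨s, hs, rfl⟩ := List.mem_map.1 hd
    exact h s hs

theorem DWord.crossable {a a' b b' : ℕ} (f : DWord a a') (g : DWord b b') :
    Crossable (a + b) f.letters (g.letters.map (a + ·)) :=
  crossable_tensor f.valid g.valid

/-- The strict laws hold for words and diagrams on the nose; the shuffle crossings are invertible and
natural, and multiplicative in the second argument, modulo the relations. -/
theorem Diag.isSemistrictMonoidal :
    IsSemistrictMonoidal Diag.isLocallyGradedTwoCategory DiagTensor DiagTensorator where
  toIsLocallyFunctorial := DiagTensor.isLocallyFunctorial
  left_one := fun a b => rfl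
  left_comp := fun a _ _ _ g' g => DWord.ext' (List.map_append ..)
  left2_hcomp := by
    intro a b b' b'' g' h' g h β' β
    obtain ⟨y, hy, rfl⟩ := SubQuot.exists_cls β'
    obtain ⟨x, hx, rfl⟩ := SubQuot.exists_cls β
    exact DWord.cls_heq rfl rfl (List.map_append ..) (List.map_append ..) _ _
      (shift_juxtapose a _ _ y x)
  right_one := fun a b => rfl
  right_comp := fun f' f b => rfl
  right2_hcomp := by
    intro a a' a'' f' h' f h b α' α
    obtain ⟨y, hy, rfl⟩ := SubQuot.exists_cls α'
    obtain ⟨x, hx, rfl⟩ := SubQuot.exists_cls α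
    rfl
  unit_obj := Nat.zero_add
  unit_left := fun {b b'} g => DWord.heq (Nat.zero_add b) (Nat.zero_add b') (map_zero_add _)
  unit_left2 := by
    intro b b' g g' β
    obtain ⟨x, hx, rfl⟩ := SubQuot.exists_cls β
    exact DWord.cls_heq (Nat.zero_add b) (Nat.zero_add b') (map_zero_add _) (map_zero_add _) _ _
      (shift_zero x)
  obj_unit := Nat.add_zero
  right_unit := fun f => HEq.rfl
  right2_unit := by
    intro a a' f f' α
    obtain ⟨x, hx, rfl⟩ := SubQuot.exists_cls α
    rfl
  obj_assoc := Nat.add_assoc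
  left_left := fun a b {c c'} h => DWord.heq (Nat.add_assoc a b c) (Nat.add_assoc a b c')
    (map_add_add a b _)
  left2_left2 := by
    intro a b c c' h h' γ
    obtain ⟨x, hx, rfl⟩ := SubQuot.exists_cls γ
    exact DWord.cls_heq (Nat.add_assoc a b c) (Nat.add_assoc a b c') (map_add_add a b _)
      (map_add_add a b _) _ _ (shift_add a b x)
  right_left := fun a {b b'} g c => DWord.heq (Nat.add_assoc a b c) (Nat.add_assoc a b' c) rfl
  right2_left2 := by
    intro a b b' g g' β c
    obtain ⟨x, hx, rfl⟩ := SubQuot.exists_cls β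
    exact DWord.cls_heq (Nat.add_assoc a b c) (Nat.add_assoc a b' c) rfl rfl _ _ rfl
  right_right := fun {a a'} f b c => DWord.heq (Nat.add_assoc a b c) (Nat.add_assoc a' b c) rfl
  right2_right2 := by
    intro a a' f f' α b c
    obtain ⟨x, hx, rfl⟩ := SubQuot.exists_cls α
    exact DWord.cls_heq (Nat.add_assoc a b c) (Nat.add_assoc a' b c) rfl rfl _ _ rfl
  tensorator_deg := by
    intro a a' b b' f g
    obtain rfl : a = a' := f.eq
    obtain rfl : b = b' := g.eq
    exact SubQuot.mem_image.2 ⟨_, _, Submodule.subset_span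
      ⟨_, isPath_crossing _ _ (f.crossable g), sum_degree_crossing _ _, rfl⟩, rfl⟩
  tensorator_iso := by
    intro a a' b b' f g
    obtain rfl : a = a' := f.eq
    obtain rfl : b = b' := g.eq
    have h := f.crossable g
    exact ⟨SubQuot.cls (cr (DWord.left a g).letters f.letters) h.symm.cr_mem,
      (cr_mul_cr_dEq h).cls_eq, (cr_mul_cr_dEq h.symm).cls_eq⟩
  tensorator_left := by
    intro a b b' c c' g h
    have e := map_add_add a b h.letters
    obtain rfl : b = b' := g.eq
    refine DWord.cls_heq (Nat.add_assoc a b c) (Nat.add_assoc a b c') ?_ ?_ _ _ ?_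
    · exact (congrArg (List.append (DWord.left a g).letters) e).trans (List.map_append ..).symm
    · exact (congrArg (fun l => List.append l (DWord.left a g).letters) e).trans
        (List.map_append ..).symm
    · exact (congrArg (cr (DWord.left a g).letters) e).trans (shift_cr a _ _).symm
  tensorator_mid := by
    intro a a' c c' f b h
    have e := map_add_add a b h.letters
    obtain rfl : a = a' := f.eq
    exact DWord.cls_heq (Nat.add_assoc a b c) (Nat.add_assoc a b c')
      (congrArg (List.append f.letters) e) (congrArg (fun l => List.append l f.letters) e) _ _
      (congrArg (cr f.letters) e)
  tensorator_right := by
    intro a a' b b' f g c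
    exact DWord.cls_heq (Nat.add_assoc a b c).symm (Nat.add_assoc a' b' c).symm rfl rfl _ _ rfl
  tensorator_one_left := by
    intro a b b' g
    exact DWord.cls_heq rfl rfl rfl (List.append_nil _) _ _ rfl
  tensorator_one_right := by
    intro a a' f b
    exact DWord.cls_heq rfl rfl (List.append_nil _) rfl _ _ (cr_nil_right f.letters)
  tensorator_natural_left := by
    intro a a' b b' f f' α g
    obtain rfl : a = a' := f.eq
    obtain rfl : b = b' := g.eq
    obtain ⟨x, hx, rfl⟩ := SubQuot.exists_cls α
    refine SubQuot.cls_eq _ _ (cast (congrArg (· ∈ _) ?_)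
      (slides_of_mem_paths f.valid g.valid hx).sub_mem)
    change _ = juxtapose _ _ x 1 * cr _ _ - cr _ _ * juxtapose _ _ 1 x
    simp only [juxtapose_apply, map_one, mul_one, one_mul]
    rfl
  tensorator_natural_right := by
    intro a a' b b' f g g' β
    obtain rfl : a = a' := f.eq
    obtain rfl : b = b' := g.eq
    obtain ⟨x, hx, rfl⟩ := SubQuot.exists_cls β
    have h := (slides_shift_of_mem_paths f.valid g.valid hx).symm (shift_mem_paths a x hx)
      (f.crossable g).symm (f.crossable g').symm
    refine SubQuot.cls_eq _ _ (cast (congrArg (· ∈ _) ?_) h.sub_mem)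
    change _ = juxtapose _ _ 1 (shift a x) * cr _ _ - cr _ _ * juxtapose _ _ (shift a x) 1
    simp only [juxtapose_apply, map_one, mul_one, one_mul]
    rfl
  tensorator_comp_right := by
    intro a a' b b' b'' f g' g
    obtain rfl : a = a' := f.eq
    obtain rfl : b = b' := g.eq
    obtain rfl : b = b'' := g'.eq
    have h₁ := f.crossable g'
    have h₂ := f.crossable g
    have hx := whisk_mem_paths_right (DWord.left a g).letters h₁.cr_mem
    -- the identification of the two bracketings is absorbed into the first factor
    have e : HEq (Diag.hcomp (DiagTensorator f g') (Diag.id2 (DiagTensor.left a g)))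
        (SubQuot.cls (whisk [] (DWord.left a g).letters (cr f.letters (DWord.left a g').letters))
          (by simpa [DWord.comp, DWord.left, DWord.right] using! hx) :
          DWord.Hom2 (DWord.comp (DWord.comp (DWord.right f b) (DWord.left a g')) (DWord.left a g))
            (DWord.comp (DWord.left a g') (DWord.comp (DWord.right f b) (DWord.left a g)))) := by
      refine DWord.cls_heq rfl rfl rfl (List.append_assoc ..) _ _ ?_
      change juxtapose _ _ (cr _ _) 1 = _
      rw [juxtapose_apply, map_one, mul_one]
      rfl
    refine HEq.trans ?_
      (heq_of_eq (TwoCatData.vcomp_eqTo_vcomp Diag.isLocallyFunctorial _ _ e).symm)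
    have h := cr_append_right_dEq h₁ h₂
    rw [← List.map_append] at h
    refine DWord.cls_heq_of_dEq rfl rfl ?_ ?_ _ _ (cast (congrArg (DEq _ _ _ _) ?_) h)
    · exact (congrArg (List.append f.letters) List.map_append).trans (List.append_assoc ..).symm
    · exact (congrArg (fun l => List.append l f.letters) List.map_append).trans
        (List.append_assoc ..)
    · change _ = _ * juxtapose _ _ 1 (cr _ _)
      rw [juxtapose_apply, map_one, one_mul]
      rfl
  tensorator_comp_left := by
    intro a a' a'' b b' f' f g
    obtain rfl : a = a' := f.eq
    obtain rfl : b = b' := g.eq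
    obtain rfl : a = a'' := f'.eq
    have h₁ := f'.crossable g
    have h₂ := f.crossable g
    have hx := whisk_mem_paths_left f'.letters h₂.cr_mem
    -- the identification of the two bracketings is absorbed into the first factor
    have e : HEq (Diag.hcomp (Diag.id2 (DiagTensor.right f' b)) (DiagTensorator f g))
        (SubQuot.cls (whisk f'.letters [] (cr f.letters (DWord.left a g).letters))
          (by simpa [DWord.comp, DWord.left, DWord.right] using! hx) :
          DWord.Hom2 (DWord.comp (DWord.right f' b) (DWord.comp (DWord.right f b) (DWord.left a g)))
            (DWord.comp (DWord.comp (DWord.right f' b) (DWord.left a g)) (DWord.right f b))) := by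
      refine DWord.cls_heq rfl rfl rfl (List.append_assoc ..).symm _ _ ?_
      change juxtapose _ _ 1 (cr _ _) = _
      rw [juxtapose_apply, map_one, one_mul]
      rfl
    refine HEq.trans ?_
      (heq_of_eq (TwoCatData.vcomp_eqTo_vcomp Diag.isLocallyFunctorial _ _ e).symm)
    refine DWord.cls_heq rfl rfl (List.append_assoc ..) (List.append_assoc ..).symm _ _ ?_
    change cr (f'.letters ++ f.letters) _ = _ * juxtapose _ _ (cr _ _) 1
    rw [juxtapose_apply, map_one, mul_one, cr_append_left]
    rfl

end DiagMonoidal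

end SoergelGray

theorem mainTheorem8 :
    ∃ (hK : (SoergelGray.KbLoc SoergelGray.Diag.isLocallyFunctorial).IsLocallyGradedTwoCategory)
      (τ : (SoergelGray.KbTensor SoergelGray.Diag.isLocallyFunctorial
        SoergelGray.DiagTensor.isLocallyFunctorial).Tensorator),
      (∀ {a a' b b' : SoergelGray.Diag.Obj} (f : SoergelGray.Cx SoergelGray.Diag a a')
        (g : SoergelGray.Cx SoergelGray.Diag b b'),
        ∃ h : SoergelGray.koszulTensorator SoergelGray.Diag.isLocallyFunctorial
            SoergelGray.DiagTensor.isLocallyFunctorial SoergelGray.DiagTensorator f g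
              ∈ SoergelGray.Cx.chainMaps _ _,
          τ f g = SoergelGray.SubQuot.cls _ h) ∧
      SoergelGray.IsSemistrictMonoidal hK _ τ := by
  exact ⟨SoergelGray.KbLoc.isLocallyGradedTwoCategory SoergelGray.Diag.isLocallyGradedTwoCategory,
    SoergelGray.Cx.tensorator SoergelGray.Diag.isSemistrictMonoidal,
    fun f g => ⟨SoergelGray.koszulTensorator_mem_chainMaps SoergelGray.Diag.isSemistrictMonoidal f g,
      rfl⟩,
    SoergelGray.KbLoc.isSemistrictMonoidal SoergelGray.Diag.isSemistrictMonoidal⟩
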